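/- For each $n\ge 1$ let $y_i=d_i\beta+w_i^\top\gamma+\varepsilon_i$, $i=1,\dots,n$, where $d_i$ is a scalar, $w_i$ is a vector of controls of fixed dimension whose first component is a non-zero constant, and $\varepsilon_i=\sum_{l\le L}\sigma_l(d_i)\varepsilon^*_{l,i}$ with $L$ fixed and the vectors $e_i=(\varepsilon^*_{l,i})_{l\le L}$ square integrable with mean zero. All laws, parameters and functions $\sigma_l$ may depend on $n$; $K,\delta_1,\delta_2,\delta_3>0$ are constants that do not depend on $n$. Let $\hat\beta$ be the first component of the OLS estimator $(\mathbf X^\top\mathbf X)^{-1}\mathbf X^\top\mathbf Y$, where $\mathbf X$ has the rows $(d_i,w_i^\top)$ and $\mathbf Y=(y_i)_{i\le n}$. Assume: (1) $d_1,\dots,d_n$ are i.i.d. with mean $\mu_d$ and variance $\sigma_d^2\ge K^{-1}$, $(d_i)_{i\le n}$ is independent of $(w_i)_{i\le n}$, and $\max_{i\le n}\mathbb E|d_i|^{2+\delta_1}\le K$; (2) $\lambda_{\min}(n^{-1}\sum_i w_iw_i^\top)\ge K^{-1}+o_p(1)$ and $\max_{i\le n}\mathbb E\|w_i\|^2\le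 K$; (3) $n^{-1}\sum_i w_i\varepsilon_i=o_p(1)$, $n^{-1}\sum_i\varepsilon_i^2=n^{-1}\sum_i\mathbb E[\varepsilon_i^2]+o_p(1)$, $\max_{i\le n}\mathbb E|\varepsilon_i|^{2+\delta_2}\le K$, and $n^{-1}\sum_i\mathbb E[\varepsilon_i^2]\ge K^{-1}$. Put $d_i^*=d_i-\mu_d$, $A_i=d_i^*(\sigma_l(d_i))_{l\le L}$, $\mu_A=\mathbb E[A_i]$, $\sigma_{e,1}^2=n^{-1}\sum_i\mathbb E[((A_i-\mu_A)^\top e_i)^2]$, $\sigma_{e,2}^2=\mathbb E[(n^{-1/2}\sum_i\mu_A^\top e_i)^2]$ and $\sigma_{d\varepsilon}^2=\sigma_{e,1}^2+\sigma_{e,2}^2$. Assume moreover: (4) $(d_i)_{i\le n}$ is independent of $(e_i)_{i\le n}$, the $\sigma_l$ are bounded by $K$ on the values of $d_i$, and $\sigma_{e,1}^2\ge K^{-1}$; (5) $\|n^{-1}\sum_i e_ie_i^\top-n^{-1}\sum_i\mathbb E[e_ie_i^\top]\|=o_p(1)$, $n^{-1}\sum_i\|e_i\|^{2+\delta_3}=O_p(1)$,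 and $\sigma_{e,2}^{-1}n^{-1/2}\sum_i\mu_A^\top e_i\to_d N(0,1)$. Then, as $n\to\infty$, $$\frac{\sqrt n(\hat\beta-\beta)}{\sigma_{d\varepsilon}/\sigma_d^2}=\frac{n^{-1/2}\sum_{i=1}^n d_i^*\varepsilon_i}{\sigma_{d\varepsilon}}+o_p(1)\to_d N(0,1).$$ Moreover, for every $n\ge1$, the dependence of the errors across $i$ enters the variance only through the scalars $\mu_A^\top e_i$: $$\sigma_{d\varepsilon}^2=n^{-1}\sum_{i=1}^n\mathbb E[(d_i^*)^2\varepsilon_i^2]+\operatorname{Var}\Big(n^{-1/2}\sum_{i=1}^n\mu_A^\top e_i\Big)-n^{-1}\sum_{i=1}^n\operatorname{Var}(\mu_A^\top e_i).$$ In particular, in a randomized trial with potential outcomes $y_i(0),y_i(1)$, that is, if $L=2$, $(\sigma_1(d_i),\sigma_2(d_i))=(1,d_i)$ and the second component of $e_i$ is $\tau_i-\mathbb E[\tau_i]$ with $\tau_i=y_i(1)-y_i(0)$, it enters only through the treatment effects $\tau_i$: $$\frac{\sigma_{d\varepsilon}^2}{\sigma_d^4}=\frac1{n\sigma_d^4}\sum_{i=1}^n\mathbb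 E[(d_i^*)^2\varepsilon_i^2]+\operatorname{Var}\Big(n^{-1/2}\sum_{i=1}^n\tau_i\Big)-n^{-1}\sum_{i=1}^n\operatorname{Var}(\tau_i).$$ -/

import Mathlib

open MeasureTheory ProbabilityTheory Filter Topology
open scoped Matrix Matrix.Norms.Frobenius

noncomputable section

section Asymptotics

variable {Ω : ℕ → Type*} [∀ n, MeasurableSpace (Ω n)]

/-- `X n = o_p(1)`; the probability space may change with the sample size `n`. -/
def IsLittleOp (P : ∀ n, Measure (Ω n)) {E : Type*} [NormedAddCommGroup E]
    (X : ∀ n, Ω n → E) : Prop :=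
  ∀ η : ℝ, 0 < η → Tendsto (fun n => P n {ω | η ≤ ‖X n ω‖}) atTop (𝓝 0)

/-- `X n = O_p(1)`. -/
def IsBigOp (P : ∀ n, Measure (Ω n)) {E : Type*} [NormedAddCommGroup E]
    (X : ∀ n, Ω n → E) : Prop :=
  ∀ η : ℝ, 0 < η → ∃ C : ℝ, ∀ᶠ n in atTop, P n {ω | C < ‖X n ω‖} ≤ ENNReal.ofReal η

end Asymptotics

/-- The absolute moment `E‖X‖^q` exists and is at most `K`. -/
def MomentLE {Ω : Type*} [MeasurableSpace Ω] (P : Measure Ω) {E : Type*} [NormedAddCommGroup E]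
    (X : Ω → E) (q K : ℝ) : Prop :=
  Integrable (fun ω => ‖X ω‖ ^ q) P ∧ ∫ ω, ‖X ω‖ ^ q ∂P ≤ K

/-- Smallest (real) eigenvalue of a symmetric real matrix of positive size. -/
def lambdaMin {p : ℕ} (A : Matrix (Fin p) (Fin p) ℝ) : ℝ := sInf (spectrum ℝ A)

/-- Regressor matrix, with rows `x_i = (d_i, w_iᵀ)`. -/
def regressorMatrix {n p : ℕ} (d : Fin n → ℝ) (w : Fin n → EuclideanSpace ℝ (Fin p)) :
    Matrix (Fin n) (Fin (p + 1)) ℝ :=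
  Matrix.of fun i => Matrix.vecCons (d i) (fun j => w i j)

/-- The OLS coefficient vector `(XᵀX)⁻¹ XᵀY`. -/
def ols {n k : ℕ} (X : Matrix (Fin n) (Fin k) ℝ) (Y : Fin n → ℝ) : Fin k → ℝ :=
  (Xᵀ * X)⁻¹ *ᵥ (Xᵀ *ᵥ Y)

/-- Primitives of the regression model, as a triangular array: row `n` is the sample of size `n`,
and every primitive may depend on `n`. The constants `muD`, `sigmaD`, `muA` get their meaning
from `RegressorAssumption` and `ScaledErrorAssumption` below. -/
structure RegressionArray (p L : ℕ) (Ω : ℕ → Type*) where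
  /-- the regressor of interest `d_i` -/
  d : ∀ n, Fin n → Ω n → ℝ
  /-- the controls `w_i` -/
  w : ∀ n, Fin n → Ω n → EuclideanSpace ℝ (Fin p)
  /-- the scaled error vectors `e_i = (ε*_{l,i})_{l ≤ L}` -/
  e : ∀ n, Fin n → Ω n → EuclideanSpace ℝ (Fin L)
  /-- the scale functions `σ_l` -/
  sigma : ℕ → Fin L → ℝ → ℝ
  /-- the coefficient of interest -/
  beta : ℕ → ℝ
  /-- the coefficients of the controls -/
  gamma : ℕ → EuclideanSpace ℝ (Fin p)
  /-- the mean of `d_i` -/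
  muD : ℕ → ℝ
  /-- the standard deviation of `d_i` -/
  sigmaD : ℕ → ℝ
  /-- the mean of `A_i` -/
  muA : ℕ → EuclideanSpace ℝ (Fin L)

namespace RegressionArray

variable {p L : ℕ} {Ω : ℕ → Type*} (M : RegressionArray p L Ω)

/-- The error `ε_i = Σ_l σ_l(d_i) ε*_{l,i}`. -/
def err (n : ℕ) (i : Fin n) (ω : Ω n) : ℝ := ∑ l, M.sigma n l (M.d n i ω) * M.e n i ω l

/-- The outcome `y_i = d_i β + w_iᵀ γ + ε_i`. -/
def y (n : ℕ) (i : Fin n) (ω : Ω n) : ℝ :=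
  M.d n i ω * M.beta n + (∑ j, M.w n i ω j * M.gamma n j) + M.err n i ω

/-- The OLS estimator of `β`, from the regression of `y_i` on `(d_i, w_i)`. -/
def betaHat (n : ℕ) (ω : Ω n) : ℝ :=
  ols (regressorMatrix (fun i => M.d n i ω) (fun i => M.w n i ω)) (fun i => M.y n i ω) 0

/-- `A_i = (d_i - μ_d) (σ_l(d_i))_{l ≤ L}`. -/
def A (n : ℕ) (i : Fin n) (ω : Ω n) : EuclideanSpace ℝ (Fin L) :=
  WithLp.toLp 2 fun l => (M.d n i ω - M.muD n) * M.sigma n l (M.d n i ω)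

/-- The scalar `μ_Aᵀ e_i`. -/
def muAe (n : ℕ) (i : Fin n) (ω : Ω n) : ℝ := inner ℝ (M.muA n) (M.e n i ω)

/-- The score `n^{-1/2} Σ_i (d_i - μ_d) ε_i`. -/
def score (n : ℕ) (ω : Ω n) : ℝ :=
  (√(n : ℝ))⁻¹ * ∑ i, (M.d n i ω - M.muD n) * M.err n i ω

variable [∀ n, MeasurableSpace (Ω n)] (P : ∀ n, Measure (Ω n))

/-- `σ_{e,1}² = n⁻¹ Σ_i E[((A_i - μ_A)ᵀ e_i)²]`. -/
def sigmaE1Sq (n : ℕ) : ℝ :=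
  (n : ℝ)⁻¹ * ∑ i : Fin n, ∫ ω, (inner ℝ (M.A n i ω - M.muA n) (M.e n i ω)) ^ 2 ∂(P n)

/-- `σ_{e,2}² = E[(n^{-1/2} Σ_i μ_Aᵀ e_i)²]`. -/
def sigmaE2Sq (n : ℕ) : ℝ :=
  ∫ ω, ((√(n : ℝ))⁻¹ * ∑ i : Fin n, M.muAe n i ω) ^ 2 ∂(P n)

/-- `σ_{dε}`, where `σ_{dε}² = σ_{e,1}² + σ_{e,2}²`. -/
def sigmaDE (n : ℕ) : ℝ := √(M.sigmaE1Sq P n + M.sigmaE2Sq P n)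

/-- Requirements on the regressor of interest: i.i.d. within each sample, independent of the
controls, with a bounded absolute moment of order above two and a variance bounded from below. -/
structure RegressorAssumption (K : ℝ) : Prop where
  measurable : ∀ n i, Measurable (M.d n i)
  indep : ∀ n, iIndepFun (M.d n) (P n)
  identDistrib : ∀ n i j, IdentDistrib (M.d n i) (M.d n j) (P n) (P n)
  mean : ∀ n i, ∫ ω, M.d n i ω ∂(P n) = M.muD n
  variance : ∀ n i, variance (M.d n i) (P n) = M.sigmaD n ^ 2
  indep_controls : ∀ n, IndepFun (fun ω i => M.d n i ω) (fun ω i => M.w n i ω) (P n)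
  moment : ∃ δ : ℝ, 0 < δ ∧ ∀ n i, MomentLE (P n) (M.d n i) (2 + δ) K
  variance_ge : ∀ n : ℕ, 1 ≤ n → K⁻¹ ≤ M.sigmaD n ^ 2

/-- Requirements on the controls: no asymptotic multicollinearity, bounded second moments, and
an intercept. -/
structure ControlAssumption [NeZero p] (K : ℝ) : Prop where
  measurable : ∀ n i, Measurable (M.w n i)
  lambdaMin_ge : ∃ R : ∀ n, Ω n → ℝ, IsLittleOp P R ∧ ∀ n, ∀ᵐ ω ∂(P n),
    K⁻¹ + R n ω ≤
      lambdaMin ((n : ℝ)⁻¹ • ∑ i : Fin n, Matrix.vecMulVec (⇑(M.w n i ω)) (⇑(M.w n i ω)))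
  moment : ∀ n i, MomentLE (P n) (M.w n i) 2 K
  intercept : ∀ n, ∃ c : ℝ, c ≠ 0 ∧ ∀ i, ∀ᵐ ω ∂(P n), M.w n i ω 0 = c

/-- Requirements on the regression errors. -/
structure ErrorAssumption (K : ℝ) : Prop where
  orthogonality : IsLittleOp P fun (n : ℕ) ω => (n : ℝ)⁻¹ • ∑ i : Fin n, M.err n i ω • M.w n i ω
  lln_sq : IsLittleOp P fun (n : ℕ) ω =>
    (n : ℝ)⁻¹ * (∑ i : Fin n, M.err n i ω ^ 2) -
      (n : ℝ)⁻¹ * ∑ i : Fin n, ∫ ω', M.err n i ω' ^ 2 ∂(P n)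
  moment : ∃ δ : ℝ, 0 < δ ∧ ∀ n i, MomentLE (P n) (M.err n i) (2 + δ) K
  second_moment_ge : ∀ n : ℕ, 1 ≤ n →
    K⁻¹ ≤ (n : ℝ)⁻¹ * ∑ i : Fin n, ∫ ω, M.err n i ω ^ 2 ∂(P n)

/-- The error components: `(d_i)` is independent of the mean-zero, square integrable vectors
`(e_i)`, the functions `σ_l` are bounded, and `σ_{e,1}²` is bounded from below. Boundedness is only
asked on the values that `d_i` takes, so that `σ_l(x) = x` is allowed for binary `d_i`. -/
structure ScaledErrorAssumption (K : ℝ) : Prop where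
  measurable : ∀ n i, Measurable (M.e n i)
  mean_zero : ∀ n i, ∫ ω, M.e n i ω ∂(P n) = 0
  sq_integrable : ∀ n i, MemLp (M.e n i) 2 (P n)
  measurable_sigma : ∀ n l, Measurable (M.sigma n l)
  mean_A : ∀ n i, ∫ ω, M.A n i ω ∂(P n) = M.muA n
  indep : ∀ n, IndepFun (fun ω i => M.d n i ω) (fun ω i => M.e n i ω) (P n)
  sigma_bounded : ∀ n i l, ∀ᵐ ω ∂(P n), |M.sigma n l (M.d n i ω)| ≤ K
  sigmaE1Sq_ge : ∀ n : ℕ, 1 ≤ n → K⁻¹ ≤ M.sigmaE1Sq P n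

/-- Weak dependence of the vectors `e_i`: a law of large numbers for `e_i e_iᵀ`, stochastically
bounded averages of `‖e_i‖^{2+δ}`, and a central limit theorem for `μ_Aᵀ e_i`. -/
structure WeakDependenceAssumption [∀ n, IsProbabilityMeasure (P n)] : Prop where
  lln_outer : IsLittleOp P fun (n : ℕ) ω =>
    (n : ℝ)⁻¹ • (∑ i : Fin n, Matrix.vecMulVec (⇑(M.e n i ω)) (⇑(M.e n i ω))) -
      (n : ℝ)⁻¹ • ∑ i : Fin n, Matrix.of fun l m => ∫ ω', M.e n i ω' l * M.e n i ω' m ∂(P n)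
  moment : ∃ δ : ℝ, 0 < δ ∧
    IsBigOp P fun (n : ℕ) ω => (n : ℝ)⁻¹ * ∑ i : Fin n, ‖M.e n i ω‖ ^ (2 + δ)
  clt : TendstoInDistribution
    (fun (n : ℕ) ω => (√(M.sigmaE2Sq P n))⁻¹ * ((√(n : ℝ))⁻¹ * ∑ i : Fin n, M.muAe n i ω))
    atTop id P (gaussianReal 0 1)

end RegressionArray

end

/-! Since d_i^* ε_i = A_iᵀ e_i, the score splits into n^{-1/2} Σ (A_i - μ_A)ᵀ e_i and n^{-1/2} Σ
μ_Aᵀ e_i. Given all the e_i, the first sum has independent centred terms, however dependent the e_i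
are, because the randomness left comes from the i.i.d. d_i. Its conditional variance is a linear
function of n⁻¹ Σ e_i e_iᵀ, hence equals σ_{e,1}² up to o_p(1). A Lyapunov bound then puts the
conditional characteristic function close, in probability, to a Gaussian factor that is not random
(`isLittleOp_integral_exp_sub_exp`). Such a factor leaves the outer integral, where only the
characteristic function of the second sum remains; that one is governed by the assumed central limit
theorem. After division by σ_{dε} the two Gaussian factors multiply to that of N(0,1)
(`tendstoInDistribution_sum_inner_add`). Neither variance need converge, so everything is compared
along a bounded sequence of arguments instead of at a limit point.

For the estimator, the intercept allows d_i to be replaced by d_i^* in the normal equations. Let b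
be the error in β, h the recentred error in the control coefficients, q = n^{-1/2} Σ d_i^* w_i, r =
n⁻¹ Σ ε_i w_i and s = n⁻¹ Σ (d_i^*)². If a > 0 bounds the smallest eigenvalue of the control Gram
matrix from below, then a‖h‖ ≤ ‖r‖ + ‖q‖ |√n b| / n and |s √n b - score| ≤ ‖q‖ ‖h‖
(`abs_sub_le_of_orthogonal`). Here q = O_p(1), as d^* is centred and independent of the controls, r
= o_p(1), and s - σ_d² = o_p(1). The term containing b on the right is absorbed on the left, which
gives √n b = O_p(1); inserting this again gives the expansion (`isLittleOp_standardized_sub`), and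
Slutsky's lemma transfers the limit.

The variance formula is exact for every n: for each i the variables (A_i - μ_A)ᵀ e_i and μ_Aᵀ e_i
are uncorrelated, so E[(d_i^*)² ε_i²] is the sum of their variances. In the randomized trial μ_A =
(0, σ_d²), so only the treatment effect component is left. -/

noncomputable section

/-! ### Calculus of o_p and O_p over varying probability spaces, and Slutsky's lemma. -/

section StochasticOrder

variable {Ω : ℕ → Type*} [∀ n, MeasurableSpace (Ω n)] {P : ∀ n, Measure (Ω n)}
  {E F : Type*} [NormedAddCommGroup E] [NormedAddCommGroup F]

/-- A bad event of vanishing probability adds a vanishing amount to every tail probability. This is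
how bounds that hold only on typical samples, such as those for least squares, are used. -/
theorem IsLittleOp.of_le_off {X : ∀ n, Ω n → E} {Y : ∀ n, Ω n → F} {B : ∀ n, Set (Ω n)}
    (hY : IsLittleOp P Y) (hB : Tendsto (fun n => P n (B n)) atTop (𝓝 0))
    (h : ∀ᶠ n in atTop, ∀ᵐ ω ∂(P n), ω ∉ B n → ‖X n ω‖ ≤ ‖Y n ω‖) : IsLittleOp P X := by
  intro η hη
  have hsum := hB.add (hY η hη)
  rw [add_zero] at hsum
  refine tendsto_of_tendsto_of_tendsto_of_le_of_le' tendsto_const_nhds hsum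
    (Eventually.of_forall fun _ => zero_le) ?_
  filter_upwards [h] with n hn
  refine (measure_mono_ae ?_).trans (measure_union_le _ _)
  filter_upwards [hn] with ω hω hx
  by_cases hb : ω ∈ B n
  · exact Or.inl hb
  · exact Or.inr (le_trans hx (hω hb))

theorem IsLittleOp.of_le {X : ∀ n, Ω n → E} {Y : ∀ n, Ω n → F}
    (hY : IsLittleOp P Y) (h : ∀ᶠ n in atTop, ∀ᵐ ω ∂(P n), ‖X n ω‖ ≤ ‖Y n ω‖) :
    IsLittleOp P X :=
  hY.of_le_off (B := fun _ => ∅) (by simp)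
    (h.mono fun n hn => hn.mono fun ω hω _ => hω)

theorem IsLittleOp.norm {X : ∀ n, Ω n → E} (hX : IsLittleOp P X) :
    IsLittleOp P fun n ω => ‖X n ω‖ :=
  hX.of_le (Eventually.of_forall fun n => ae_of_all _ fun ω => by simp)

theorem IsLittleOp.add {X Y : ∀ n, Ω n → E} (hX : IsLittleOp P X) (hY : IsLittleOp P Y) :
    IsLittleOp P fun n ω => X n ω + Y n ω := by
  intro η hη
  have hsum := (hX (η / 2) (by positivity)).add (hY (η / 2) (by positivity))
  rw [add_zero] at hsum
  refine tendsto_of_tendsto_of_tendsto_of_le_of_le tendsto_const_nhds hsum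
    (fun _ => zero_le) fun n => ?_
  refine (measure_mono ?_).trans (measure_union_le _ _)
  intro ω hω
  by_contra hc
  simp only [Set.mem_union, Set.mem_ofPred_eq, not_or, not_le] at hc hω
  have := norm_add_le (X n ω) (Y n ω)
  linarith [hc.1, hc.2]

theorem IsLittleOp.sum {ι : Type*} (s : Finset ι) {X : ι → ∀ n, Ω n → E}
    (hX : ∀ i ∈ s, IsLittleOp P (X i)) : IsLittleOp P fun n ω => ∑ i ∈ s, X i n ω := by
  classical
  induction s using Finset.induction_on with
  | empty =>
    intro η hη
    simp [not_le.2 hη]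
  | insert a s ha ih =>
    simp_rw [Finset.sum_insert ha]
    exact (hX a (by simp)).add (ih fun i hi => hX i (by simp [hi]))

theorem IsBigOp.mul_isLittleOp {X Y : ∀ n, Ω n → ℝ} (hX : IsBigOp P X) (hY : IsLittleOp P Y) :
    IsLittleOp P fun n ω => X n ω * Y n ω := by
  intro η hη
  rw [ENNReal.tendsto_nhds_zero]
  intro ε hε
  obtain ⟨r, hr0, hr⟩ : ∃ r : ℝ, 0 < r ∧ ENNReal.ofReal r ≤ ε / 2 := by
    obtain ⟨r, h0, h1⟩ := ENNReal.lt_iff_exists_nnreal_btwn.1 (ENNReal.half_pos hε.ne')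
    exact ⟨r, by exact_mod_cast h0, by simpa using h1.le⟩
  obtain ⟨C, hC⟩ := hX r hr0
  -- The tail constant C may be negative or zero, so |C| + 1 serves as the divisor.
  have hC' : 0 < |C| + 1 := by positivity
  have h2 := (ENNReal.tendsto_nhds_zero.1 (hY (η / (|C| + 1)) (by positivity))) (ε / 2)
    (ENNReal.half_pos hε.ne')
  filter_upwards [hC, h2] with n h1 h2
  calc _ ≤ P n ({ω | C < ‖X n ω‖} ∪ {ω | η / (|C| + 1) ≤ ‖Y n ω‖}) := by
        refine measure_mono fun ω hω => ?_
        by_contra hc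
        simp only [Set.mem_union, Set.mem_ofPred_eq, not_or, not_le, not_lt, norm_mul] at hc hω
        rw [lt_div_iff₀ hC'] at hc
        have h3 : ‖X n ω‖ ≤ |C| + 1 := by linarith [hc.1, le_abs_self C]
        nlinarith [hc.2, norm_nonneg (Y n ω), norm_nonneg (X n ω)]
    _ ≤ _ := measure_union_le _ _
    _ ≤ ε / 2 + ε / 2 := add_le_add (h1.trans hr) h2
    _ = ε := ENNReal.add_halves ε

theorem IsLittleOp.isBigOp {X : ∀ n, Ω n → E} (hX : IsLittleOp P X) : IsBigOp P X := by
  intro η hη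
  refine ⟨1, ?_⟩
  have h := (ENNReal.tendsto_nhds_zero.1 (hX 1 one_pos)) (ENNReal.ofReal η) (by simpa using hη)
  filter_upwards [h] with n hn
  exact (measure_mono fun ω (hω : 1 < ‖X n ω‖) => hω.le).trans hn

theorem IsBigOp.of_le_off {X : ∀ n, Ω n → E} {Y : ∀ n, Ω n → F} {B : ∀ n, Set (Ω n)}
    (hY : IsBigOp P Y) (hB : Tendsto (fun n => P n (B n)) atTop (𝓝 0))
    (h : ∀ᶠ n in atTop, ∀ᵐ ω ∂(P n), ω ∉ B n → ‖X n ω‖ ≤ ‖Y n ω‖) : IsBigOp P X := by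
  intro η hη
  obtain ⟨C, hC⟩ := hY (η / 2) (by positivity)
  refine ⟨C, ?_⟩
  have h2 := (ENNReal.tendsto_nhds_zero.1 hB) (ENNReal.ofReal (η / 2))
    (by simpa using hη)
  filter_upwards [hC, h2, h] with n h1 h2 h3
  calc _ ≤ P n (B n ∪ {ω | C < ‖Y n ω‖}) := by
        refine measure_mono_ae ?_
        filter_upwards [h3] with ω hω hx
        by_cases hb : ω ∈ B n
        · exact Or.inl hb
        · exact Or.inr (lt_of_lt_of_le hx (hω hb))
    _ ≤ _ := measure_union_le _ _
    _ ≤ ENNReal.ofReal (η / 2) + ENNReal.ofReal (η / 2) := add_le_add h2 h1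
    _ = ENNReal.ofReal η := by
        rw [← ENNReal.ofReal_add (by positivity) (by positivity), add_halves]

theorem IsBigOp.of_le {X : ∀ n, Ω n → E} {Y : ∀ n, Ω n → F}
    (hY : IsBigOp P Y) (h : ∀ᶠ n in atTop, ∀ᵐ ω ∂(P n), ‖X n ω‖ ≤ ‖Y n ω‖) : IsBigOp P X :=
  hY.of_le_off (B := fun _ => ∅) (by simp)
    (h.mono fun n hn => hn.mono fun ω hω _ => hω)

theorem IsBigOp.add {X Y : ∀ n, Ω n → E} (hX : IsBigOp P X) (hY : IsBigOp P Y) :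
    IsBigOp P fun n ω => X n ω + Y n ω := by
  intro η hη
  obtain ⟨C, hC⟩ := hX (η / 2) (by positivity)
  obtain ⟨D, hD⟩ := hY (η / 2) (by positivity)
  refine ⟨C + D, ?_⟩
  filter_upwards [hC, hD] with n h1 h2
  calc _ ≤ P n ({ω | C < ‖X n ω‖} ∪ {ω | D < ‖Y n ω‖}) := by
        refine measure_mono fun ω hω => ?_
        by_contra hc
        simp only [Set.mem_union, Set.mem_ofPred_eq, not_or, not_lt] at hc hω
        have := norm_add_le (X n ω) (Y n ω)
        linarith [hc.1, hc.2]
    _ ≤ _ := measure_union_le _ _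
    _ ≤ ENNReal.ofReal (η / 2) + ENNReal.ofReal (η / 2) := add_le_add h1 h2
    _ = ENNReal.ofReal η := by
        rw [← ENNReal.ofReal_add (by positivity) (by positivity), add_halves]

theorem IsBigOp.mul {X Y : ∀ n, Ω n → ℝ} (hX : IsBigOp P X) (hY : IsBigOp P Y) :
    IsBigOp P fun n ω => X n ω * Y n ω := by
  intro η hη
  obtain ⟨C, hC⟩ := hX (η / 2) (by positivity)
  obtain ⟨D, hD⟩ := hY (η / 2) (by positivity)
  refine ⟨|C| * |D|, ?_⟩
  filter_upwards [hC, hD] with n h1 h2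
  calc _ ≤ P n ({ω | C < ‖X n ω‖} ∪ {ω | D < ‖Y n ω‖}) := by
        refine measure_mono fun ω hω => ?_
        by_contra hc
        simp only [Set.mem_union, Set.mem_ofPred_eq, not_or, not_lt, norm_mul] at hc hω
        have := mul_le_mul (hc.1.trans (le_abs_self C)) (hc.2.trans (le_abs_self D))
          (norm_nonneg _) (abs_nonneg _)
        linarith
    _ ≤ _ := measure_union_le _ _
    _ ≤ ENNReal.ofReal (η / 2) + ENNReal.ofReal (η / 2) := add_le_add h1 h2
    _ = ENNReal.ofReal η := by
        rw [← ENNReal.ofReal_add (by positivity) (by positivity), add_halves]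

theorem isBigOp_const [∀ n, IsProbabilityMeasure (P n)] (x : E) :
    IsBigOp P fun _ _ => x := fun η _ => ⟨‖x‖, by simp⟩

theorem isLittleOp_of_tendsto_zero {x : ℕ → E} (hx : Tendsto x atTop (𝓝 0)) :
    IsLittleOp P fun n _ => x n := by
  intro η hη
  refine tendsto_const_nhds.congr' ?_
  filter_upwards [(tendsto_zero_iff_norm_tendsto_zero.1 hx).eventually (gt_mem_nhds hη)] with n hn
  simp [not_le.2 hn]

/-- Markov's inequality. -/
theorem isLittleOp_of_integral_norm_le [∀ n, IsProbabilityMeasure (P n)] {X : ∀ n, Ω n → E}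
    {a : ℕ → ℝ} (hX : ∀ n, Integrable (X n) (P n))
    (h : ∀ᶠ n in atTop, ∫ ω, ‖X n ω‖ ∂(P n) ≤ a n) (ha : Tendsto a atTop (𝓝 0)) :
    IsLittleOp P X := by
  intro η hη
  have hlim : Tendsto (fun n => ENNReal.ofReal (a n / η)) atTop (𝓝 0) := by
    have := ENNReal.tendsto_ofReal (ha.div_const η)
    simpa using this
  refine tendsto_of_tendsto_of_tendsto_of_le_of_le' tendsto_const_nhds hlim
    (Eventually.of_forall fun _ => zero_le) ?_
  filter_upwards [h] with n hn
  have hM := mul_meas_ge_le_integral_of_nonneg (ae_of_all _ fun ω => norm_nonneg (X n ω))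
    (hX n).norm η
  rw [← ofReal_measureReal (μ := P n)]
  refine ENNReal.ofReal_le_ofReal ?_
  rw [le_div_iff₀ hη]
  linarith

theorem isBigOp_of_integral_norm_le [∀ n, IsProbabilityMeasure (P n)] {X : ∀ n, Ω n → E}
    {C : ℝ} (hX : ∀ n, Integrable (X n) (P n))
    (h : ∀ᶠ n in atTop, ∫ ω, ‖X n ω‖ ∂(P n) ≤ C) : IsBigOp P X := by
  intro η hη
  have hC' : 0 < |C| + 1 := by positivity
  refine ⟨(|C| + 1) / η, ?_⟩
  filter_upwards [h] with n hn
  have hM := mul_meas_ge_le_integral_of_nonneg (ae_of_all _ fun ω => norm_nonneg (X n ω))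
    (hX n).norm ((|C| + 1) / η)
  refine (measure_mono fun ω (hω : (|C| + 1) / η < ‖X n ω‖) => hω.le).trans ?_
  change (P n) {ω | (|C| + 1) / η ≤ ‖X n ω‖} ≤ _
  rw [← ofReal_measureReal (μ := P n)]
  refine ENNReal.ofReal_le_ofReal ?_
  rw [div_mul_eq_mul_div, div_le_iff₀ hη] at hM
  have h1 : (|C| + 1) * (P n).real {ω | (|C| + 1) / η ≤ ‖X n ω‖} ≤ (|C| + 1) * η := by
    refine hM.trans ?_
    gcongr
    linarith [le_abs_self C]
  exact le_of_mul_le_mul_left h1 hC'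

/-- A bound on the mean of `X²` makes `X` stochastically bounded. -/
theorem isBigOp_of_integral_sq_le [∀ n, IsProbabilityMeasure (P n)] {X : ∀ n, Ω n → ℝ}
    {C : ℝ} (hX : ∀ n, Integrable (fun ω => X n ω ^ 2) (P n))
    (h : ∀ᶠ n in atTop, ∫ ω, X n ω ^ 2 ∂(P n) ≤ C) : IsBigOp P X := by
  have h1 : IsBigOp P fun n ω => X n ω ^ 2 :=
    isBigOp_of_integral_norm_le hX (by simpa using h)
  refine (h1.add (isBigOp_const (1 : ℝ))).of_le (Eventually.of_forall fun n => ae_of_all _ fun ω => ?_)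
  rw [Real.norm_eq_abs, Real.norm_eq_abs, abs_of_nonneg (by positivity : 0 ≤ X n ω ^ 2 + 1)]
  nlinarith [sq_abs (X n ω), sq_nonneg (|X n ω| - 1)]

/-- Bounded convergence in probability. -/
theorem IsLittleOp.tendsto_integral_norm [∀ n, IsProbabilityMeasure (P n)] {X : ∀ n, Ω n → E}
    (hX : IsLittleOp P X) (hm : ∀ n, AEStronglyMeasurable (X n) (P n)) {C : ℝ}
    (hC : ∀ᶠ n in atTop, ∀ᵐ ω ∂(P n), ‖X n ω‖ ≤ C) :
    Tendsto (fun n => ∫ ω, ‖X n ω‖ ∂(P n)) atTop (𝓝 0) := by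
  rw [Metric.tendsto_nhds]
  intro ε hε
  have h1 : Tendsto (fun n => |C| * (P n).real {ω | ε / 2 ≤ ‖X n ω‖}) atTop (𝓝 0) := by
    have := (ENNReal.tendsto_toReal ENNReal.zero_ne_top).comp (hX (ε / 2) (by positivity))
    simpa [measureReal_def] using this.const_mul |C|
  filter_upwards [hC, h1.eventually (gt_mem_nhds (half_pos hε))] with n hn h2
  have hset : NullMeasurableSet {ω | ε / 2 ≤ ‖X n ω‖} (P n) :=
    nullMeasurableSet_le aemeasurable_const (hm n).norm.aemeasurable
  rw [Real.dist_eq, sub_zero, abs_of_nonneg (integral_nonneg fun _ => norm_nonneg _)]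
  -- Below the level ε / 2 the integrand contributes at most ε / 2; above it, at most |C| times a
  -- vanishing probability.
  have h3 : ∫ ω, ‖X n ω‖ ∂(P n) ≤
      ∫ ω, (ε / 2 + {ω | ε / 2 ≤ ‖X n ω‖}.indicator (fun _ => |C|) ω) ∂(P n) := by
    refine integral_mono_ae ?_ ?_ ?_
    · exact (Integrable.of_bound (hm n) C hn).norm
    · exact (integrable_const _).add ((integrable_const _).indicator₀ hset)
    · filter_upwards [hn] with ω hω
      by_cases h : ε / 2 ≤ ‖X n ω‖
      · simp only [Set.indicator, Set.mem_ofPred_eq, h, if_true]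
        linarith [le_abs_self C]
      · simp only [Set.indicator, Set.mem_ofPred_eq, h, if_false]
        linarith
  rw [integral_add (integrable_const _) ((integrable_const _).indicator₀ hset),
    integral_indicator₀ hset] at h3
  simp only [integral_const, probReal_univ, MeasurableSet.univ,
    measureReal_restrict_apply, Set.univ_inter, smul_eq_mul] at h3
  linarith [mul_comm |C| ((P n).real {ω | ε / 2 ≤ ‖X n ω‖})]

/-- Slutsky's lemma when the probability space may change with the index. -/
theorem tendstoInDistribution_of_isLittleOp_sub [∀ n, IsProbabilityMeasure (P n)]
    {Ω' : Type*} [MeasurableSpace Ω'] {P' : Measure Ω'} [IsProbabilityMeasure P'] {Z : Ω' → ℝ}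
    {X Y : ∀ n, Ω n → ℝ} (hX : TendstoInDistribution X atTop Z P P')
    (hY : ∀ n, AEMeasurable (Y n) (P n)) (h : IsLittleOp P fun n ω => Y n ω - X n ω) :
    TendstoInDistribution Y atTop Z P P' := by
  refine ⟨hY, hX.aemeasurable_limit,
    ProbabilityMeasure.tendsto_iff_tendsto_charFun.2 fun t => ?_⟩
  have h1 := (ProbabilityMeasure.tendsto_iff_tendsto_charFun.1 hX.tendsto) t
  have hXm := hX.forall_aemeasurable
  simp only [ProbabilityMeasure.coe_mk] at h1 ⊢
  -- The difference of the characteristic functions is at most the mean of |e^{itY} - e^{itX}|,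
  -- which is bounded by 2 and by |t| |Y - X|, so bounded convergence in probability applies.
  have key : ∀ n, ‖charFun ((P n).map (Y n)) t - charFun ((P n).map (X n)) t‖ ≤
      ∫ ω, ‖Complex.exp (t * Y n ω * Complex.I) - Complex.exp (t * X n ω * Complex.I)‖ ∂(P n) := by
    intro n
    rw [charFun_apply_real, charFun_apply_real, integral_map (hY n) (by fun_prop),
      integral_map (hXm n) (by fun_prop), ← integral_sub]
    · exact norm_integral_le_integral_norm _
    · refine Integrable.of_bound (by have := hY n; fun_prop) 1 (ae_of_all _ fun ω => ?_)
      rw [← Complex.ofReal_mul, Complex.norm_exp_ofReal_mul_I]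
    · refine Integrable.of_bound (by have := hXm n; fun_prop) 1 (ae_of_all _ fun ω => ?_)
      rw [← Complex.ofReal_mul, Complex.norm_exp_ofReal_mul_I]
  have h2 : IsLittleOp P fun n ω =>
      Complex.exp (t * Y n ω * Complex.I) - Complex.exp (t * X n ω * Complex.I) := by
    refine ((isBigOp_const t).mul_isLittleOp h).of_le
      (Eventually.of_forall fun n => ae_of_all _ fun ω => ?_)
    have : Complex.exp (t * Y n ω * Complex.I) - Complex.exp (t * X n ω * Complex.I) =
        Complex.exp ((t * X n ω : ℝ) * Complex.I) *
          (Complex.exp (Complex.I * (t * (Y n ω - X n ω) : ℝ)) - 1) := by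
      rw [mul_sub, ← Complex.exp_add, mul_one]
      push_cast
      ring_nf
    rw [this, norm_mul, Complex.norm_exp_ofReal_mul_I, one_mul]
    exact Real.norm_exp_I_mul_ofReal_sub_one_le
  have h3 := h2.tendsto_integral_norm (C := 2)
    (fun n => by have := hXm n; have := hY n; fun_prop)
    (Eventually.of_forall fun n => ae_of_all _ fun ω => by
      refine (norm_sub_le _ _).trans ?_
      rw [← Complex.ofReal_mul, ← Complex.ofReal_mul, Complex.norm_exp_ofReal_mul_I,
        Complex.norm_exp_ofReal_mul_I]
      norm_num)
  have h4 := squeeze_zero_norm key h3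
  simpa using h4.add h1

end StochasticOrder

/-! ### Weak law of large numbers for triangular arrays, by truncation. -/

section LawOfLargeNumbers

variable {Ω : ℕ → Type*} [∀ n, MeasurableSpace (Ω n)] {P : ∀ n, Measure (Ω n)}

theorem IsLittleOp.of_sq {X : ∀ n, Ω n → ℝ} (h : IsLittleOp P fun n ω => X n ω ^ 2) :
    IsLittleOp P X := by
  intro η hη
  refine tendsto_of_tendsto_of_tendsto_of_le_of_le tendsto_const_nhds (h (η ^ 2) (by positivity))
    (fun _ => zero_le) fun n => measure_mono fun ω hω => ?_
  simp only [Set.mem_ofPred_eq, norm_pow] at hω ⊢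
  gcongr

/-- Second moment of a centred average of bounded independent random variables. -/
theorem integral_sq_average_sub_le {Ω : Type*} [MeasurableSpace Ω] {P : Measure Ω}
    [IsProbabilityMeasure P] {n : ℕ} {U : Fin n → Ω → ℝ} {b : ℝ}
    (hm : ∀ i, Measurable (U i)) (hind : Set.Pairwise Set.univ fun i j => IndepFun (U i) (U j) P)
    (hb0 : ∀ i ω, 0 ≤ U i ω) (hb : ∀ i ω, U i ω ≤ b) :
    ∫ ω, ((n : ℝ)⁻¹ * ∑ i, U i ω - (n : ℝ)⁻¹ * ∑ i, ∫ ω', U i ω' ∂P) ^ 2 ∂P ≤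
      b ^ 2 * (n : ℝ)⁻¹ := by
  have hL : ∀ i, MemLp (U i) 2 P := fun i =>
    MemLp.of_bound (hm i).aestronglyMeasurable b (ae_of_all _ fun ω => by
      rw [Real.norm_of_nonneg (hb0 i ω)]; exact hb i ω)
  have hS : MemLp (∑ i, U i) 2 P := memLp_finsetSum' _ fun i _ => hL i
  have h1 : ∫ ω, ((n : ℝ)⁻¹ * ∑ i, U i ω - (n : ℝ)⁻¹ * ∑ i, ∫ ω', U i ω' ∂P) ^ 2 ∂P =
      (n : ℝ)⁻¹ ^ 2 * variance (∑ i, U i) P := by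
    rw [variance_eq_integral hS.aemeasurable, ← integral_const_mul]
    refine integral_congr_ae (ae_of_all _ fun ω => ?_)
    have : ∫ ω', (∑ i, U i) ω' ∂P = ∑ i, ∫ ω', U i ω' ∂P := by
      simp only [Finset.sum_apply]
      exact integral_finsetSum _ fun i _ => (hL i).integrable one_le_two
    rw [this]
    simp only [Finset.sum_apply]
    ring
  rw [h1, IndepFun.variance_sum (fun i _ => hL i) (by
    intro i _ j _ hij; exact hind (Set.mem_univ i) (Set.mem_univ j) hij)]
  have h2 : ∀ i ∈ Finset.univ, variance (U i) P ≤ b ^ 2 := by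
    intro i _
    refine (variance_le_expectation_sq (hm i).aestronglyMeasurable).trans ?_
    calc ∫ ω, (U i ^ 2) ω ∂P ≤ ∫ _, b ^ 2 ∂P := by
          refine integral_mono (hL i).integrable_sq (integrable_const _) fun ω => ?_
          exact pow_le_pow_left₀ (hb0 i ω) (hb i ω) 2
      _ = b ^ 2 := by simp
  have h3 := Finset.sum_le_card_nsmul _ _ _ h2
  rw [Finset.card_univ, Fintype.card_fin, nsmul_eq_mul] at h3
  calc _ ≤ (n : ℝ)⁻¹ ^ 2 * (n * b ^ 2) := by gcongr
    _ = b ^ 2 * (n : ℝ)⁻¹ := by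
      rcases Nat.eq_zero_or_pos n with rfl | hn
      · simp
      · have : (n : ℝ) ≠ 0 := by positivity
        field_simp

/-- Excess of a nonnegative number over a threshold. -/
theorem sub_min_le_rpow {y b η : ℝ} (hy : 0 ≤ y) (hb : 0 < b) (hη : 0 < η) :
    y - min y b ≤ y ^ (1 + η) * b ^ (-η) := by
  rcases le_total y b with h | h
  · rw [min_eq_left h, sub_self]; positivity
  · have hy' : 0 < y := hb.trans_le h
    rw [min_eq_right h, Real.rpow_add hy', Real.rpow_one, mul_assoc]
    have : 1 ≤ y ^ η * b ^ (-η) := by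
      rw [Real.rpow_neg hb.le, ← div_eq_mul_inv, one_le_div (by positivity)]
      exact Real.rpow_le_rpow hb.le h hη.le
    nlinarith

theorem Integrable.of_rpow_one_add {Ω : Type*} [MeasurableSpace Ω] {P : Measure Ω}
    [IsFiniteMeasure P] {Y : Ω → ℝ} (hm : AEStronglyMeasurable Y P) (h0 : ∀ ω, 0 ≤ Y ω) {η : ℝ}
    (hη : 0 < η) (h : Integrable (fun ω => Y ω ^ (1 + η)) P) : Integrable Y P := by
  refine Integrable.mono' ((integrable_const (1 : ℝ)).add h) hm (ae_of_all _ fun ω => ?_)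
  have := sub_min_le_rpow (h0 ω) one_pos hη
  have h2 := min_le_right (Y ω) 1
  simp only [Real.norm_of_nonneg (h0 ω), Pi.add_apply, Real.one_rpow, mul_one] at this ⊢
  linarith

theorem integral_sub_min_le {Ω : Type*} [MeasurableSpace Ω] {P : Measure Ω}
    [IsProbabilityMeasure P] {Y : Ω → ℝ} (hY : Integrable Y P) (h0 : ∀ ω, 0 ≤ Y ω) {η b C : ℝ}
    (hη : 0 < η) (hb : 0 < b) (hint : Integrable (fun ω => Y ω ^ (1 + η)) P)
    (hC : ∫ ω, Y ω ^ (1 + η) ∂P ≤ C) : ∫ ω, (Y ω - min (Y ω) b) ∂P ≤ C * b ^ (-η) :=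
  calc _ ≤ ∫ ω, Y ω ^ (1 + η) * b ^ (-η) ∂P :=
        integral_mono (hY.sub (hY.inf (integrable_const b))) (hint.mul_const _)
          fun ω => sub_min_le_rpow (h0 ω) hb hη
    _ ≤ _ := by
        rw [integral_mul_const]
        exact mul_le_mul_of_nonneg_right hC (by positivity)

theorem inv_mul_sum_le_of_forall_le {n : ℕ} {f : Fin n → ℝ} {C : ℝ} (hn : 0 < n)
    (h : ∀ i, f i ≤ C) : (n : ℝ)⁻¹ * ∑ i, f i ≤ C := by
  have h3 := Finset.sum_le_card_nsmul Finset.univ f C fun i _ => h i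
  rw [Finset.card_univ, Fintype.card_fin, nsmul_eq_mul] at h3
  have hn' : (0 : ℝ) < n := by exact_mod_cast hn
  rw [inv_mul_le_iff₀ hn']
  exact h3

/-- Weak law of large numbers for row-wise independent nonnegative triangular arrays with bounded
moments of order above one. -/
theorem isLittleOp_average_sub_average_integral [∀ n, IsProbabilityMeasure (P n)]
    {Y : ∀ n, Fin n → Ω n → ℝ} (hm : ∀ n i, Measurable (Y n i)) (h0 : ∀ n i ω, 0 ≤ Y n i ω)
    (hind : ∀ n, Set.Pairwise Set.univ fun i j => IndepFun (Y n i) (Y n j) (P n))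
    {η C : ℝ} (hη : 0 < η) (hint : ∀ n i, Integrable (fun ω => Y n i ω ^ (1 + η)) (P n))
    (hC : ∀ n i, ∫ ω, Y n i ω ^ (1 + η) ∂(P n) ≤ C) :
    IsLittleOp P fun (n : ℕ) ω =>
      (n : ℝ)⁻¹ * ∑ i, Y n i ω - (n : ℝ)⁻¹ * ∑ i, ∫ ω', Y n i ω' ∂(P n) := by
  obtain ⟨b, hb0, hbpos, hbsq, hbη⟩ : ∃ b : ℕ → ℝ, (∀ n, 0 ≤ b n) ∧ (∀ n, 0 < n → 0 < b n) ∧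
      Tendsto (fun n => b n ^ 2 * (n : ℝ)⁻¹) atTop (𝓝 0) ∧
      Tendsto (fun n => C * b n ^ (-η)) atTop (𝓝 0) := by
    -- The truncation level n^{1/4} must grow slowly enough for the variance bound b²/n = n^{-1/2}
    -- to vanish, and any growth makes the tail factor b^{-η} vanish.
    refine ⟨fun n => (n : ℝ) ^ (1 / 4 : ℝ), fun n => by positivity, fun n hn => by positivity,
      ?_, ?_⟩
    · have : Tendsto (fun n : ℕ => (n : ℝ) ^ (-(1 / 2 : ℝ))) atTop (𝓝 0) :=
        (tendsto_rpow_neg_atTop (by norm_num)).comp tendsto_natCast_atTop_atTop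
      refine this.congr' ?_
      filter_upwards [eventually_gt_atTop 0] with n hn
      have hn' : (0 : ℝ) < n := by exact_mod_cast hn
      rw [← Real.rpow_natCast, ← Real.rpow_mul hn'.le, ← Real.rpow_neg_one, ← Real.rpow_add hn']
      norm_num
    · have : Tendsto (fun n : ℕ => ((n : ℝ) ^ (1 / 4 : ℝ)) ^ (-η)) atTop (𝓝 0) :=
        (tendsto_rpow_neg_atTop hη).comp
          ((tendsto_rpow_atTop (by norm_num)).comp tendsto_natCast_atTop_atTop)
      simpa using this.const_mul C
  have hYint : ∀ n i, Integrable (Y n i) (P n) := fun n i =>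
    Integrable.of_rpow_one_add (hm n i).aestronglyMeasurable (h0 n i) hη (hint n i)
  have hUm : ∀ n i, Measurable fun ω => min (Y n i ω) (b n) := fun n i =>
    (hm n i).min measurable_const
  have hUint : ∀ n i, Integrable (fun ω => min (Y n i ω) (b n)) (P n) := fun n i =>
    (hYint n i).inf (integrable_const _)
  have hUL : ∀ n i, MemLp (fun ω => min (Y n i ω) (b n)) 2 (P n) := fun n i =>
    MemLp.of_bound (hUm n i).aestronglyMeasurable (b n) (ae_of_all _ fun ω => by
      rw [Real.norm_of_nonneg (le_min (h0 n i ω) (hb0 n))]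
      exact min_le_right _ _)
  -- The truncated averages concentrate by their second moment; the excess over the level is small
  -- in mean, which disposes of both its average and its expectation.
  have htrunc : IsLittleOp P fun (n : ℕ) ω => (n : ℝ)⁻¹ * ∑ i, min (Y n i ω) (b n) -
      (n : ℝ)⁻¹ * ∑ i, ∫ ω', min (Y n i ω') (b n) ∂(P n) := by
    refine IsLittleOp.of_sq ?_
    refine isLittleOp_of_integral_norm_le (fun n => ?_) (Eventually.of_forall fun n => ?_) hbsq
    · have h1 : MemLp (fun ω => ∑ i, min (Y n i ω) (b n)) 2 (P n) :=
        memLp_finsetSum _ fun i _ => hUL n i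
      exact ((h1.const_mul (n : ℝ)⁻¹).sub (memLp_const _)).integrable_sq
    · simp only [norm_pow, Real.norm_eq_abs, sq_abs]
      refine integral_sq_average_sub_le (U := fun i ω => min (Y n i ω) (b n)) (hUm n) ?_
        (fun i ω => le_min (h0 n i ω) (hb0 n)) (fun i ω => min_le_right _ _)
      intro i hi j hj hij
      exact (hind n hi hj hij).comp (φ := fun x => min x (b n)) (ψ := fun x => min x (b n))
        (by fun_prop) (by fun_prop)
  have htail : IsLittleOp P fun (n : ℕ) ω => (n : ℝ)⁻¹ * ∑ i, (Y n i ω - min (Y n i ω) (b n)) := by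
    refine isLittleOp_of_integral_norm_le (fun n => ?_) ?_ hbη
    · exact (integrable_finsetSum _ fun i _ => (hYint n i).sub (hUint n i)).const_mul _
    · filter_upwards [eventually_gt_atTop 0] with n hn
      have hnn : ∀ ω, 0 ≤ (n : ℝ)⁻¹ * ∑ i, (Y n i ω - min (Y n i ω) (b n)) := fun ω =>
        mul_nonneg (by positivity) (Finset.sum_nonneg fun i _ => sub_nonneg.2 (min_le_left _ _))
      simp_rw [fun ω => Real.norm_of_nonneg (hnn ω)]
      have hsub : ∀ i, Integrable (fun ω => Y n i ω - min (Y n i ω) (b n)) (P n) := fun i =>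
        (hYint n i).sub (hUint n i)
      rw [integral_const_mul, integral_finsetSum _ fun i _ => hsub i]
      exact inv_mul_sum_le_of_forall_le hn fun i =>
        integral_sub_min_le (hYint n i) (h0 n i) hη (hbpos n hn) (hint n i) (hC n i)
  have htailmean : IsLittleOp P fun (n : ℕ) (_ : Ω n) =>
      (n : ℝ)⁻¹ * ∑ i, ∫ ω', (Y n i ω' - min (Y n i ω') (b n)) ∂(P n) := by
    refine isLittleOp_of_tendsto_zero (squeeze_zero_norm' ?_ hbη)
    filter_upwards [eventually_gt_atTop 0] with n hn
    rw [Real.norm_of_nonneg (mul_nonneg (by positivity) (Finset.sum_nonneg fun i _ =>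
      integral_nonneg fun ω => sub_nonneg.2 (min_le_left _ _)))]
    exact inv_mul_sum_le_of_forall_le hn fun i =>
      integral_sub_min_le (hYint n i) (h0 n i) hη (hbpos n hn) (hint n i) (hC n i)
  have hneg : IsLittleOp P fun (n : ℕ) (_ : Ω n) =>
      -((n : ℝ)⁻¹ * ∑ i, ∫ ω', (Y n i ω' - min (Y n i ω') (b n)) ∂(P n)) :=
    htailmean.of_le (Eventually.of_forall fun n => ae_of_all _ fun ω => by rw [norm_neg])
  refine ((htrunc.add htail).add hneg).of_le
    (Eventually.of_forall fun n => ae_of_all _ fun ω => le_of_eq (congrArg _ ?_))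
  simp only [fun i => integral_sub (hYint n i) (hUint n i), Finset.sum_sub_distrib]
  ring

end LawOfLargeNumbers

/-! ### Lyapunov bounds for characteristic functions, and Fubini for independent variables. -/

section CharacteristicFunctions

/-- Replace one factor at a time: each swap costs one difference, since all other factors have norm
at most one. -/
theorem norm_prod_sub_prod_le_sum {ι : Type*} (s : Finset ι) {a b : ι → ℂ}
    (ha : ∀ i ∈ s, ‖a i‖ ≤ 1) (hb : ∀ i ∈ s, ‖b i‖ ≤ 1) :
    ‖∏ i ∈ s, a i - ∏ i ∈ s, b i‖ ≤ ∑ i ∈ s, ‖a i - b i‖ := by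
  classical
  induction s using Finset.induction_on with
  | empty => simp
  | insert j s hj ih =>
    rw [Finset.prod_insert hj, Finset.prod_insert hj, Finset.sum_insert hj]
    have h1 := ih (fun i hi => ha i (by simp [hi])) (fun i hi => hb i (by simp [hi]))
    have hA : ‖∏ i ∈ s, a i‖ ≤ 1 := by
      rw [norm_prod]
      exact Finset.prod_le_one (fun _ _ => norm_nonneg _) fun i hi => ha i (by simp [hi])
    have hbj := hb j (by simp)
    calc _ = ‖(a j - b j) * ∏ i ∈ s, a i + b j * (∏ i ∈ s, a i - ∏ i ∈ s, b i)‖ := by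
          congr 1; ring
      _ ≤ ‖a j - b j‖ * ‖∏ i ∈ s, a i‖ + ‖b j‖ * ‖∏ i ∈ s, a i - ∏ i ∈ s, b i‖ := by
          refine (norm_add_le _ _).trans ?_
          rw [norm_mul, norm_mul]
      _ ≤ ‖a j - b j‖ * 1 + 1 * ‖∏ i ∈ s, a i - ∏ i ∈ s, b i‖ := by gcongr
      _ ≤ _ := by linarith

/-- For |x| ≤ 1 the cubic Taylor remainder suffices, because δ ≤ 1 gives |x|³ ≤ |x|^{2+δ}. For |x| ≥
1 the triangle inequality gives 1 + (1 + |x| + x²/2) ≤ 4x². -/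
theorem norm_exp_mul_I_sub_taylor_le {x δ : ℝ} (hδ : 0 ≤ δ) (hδ1 : δ ≤ 1) :
    ‖Complex.exp (x * Complex.I) - (1 + x * Complex.I - x ^ 2 / 2)‖ ≤ 4 * |x| ^ (2 + δ) := by
  rcases le_total |x| 1 with h | h
  · have h1 : ‖(x * Complex.I : ℂ)‖ = |x| := by simp
    have h2 := Complex.exp_bound (x := x * Complex.I) (by rw [h1]; exact h) (n := 3) (by norm_num)
    rw [h1] at h2
    have h3 : (∑ m ∈ Finset.range 3, (x * Complex.I : ℂ) ^ m / (m.factorial : ℂ)) =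
        1 + x * Complex.I - x ^ 2 / 2 := by
      simp only [Finset.sum_range_succ, Finset.sum_range_zero, mul_pow, Complex.I_sq,
        Nat.factorial]
      push_cast
      ring
    rw [h3] at h2
    refine h2.trans ?_
    have h4 : |x| ^ 3 ≤ |x| ^ (2 + δ) := by
      rcases (abs_nonneg x).eq_or_lt with h0 | h0
      · rw [← h0]; simp; positivity
      · rw [← Real.rpow_natCast]
        exact Real.rpow_le_rpow_of_exponent_ge h0 h (by push_cast; linarith)
    have h5 : ((Nat.succ 3 : ℕ) * ((Nat.factorial 3 : ℕ) * (3 : ℕ) : ℝ)⁻¹ : ℝ) ≤ 1 := by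
      norm_num [Nat.factorial]
    have h6 : 0 ≤ |x| ^ 3 := by positivity
    nlinarith
  · have h1 : |x| ^ 2 ≤ |x| ^ (2 + δ) := by
      rw [← Real.rpow_natCast]
      exact Real.rpow_le_rpow_of_exponent_le h (by push_cast; linarith)
    have h2 : ‖(1 + x * Complex.I - x ^ 2 / 2 : ℂ)‖ ≤ 1 + |x| + |x| ^ 2 / 2 := by
      refine (norm_sub_le _ _).trans ?_
      refine add_le_add ((norm_add_le _ _).trans ?_) ?_
      · simp
      · simp
    refine (norm_sub_le _ _).trans ?_
    rw [Complex.norm_exp_ofReal_mul_I]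
    nlinarith

/-- The exponent 1 + δ/2 is the one that Jensen's inequality turns into a moment of order 2 + δ when
y is half a variance. -/
theorem abs_exp_neg_sub_one_add_le {y δ : ℝ} (hy : 0 ≤ y) (hδ : 0 ≤ δ) (hδ1 : δ ≤ 1) :
    |Real.exp (-y) - (1 - y)| ≤ y ^ (1 + δ / 2) := by
  rcases le_total y 1 with h | h
  · have h1 := Real.norm_exp_sub_one_sub_id_le (x := -y) (by
      rw [norm_neg, Real.norm_of_nonneg hy]; exact h)
    rw [norm_neg, Real.norm_of_nonneg hy, Real.norm_eq_abs] at h1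
    have h2 : y ^ 2 ≤ y ^ (1 + δ / 2) := by
      rcases hy.eq_or_lt with h0 | h0
      · rw [← h0]; simp; positivity
      · rw [← Real.rpow_natCast]
        exact Real.rpow_le_rpow_of_exponent_ge h0 h (by push_cast; linarith)
    refine le_trans (le_of_eq ?_) (h1.trans h2)
    congr 1; ring
  · have h1 : y ≤ y ^ (1 + δ / 2) := by
      conv_lhs => rw [← Real.rpow_one y]
      exact Real.rpow_le_rpow_of_exponent_le h (by linarith)
    have h2 : Real.exp (-y) ≤ 1 := Real.exp_le_one_iff.2 (by linarith)
    have h3 := Real.add_one_le_exp (-y)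
    rw [abs_of_nonneg (by linarith)]
    linarith

variable {Ω : Type*} [MeasurableSpace Ω] {P : Measure Ω} [IsProbabilityMeasure P]

theorem memLp_two_of_integrable_rpow {X : Ω → ℝ} (hX : AEMeasurable X P) {δ : ℝ} (hδ : 0 ≤ δ)
    (h : Integrable (fun ω => |X ω| ^ (2 + δ)) P) : MemLp X 2 P := by
  rw [memLp_two_iff_integrable_sq hX.aestronglyMeasurable]
  refine Integrable.mono' ((integrable_const (1 : ℝ)).add h) (by fun_prop)
    (ae_of_all _ fun ω => ?_)
  have h0 : 0 ≤ |X ω| ^ (2 + δ) := by positivity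
  simp only [Pi.add_apply, norm_pow, Real.norm_eq_abs]
  rcases le_total |X ω| 1 with h | h
  · nlinarith [abs_nonneg (X ω)]
  · have h1 : |X ω| ^ 2 ≤ |X ω| ^ (2 + δ) := by
      rw [← Real.rpow_natCast]
      exact Real.rpow_le_rpow_of_exponent_le h (by push_cast; linarith)
    linarith

/-- Jensen's inequality for the convex function x ↦ x^{1+δ/2}. It lets the Lyapunov moment also
control the error on the Gaussian side. -/
theorem rpow_integral_sq_le {X : Ω → ℝ} (hX : AEMeasurable X P) {δ : ℝ} (hδ : 0 ≤ δ)
    (h : Integrable (fun ω => |X ω| ^ (2 + δ)) P) :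
    (∫ ω, X ω ^ 2 ∂P) ^ (1 + δ / 2) ≤ ∫ ω, |X ω| ^ (2 + δ) ∂P := by
  have hpow : ∀ ω, (X ω ^ 2) ^ (1 + δ / 2) = |X ω| ^ (2 + δ) := fun ω => by
    rw [← sq_abs, ← Real.rpow_natCast, ← Real.rpow_mul (abs_nonneg _)]
    congr 1; push_cast; ring
  have := (convexOn_rpow (p := 1 + δ / 2) (by linarith)).map_integral_le (μ := P)
    (f := fun ω => X ω ^ 2)
    (Real.continuous_rpow_const (by linarith)).continuousOn isClosed_Ici
    (ae_of_all _ fun ω => sq_nonneg (X ω))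
    (memLp_two_of_integrable_rpow hX hδ h).integrable_sq (by
      simpa only [Function.comp_def, hpow] using h)
  simpa only [hpow] using this

/-- Lyapunov-type bound on the distance between the characteristic functions of a centred random
variable and of a Gaussian one with the same variance. -/
theorem norm_integral_exp_sub_le {X : Ω → ℝ} (hX : AEMeasurable X P) (h0 : ∫ ω, X ω ∂P = 0) {δ : ℝ}
    (hδ : 0 ≤ δ) (hδ1 : δ ≤ 1) (h : Integrable (fun ω => |X ω| ^ (2 + δ)) P) :
    ‖∫ ω, Complex.exp (X ω * Complex.I) ∂P - Real.exp (-((∫ ω, X ω ^ 2 ∂P) / 2))‖ ≤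
      5 * ∫ ω, |X ω| ^ (2 + δ) ∂P := by
  have h2 := memLp_two_of_integrable_rpow hX hδ h
  have hi1 : Integrable (fun ω => (X ω : ℂ)) P := (h2.integrable one_le_two).ofReal
  have hi2 : Integrable (fun ω => ((X ω : ℂ)) ^ 2) P := by
    simpa using h2.integrable_sq.ofReal (𝕜 := ℂ)
  have hiE : Integrable (fun ω => Complex.exp (X ω * Complex.I)) P :=
    Integrable.of_bound (by fun_prop) 1 (ae_of_all _ fun ω => by
      rw [Complex.norm_exp_ofReal_mul_I])
  have hi12 : Integrable (fun ω => (1 + X ω * Complex.I : ℂ)) P :=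
    (integrable_const _).add (hi1.mul_const _)
  have hiT : Integrable (fun ω => (1 + X ω * Complex.I - (X ω : ℂ) ^ 2 / 2)) P :=
    hi12.sub (hi2.div_const _)
  -- Both characteristic functions are compared with 1 - Var/2; the linear term drops out because X
  -- is centred. The Taylor side costs 4 Lyapunov moments and the Gaussian side 1, hence the
  -- constant 5.
  have e1 : ∫ ω, (1 + X ω * Complex.I - (X ω : ℂ) ^ 2 / 2) ∂P =
      1 - ((∫ ω, X ω ^ 2 ∂P : ℝ) : ℂ) / 2 := by
    rw [integral_sub hi12 (hi2.div_const _),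
      integral_add (integrable_const _) (hi1.mul_const _), integral_mul_const, integral_div,
      integral_complex_ofReal, h0, ← integral_complex_ofReal]
    simp
  have b1 : ‖∫ ω, Complex.exp (X ω * Complex.I) ∂P - (1 - ((∫ ω, X ω ^ 2 ∂P : ℝ) : ℂ) / 2)‖ ≤
      4 * ∫ ω, |X ω| ^ (2 + δ) ∂P := by
    rw [← e1, ← integral_sub hiE hiT, ← integral_const_mul]
    refine (norm_integral_le_integral_norm _).trans ?_
    exact integral_mono (hiE.sub hiT).norm (h.const_mul 4) fun ω =>
      norm_exp_mul_I_sub_taylor_le hδ hδ1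
  have hv : 0 ≤ ∫ ω, X ω ^ 2 ∂P := integral_nonneg fun ω => sq_nonneg _
  have b2 : ‖(1 - ((∫ ω, X ω ^ 2 ∂P : ℝ) : ℂ) / 2) -
      (Real.exp (-((∫ ω, X ω ^ 2 ∂P) / 2)) : ℝ)‖ ≤ ∫ ω, |X ω| ^ (2 + δ) ∂P := by
    have e2 : (1 - ((∫ ω, X ω ^ 2 ∂P : ℝ) : ℂ) / 2) - (Real.exp (-((∫ ω, X ω ^ 2 ∂P) / 2)) : ℝ) =
        ((1 - (∫ ω, X ω ^ 2 ∂P) / 2 - Real.exp (-((∫ ω, X ω ^ 2 ∂P) / 2)) : ℝ) : ℂ) := by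
      push_cast; ring
    rw [e2, Complex.norm_real, norm_sub_rev, Real.norm_eq_abs]
    refine (abs_exp_neg_sub_one_add_le (by positivity) hδ hδ1).trans ?_
    refine le_trans ?_ (rpow_integral_sq_le hX hδ h)
    exact Real.rpow_le_rpow (by positivity) (by linarith) (by positivity)
  calc _ ≤ _ := norm_sub_le_norm_sub_add_norm_sub _ (1 - ((∫ ω, X ω ^ 2 ∂P : ℝ) : ℂ) / 2) _
    _ ≤ _ := add_le_add b1 b2
    _ = _ := by ring

/-- The Lyapunov bound for sums of independent centred random variables. -/
theorem norm_integral_exp_sum_sub_le {ι : Type*} [Fintype ι] {X : ι → Ω → ℝ}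
    (hX : ∀ i, AEMeasurable (X i) P) (hind : iIndepFun X P) (h0 : ∀ i, ∫ ω, X i ω ∂P = 0) {δ : ℝ}
    (hδ : 0 ≤ δ) (hδ1 : δ ≤ 1) (h : ∀ i, Integrable (fun ω => |X i ω| ^ (2 + δ)) P) :
    ‖∫ ω, Complex.exp ((∑ i, X i ω : ℝ) * Complex.I) ∂P -
        Real.exp (-((∑ i, ∫ ω, X i ω ^ 2 ∂P) / 2))‖ ≤
      5 * ∑ i, ∫ ω, |X i ω| ^ (2 + δ) ∂P := by
  have e1 : ∫ ω, Complex.exp ((∑ i, X i ω : ℝ) * Complex.I) ∂P =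
      ∏ i, ∫ ω, Complex.exp (X i ω * Complex.I) ∂P := by
    have := congrFun (hind.charFun_map_fun_sum_eq_prod hX) 1
    rw [charFun_apply_real, integral_map (by fun_prop) (by fun_prop)] at this
    simp only [Complex.ofReal_one, one_mul] at this
    rw [this, Finset.prod_apply]
    refine Finset.prod_congr rfl fun i _ => ?_
    rw [charFun_apply_real, integral_map (hX i) (by fun_prop)]
    simp
  have e2 : ((Real.exp (-((∑ i, ∫ ω, X i ω ^ 2 ∂P) / 2)) : ℝ) : ℂ) =
      ∏ i, ((Real.exp (-((∫ ω, X i ω ^ 2 ∂P) / 2)) : ℝ) : ℂ) := by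
    rw [← Complex.ofReal_prod, ← Real.exp_sum, Finset.sum_neg_distrib, Finset.sum_div]
  rw [e1, e2, Finset.mul_sum]
  refine (norm_prod_sub_prod_le_sum _ (fun i _ => ?_) (fun i _ => ?_)).trans
    (Finset.sum_le_sum fun i _ => norm_integral_exp_sub_le (hX i) (h0 i) hδ hδ1 (h i))
  · refine (norm_integral_le_integral_norm _).trans ?_
    simp [Complex.norm_exp_ofReal_mul_I]
  · rw [Complex.norm_real, Real.norm_of_nonneg (Real.exp_pos _).le]
    have : 0 ≤ ∫ ω, X i ω ^ 2 ∂P := integral_nonneg fun ω => sq_nonneg _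
    exact Real.exp_le_one_iff.2 (by linarith)

variable {𝓧 𝓨 : Type*} [MeasurableSpace 𝓧] [MeasurableSpace 𝓨]

/-- Integration over one of two independent random variables first, with the other one fixed. -/
theorem ProbabilityTheory.IndepFun.integral_comp_eq_integral_integral {X : Ω → 𝓧} {Y : Ω → 𝓨}
    (hX : Measurable X) (hY : Measurable Y) (hXY : IndepFun X Y P) {F : 𝓧 × 𝓨 → ℂ}
    (hF : Measurable F) {C : ℝ} (hC : ∀ z, ‖F z‖ ≤ C) :
    ∫ ω, F (X ω, Y ω) ∂P = ∫ ω, ∫ ω', F (X ω', Y ω) ∂P ∂P := by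
  have : IsProbabilityMeasure (P.map X) := Measure.isProbabilityMeasure_map hX.aemeasurable
  have : IsProbabilityMeasure (P.map Y) := Measure.isProbabilityMeasure_map hY.aemeasurable
  have h1 : ∫ ω, F (X ω, Y ω) ∂P = ∫ z, F z ∂((P.map X).prod (P.map Y)) := by
    rw [← (indepFun_iff_map_prod_eq_prod_map_map hX.aemeasurable hY.aemeasurable).1 hXY,
      integral_map (by fun_prop) hF.aestronglyMeasurable]
  have hsm : StronglyMeasurable fun y => ∫ x, F (x, y) ∂(P.map X) :=
    hF.stronglyMeasurable.integral_prod_left'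
  rw [h1, integral_prod_symm _ (Integrable.of_bound hF.aestronglyMeasurable C (ae_of_all _ hC)),
    integral_map hY.aemeasurable hsm.aestronglyMeasurable]
  refine integral_congr_ae (ae_of_all _ fun ω => ?_)
  have hFy : Measurable fun x => F (x, Y ω) := hF.comp (by fun_prop)
  exact integral_map hX.aemeasurable hFy.aestronglyMeasurable

theorem measurable_integral_comp {X : Ω → 𝓧} {Y : Ω → 𝓨}
    (hX : Measurable X) (hY : Measurable Y) {F : 𝓧 × 𝓨 → ℂ} (hF : Measurable F) :
    Measurable fun ω => ∫ ω', F (X ω', Y ω) ∂P :=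
  (StronglyMeasurable.integral_prod_left' (μ := P) (f := fun z : Ω × Ω => F (X z.1, Y z.2))
    (hF.comp (by fun_prop)).stronglyMeasurable).measurable

/-- Convergence of characteristic functions along a bounded sequence of arguments, for
random variables with second moments at most one. -/
theorem tendsto_charFun_sub_of_bounded {Ω : ℕ → Type*} [∀ n, MeasurableSpace (Ω n)]
    {P : ∀ n, Measure (Ω n)} [∀ n, IsProbabilityMeasure (P n)] {X : ∀ n, Ω n → ℝ}
    {μ : Measure ℝ} [IsProbabilityMeasure μ]
    (hX : TendstoInDistribution X atTop id P μ) (h2 : ∀ n, Integrable (fun ω => X n ω ^ 2) (P n))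
    (h2' : ∀ n, ∫ ω, X n ω ^ 2 ∂(P n) ≤ 1) {s : ℕ → ℝ} {t : ℝ} (hs : ∀ n, |s n| ≤ t) :
    Tendsto (fun n => charFun ((P n).map (X n)) (s n) - charFun μ (s n)) atTop (𝓝 0) := by
  have hXm := hX.forall_aemeasurable
  have hpt : ∀ u, Tendsto (fun n => charFun ((P n).map (X n)) u) atTop (𝓝 (charFun μ u)) := by
    intro u
    have := (ProbabilityMeasure.tendsto_iff_tendsto_charFun.1 hX.tendsto) u
    simpa using this
  -- A first absolute moment of at most one makes all these characteristic functions 1-Lipschitz, so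
  -- pointwise convergence is uniform on compact sets.
  have hlip : ∀ n u v, ‖charFun ((P n).map (X n)) u - charFun ((P n).map (X n)) v‖ ≤ |u - v| := by
    intro n u v
    have hb : ∀ r : ℝ, Integrable (fun ω => Complex.exp (r * X n ω * Complex.I)) (P n) := fun r =>
      Integrable.of_bound (by have := hXm n; fun_prop) 1 (ae_of_all _ fun ω => by
        rw [← Complex.ofReal_mul, Complex.norm_exp_ofReal_mul_I])
    have hL : MemLp (X n) 2 (P n) :=
      (memLp_two_iff_integrable_sq (hXm n).aestronglyMeasurable).2 (h2 n)
    have hL1 : Integrable (fun ω => |X n ω|) (P n) := (hL.integrable one_le_two).abs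
    have habs : ∫ ω, |X n ω| ∂(P n) ≤ 1 := by
      have : ∫ ω, |X n ω| ∂(P n) ≤ ∫ ω, (X n ω ^ 2 / 2 + 1 / 2) ∂(P n) := by
        refine integral_mono hL1 (((h2 n).div_const 2).add (integrable_const _)) fun ω => ?_
        simp only
        nlinarith [sq_abs (X n ω), sq_nonneg (|X n ω| - 1)]
      rw [integral_add ((h2 n).div_const 2) (integrable_const _), integral_div] at this
      simp only [integral_const, probReal_univ, smul_eq_mul, one_mul] at this
      linarith [h2' n]
    rw [charFun_apply_real, charFun_apply_real, integral_map (hXm n) (by fun_prop),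
      integral_map (hXm n) (by fun_prop), ← integral_sub (hb u) (hb v)]
    calc _ ≤ ∫ ω, ‖Complex.exp (u * X n ω * Complex.I) - Complex.exp (v * X n ω * Complex.I)‖
            ∂(P n) := norm_integral_le_integral_norm _
      _ ≤ ∫ ω, |u - v| * |X n ω| ∂(P n) := by
          refine integral_mono ((hb u).sub (hb v)).norm (hL1.const_mul _) fun ω => ?_
          have : Complex.exp (u * X n ω * Complex.I) - Complex.exp (v * X n ω * Complex.I) =
              Complex.exp ((v * X n ω : ℝ) * Complex.I) *
                (Complex.exp (Complex.I * ((u - v) * X n ω : ℝ)) - 1) := by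
            rw [mul_sub, ← Complex.exp_add, mul_one]
            push_cast
            ring_nf
          simp only
          rw [this, norm_mul, Complex.norm_exp_ofReal_mul_I, one_mul, ← abs_mul]
          exact Real.norm_exp_I_mul_ofReal_sub_one_le
      _ ≤ |u - v| := by
          rw [integral_const_mul]
          exact mul_le_of_le_one_right (abs_nonneg _) habs
  -- Along a subsequence the arguments converge to some u in [-t, t]; the Lipschitz bound replaces
  -- the moving argument by u.
  refine tendsto_of_subseq_tendsto fun ns hns => ?_
  obtain ⟨u, -, φ, hφ, hu⟩ := (isCompact_Icc (a := -t) (b := t)).tendsto_subseq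
    (x := fun k => s (ns k)) (fun k => abs_le.1 (hs (ns k)))
  refine ⟨φ, ?_⟩
  have hns' : Tendsto (fun k => ns (φ k)) atTop atTop := hns.comp hφ.tendsto_atTop
  have h1 : Tendsto (fun k => charFun ((P (ns (φ k))).map (X (ns (φ k)))) (s (ns (φ k))) -
      charFun ((P (ns (φ k))).map (X (ns (φ k)))) u) atTop (𝓝 0) := by
    refine squeeze_zero_norm (fun k => hlip _ _ _) ?_
    have : Tendsto (fun k => s (ns (φ k)) - u) atTop (𝓝 0) := by
      simpa using (show Tendsto (fun k => s (ns (φ k))) atTop (𝓝 u) from hu).sub_const u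
    simpa using this.abs
  have h3 : Tendsto (fun k => charFun μ (s (ns (φ k)))) atTop (𝓝 (charFun μ u)) :=
    (continuous_charFun.tendsto u).comp hu
  have := (h1.add ((hpt u).comp hns')).sub h3
  simpa [Function.comp_def] using this

end CharacteristicFunctions

/-! ### Inner products with random vectors as quadratic forms. -/

section QuadraticForms

theorem Matrix.abs_entry_le_frobenius_norm {m n : ℕ} (A : Matrix (Fin m) (Fin n) ℝ) (i : Fin m)
    (j : Fin n) : |A i j| ≤ ‖A‖ := by
  rw [Matrix.frobenius_norm_def, ← Real.sqrt_eq_rpow]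
  refine Real.le_sqrt_of_sq_le ?_
  have h1 : ‖A i j‖ ^ (2 : ℝ) ≤ ∑ j', ‖A i j'‖ ^ (2 : ℝ) :=
    Finset.single_le_sum (f := fun j' => ‖A i j'‖ ^ (2 : ℝ)) (fun _ _ => by positivity)
      (Finset.mem_univ j)
  have h2 : ∑ j', ‖A i j'‖ ^ (2 : ℝ) ≤ ∑ i', ∑ j', ‖A i' j'‖ ^ (2 : ℝ) :=
    Finset.single_le_sum (f := fun i' => ∑ j', ‖A i' j'‖ ^ (2 : ℝ))
      (fun _ _ => by positivity) (Finset.mem_univ i)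
  have h3 := h1.trans h2
  rwa [Real.norm_eq_abs, Real.rpow_two] at h3

variable {Ω : Type*} [MeasurableSpace Ω] {P : Measure Ω} {L : ℕ}

theorem EuclideanSpace.inner_eq_sum_mul (x y : EuclideanSpace ℝ (Fin L)) :
    inner ℝ x y = ∑ l, x l * y l := by
  simp [PiLp.inner_apply, mul_comm]

theorem EuclideanSpace.inner_sq_eq_sum (x y : EuclideanSpace ℝ (Fin L)) :
    (inner ℝ x y) ^ 2 = ∑ l, ∑ m, (x l * x m) * (y l * y m) := by
  rw [EuclideanSpace.inner_eq_sum_mul, sq, Finset.sum_mul_sum]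
  exact Finset.sum_congr rfl fun l _ => Finset.sum_congr rfl fun m _ => by ring

theorem MeasureTheory.MemLp.integrable_entry_mul {a : Ω → EuclideanSpace ℝ (Fin L)}
    (ha : MemLp a 2 P) (l m : Fin L) : Integrable (fun ω => a ω l * a ω m) P :=
  (ha.eval_piLp l).integrable_mul (ha.eval_piLp m)

/-- With v = e_i frozen, this exhibits the conditional variance as linear in the entries of e_i
e_iᵀ, to which the law of large numbers applies. -/
theorem integral_inner_sq_eq_sum {a : Ω → EuclideanSpace ℝ (Fin L)} (ha : MemLp a 2 P)
    (v : EuclideanSpace ℝ (Fin L)) :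
    ∫ ω, (inner ℝ (a ω) v) ^ 2 ∂P = ∑ l, ∑ m, (∫ ω, a ω l * a ω m ∂P) * (v l * v m) := by
  simp_rw [EuclideanSpace.inner_sq_eq_sum]
  rw [integral_finsetSum _ fun l _ =>
    integrable_finsetSum _ fun m _ => (ha.integrable_entry_mul l m).mul_const _]
  refine Finset.sum_congr rfl fun l _ => ?_
  rw [integral_finsetSum _ fun m _ => (ha.integrable_entry_mul l m).mul_const _]
  exact Finset.sum_congr rfl fun m _ => integral_mul_const _ _

variable {a e : Ω → EuclideanSpace ℝ (Fin L)}

theorem ProbabilityTheory.IndepFun.entry_mul (hae : IndepFun a e P) (l m l' m' : Fin L) :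
    IndepFun (fun ω => a ω l * a ω m) (fun ω => e ω l' * e ω m') P :=
  hae.comp (φ := fun x : EuclideanSpace ℝ (Fin L) => x l * x m)
    (ψ := fun x : EuclideanSpace ℝ (Fin L) => x l' * x m') (by fun_prop) (by fun_prop)

theorem ProbabilityTheory.IndepFun.integrable_inner_sq (hae : IndepFun a e P) (ha : MemLp a 2 P)
    (he : MemLp e 2 P) : Integrable (fun ω => (inner ℝ (a ω) (e ω)) ^ 2) P := by
  simp_rw [EuclideanSpace.inner_sq_eq_sum]
  exact integrable_finsetSum _ fun l _ => integrable_finsetSum _ fun m _ =>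
    (hae.entry_mul l m l m).integrable_mul (ha.integrable_entry_mul l m)
      (he.integrable_entry_mul l m)

/-- Independence factors each product of entries. The coefficients are the same as in
`integral_inner_sq_eq_sum`, so conditional and unconditional variances can be subtracted entry by
entry. -/
theorem ProbabilityTheory.IndepFun.integral_inner_sq (hae : IndepFun a e P) (ha : MemLp a 2 P)
    (he : MemLp e 2 P) :
    ∫ ω, (inner ℝ (a ω) (e ω)) ^ 2 ∂P =
      ∑ l, ∑ m, (∫ ω, a ω l * a ω m ∂P) * ∫ ω, e ω l * e ω m ∂P := by
  have hi : ∀ l m, Integrable (fun ω => a ω l * a ω m * (e ω l * e ω m)) P := fun l m =>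
    (hae.entry_mul l m l m).integrable_mul (ha.integrable_entry_mul l m)
      (he.integrable_entry_mul l m)
  simp_rw [EuclideanSpace.inner_sq_eq_sum]
  rw [integral_finsetSum _ fun l _ => integrable_finsetSum _ fun m _ => hi l m]
  refine Finset.sum_congr rfl fun l _ => ?_
  rw [integral_finsetSum _ fun m _ => hi l m]
  exact Finset.sum_congr rfl fun m _ => (hae.entry_mul l m l m).integral_fun_mul_eq_mul_integral
    (ha.integrable_entry_mul l m).aestronglyMeasurable
    (he.integrable_entry_mul l m).aestronglyMeasurable

theorem integral_inner_left_eq_zero [IsProbabilityMeasure P] (ha : MemLp a 2 P)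
    (h0 : ∀ l, ∫ ω, a ω l ∂P = 0) (v : EuclideanSpace ℝ (Fin L)) :
    ∫ ω, inner ℝ (a ω) v ∂P = 0 := by
  simp_rw [EuclideanSpace.inner_eq_sum_mul]
  rw [integral_finsetSum _ fun l _ =>
    ((ha.eval_piLp l).integrable one_le_two).mul_const _]
  simp [integral_mul_const, h0]

theorem memLp_two_of_integrable_norm_rpow [IsProbabilityMeasure P]
    {E : Type*} [NormedAddCommGroup E] {X : Ω → E} (hX : AEStronglyMeasurable X P) {δ : ℝ}
    (hδ : 0 ≤ δ) (h : Integrable (fun ω => ‖X ω‖ ^ (2 + δ)) P) : MemLp X 2 P := by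
  have := memLp_two_of_integrable_rpow (X := fun ω => ‖X ω‖) hX.norm.aemeasurable hδ (by
    simpa only [abs_norm] using h)
  exact (memLp_norm_iff hX).1 this

/-- Lyapunov bound for linear combinations of independent centred vectors. -/
theorem norm_integral_exp_inner_sum_sub_le [IsProbabilityMeasure P] {ι : Type*} [Fintype ι]
    {a : ι → Ω → EuclideanSpace ℝ (Fin L)} (hm : ∀ i, Measurable (a i)) (hind : iIndepFun a P)
    (h0 : ∀ i l, ∫ ω, a i ω l ∂P = 0) {δ C : ℝ} (hδ : 0 ≤ δ) (hδ1 : δ ≤ 1)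
    (hint : ∀ i, Integrable (fun ω => ‖a i ω‖ ^ (2 + δ)) P)
    (hC : ∀ i, ∫ ω, ‖a i ω‖ ^ (2 + δ) ∂P ≤ C) (v : ι → EuclideanSpace ℝ (Fin L)) (u : ℝ) :
    ‖∫ ω, Complex.exp ((u * ∑ i, inner ℝ (a i ω) (v i) : ℝ) * Complex.I) ∂P -
        Real.exp (-(u ^ 2 * (∑ i, ∫ ω, (inner ℝ (a i ω) (v i)) ^ 2 ∂P) / 2))‖ ≤
      5 * C * |u| ^ (2 + δ) * ∑ i, ‖v i‖ ^ (2 + δ) := by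
  have hL : ∀ i, MemLp (a i) 2 P := fun i =>
    memLp_two_of_integrable_norm_rpow (hm i).aestronglyMeasurable hδ (hint i)
  have hXm : ∀ i, Measurable fun ω => u * inner ℝ (a i ω) (v i) := fun i => by
    have := hm i; fun_prop
  have hpt : ∀ i ω, |u * inner ℝ (a i ω) (v i)| ^ (2 + δ) ≤
      |u| ^ (2 + δ) * ‖v i‖ ^ (2 + δ) * ‖a i ω‖ ^ (2 + δ) := by
    intro i ω
    rw [← Real.mul_rpow (abs_nonneg _) (norm_nonneg _),
      ← Real.mul_rpow (by positivity) (norm_nonneg _), abs_mul, mul_assoc]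
    refine Real.rpow_le_rpow (by positivity) ?_ (by positivity)
    gcongr
    rw [mul_comm]
    exact abs_real_inner_le_norm _ _
  have hXint : ∀ i, Integrable (fun ω => |u * inner ℝ (a i ω) (v i)| ^ (2 + δ)) P := fun i =>
    Integrable.mono' ((hint i).const_mul _) ((hXm i).abs.pow_const _).aestronglyMeasurable (ae_of_all _ fun ω => by
      rw [Real.norm_of_nonneg (by positivity)]; exact hpt i ω)
  have hXind : iIndepFun (fun i ω => u * inner ℝ (a i ω) (v i)) P :=
    hind.comp (g := fun i x => u * inner ℝ x (v i)) (fun i => by fun_prop)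
  have h1 := norm_integral_exp_sum_sub_le (fun i => (hXm i).aemeasurable) hXind (fun i => by
    rw [integral_const_mul, integral_inner_left_eq_zero (hL i) (h0 i), mul_zero]) hδ hδ1 hXint
  simp only [mul_pow, integral_const_mul, ← Finset.mul_sum] at h1
  refine h1.trans ?_
  calc 5 * ∑ i, ∫ ω, |u * inner ℝ (a i ω) (v i)| ^ (2 + δ) ∂P
      ≤ 5 * ∑ i, |u| ^ (2 + δ) * ‖v i‖ ^ (2 + δ) * C := by
        gcongr with i
        refine (integral_mono (hXint i) ((hint i).const_mul _) (hpt i)).trans ?_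
        rw [integral_const_mul]
        exact mul_le_mul_of_nonneg_left (hC i) (by positivity)
    _ = _ := by
        simp only [Finset.mul_sum]
        exact Finset.sum_congr rfl fun i _ => by ring

end QuadraticForms

/-! ### Conditional characteristic functions given the weakly dependent vectors. -/

section ConditionalCentralLimitTheorem

variable {L : ℕ} {Ω : ℕ → Type*} [∀ n, MeasurableSpace (Ω n)] {P : ∀ n, Measure (Ω n)}
  {a e : ∀ n, Fin n → Ω n → EuclideanSpace ℝ (Fin L)}

/-- The average conditional variance of `aᵢᵀ eᵢ` given the vectors `eᵢ`. -/
def conditionalVariance (P : ∀ n, Measure (Ω n))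
    (a e : ∀ n, Fin n → Ω n → EuclideanSpace ℝ (Fin L)) (n : ℕ) (ω : Ω n) : ℝ :=
  (n : ℝ)⁻¹ * ∑ i, ∫ ω', (inner ℝ (a n i ω') (e n i ω)) ^ 2 ∂(P n)

theorem conditionalVariance_nonneg (n : ℕ) (ω : Ω n) : 0 ≤ conditionalVariance P a e n ω :=
  mul_nonneg (by positivity) (Finset.sum_nonneg fun _ _ => integral_nonneg fun _ => sq_nonneg _)

variable [∀ n, IsProbabilityMeasure (P n)]

/-- The covariance matrix V of a_i does not depend on i, so it factors out of the average over i.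
The difference is then a sum of L² entries of the matrix in the law of large numbers, weighted by
bounded coefficients. -/
theorem isLittleOp_conditionalVariance_sub (ha : ∀ n i, MemLp (a n i) 2 (P n))
    (he : ∀ n i, MemLp (e n i) 2 (P n)) (hae : ∀ n i, IndepFun (a n i) (e n i) (P n))
    {V : ℕ → Fin L → Fin L → ℝ} (hV : ∀ n i l m, ∫ ω, a n i ω l * a n i ω m ∂(P n) = V n l m)
    {C : ℝ} (hC : ∀ᶠ n in atTop, ∀ l m, |V n l m| ≤ C)
    (hlln : IsLittleOp P fun (n : ℕ) ω =>
      (n : ℝ)⁻¹ • (∑ i : Fin n, Matrix.vecMulVec (⇑(e n i ω)) (⇑(e n i ω))) -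
        (n : ℝ)⁻¹ • ∑ i : Fin n, Matrix.of fun l m => ∫ ω', e n i ω' l * e n i ω' m ∂(P n)) :
    IsLittleOp P fun (n : ℕ) ω => conditionalVariance P a e n ω -
      (n : ℝ)⁻¹ * ∑ i, ∫ ω', (inner ℝ (a n i ω') (e n i ω')) ^ 2 ∂(P n) := by
  have hterm : ∀ l m, IsLittleOp P fun (n : ℕ) ω => V n l m *
      ((n : ℝ)⁻¹ * (∑ i, e n i ω l * e n i ω m) -
        (n : ℝ)⁻¹ * ∑ i, ∫ ω', e n i ω' l * e n i ω' m ∂(P n)) := by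
    intro l m
    refine ((isBigOp_const C).mul_isLittleOp hlln.norm).of_le ?_
    filter_upwards [hC] with n hn
    refine ae_of_all _ fun ω => ?_
    rw [norm_mul, norm_mul, norm_norm]
    have h1 := Matrix.abs_entry_le_frobenius_norm ((n : ℝ)⁻¹ • (∑ i : Fin n,
      Matrix.vecMulVec (⇑(e n i ω)) (⇑(e n i ω))) - (n : ℝ)⁻¹ • ∑ i : Fin n,
        Matrix.of fun l m => ∫ ω', e n i ω' l * e n i ω' m ∂(P n)) l m
    simp only [Matrix.sub_apply, Matrix.smul_apply, Matrix.sum_apply, Matrix.vecMulVec_apply,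
      Matrix.of_apply, smul_eq_mul] at h1
    rw [Real.norm_eq_abs, Real.norm_eq_abs, Real.norm_eq_abs]
    exact mul_le_mul ((hn l m).trans (le_abs_self C)) h1 (abs_nonneg _) (abs_nonneg _)
  refine (IsLittleOp.sum Finset.univ fun l _ => IsLittleOp.sum Finset.univ fun m _ =>
    hterm l m).of_le (Eventually.of_forall fun n => ae_of_all _ fun ω => le_of_eq (congrArg _ ?_))
  simp only [conditionalVariance, integral_inner_sq_eq_sum (ha n _),
    (hae n _).integral_inner_sq (ha n _) (he n _), hV]
  simp only [mul_sub, Finset.sum_sub_distrib, Finset.mul_sum]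
  congr 1
  · rw [Finset.sum_comm]
    refine Finset.sum_congr rfl fun l _ => ?_
    rw [Finset.sum_comm]
    exact Finset.sum_congr rfl fun m _ => Finset.sum_congr rfl fun i _ => by ring
  · rw [Finset.sum_comm]
    refine Finset.sum_congr rfl fun l _ => ?_
    rw [Finset.sum_comm]
    exact Finset.sum_congr rfl fun m _ => Finset.sum_congr rfl fun i _ => by ring

/-- Reduce to x ≤ y, factor out e^{-x} ≤ 1 and use 1 - e^{-u} ≤ u. -/
theorem abs_exp_neg_sub_exp_neg_le {x y : ℝ} (hx : 0 ≤ x) (hy : 0 ≤ y) :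
    |Real.exp (-x) - Real.exp (-y)| ≤ |x - y| := by
  wlog hxy : x ≤ y generalizing x y
  · rw [abs_sub_comm, abs_sub_comm x]
    exact this hy hx (le_of_not_ge hxy)
  have h1 : Real.exp (-y) ≤ Real.exp (-x) := Real.exp_le_exp.2 (by linarith)
  have h2 : Real.exp (-x) ≤ 1 := Real.exp_le_one_iff.2 (by linarith)
  have h3 : Real.exp (-y) = Real.exp (-x) * Real.exp (-(y - x)) := by
    rw [← Real.exp_add]; congr 1; ring
  have h4 := Real.add_one_le_exp (-(y - x))
  rw [abs_of_nonneg (by linarith), abs_of_nonpos (by linarith), h3]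
  nlinarith [Real.exp_pos (-x)]

/-- Conditionally on the vectors `eᵢ`, the characteristic function of the scaled sum of the `aᵢᵀ eᵢ`
is close to that of a centred Gaussian whose variance is not random. -/
theorem isLittleOp_integral_exp_sub_exp (ham : ∀ n i, Measurable (a n i))
    (hind : ∀ n, iIndepFun (a n) (P n)) (h0 : ∀ n i l, ∫ ω, a n i ω l ∂(P n) = 0)
    {δ C : ℝ} (hδ : 0 < δ) (hδ1 : δ ≤ 1)
    (hint : ∀ n i, Integrable (fun ω => ‖a n i ω‖ ^ (2 + δ)) (P n))
    (hC : ∀ n i, ∫ ω, ‖a n i ω‖ ^ (2 + δ) ∂(P n) ≤ C)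
    (hmom : IsBigOp P fun (n : ℕ) ω => (n : ℝ)⁻¹ * ∑ i, ‖e n i ω‖ ^ (2 + δ))
    {v : ℕ → ℝ} (hv : ∀ n, 0 ≤ v n)
    (hvar : IsLittleOp P fun (n : ℕ) ω => conditionalVariance P a e n ω - v n)
    {s : ℕ → ℝ} {S : ℝ} (hs : ∀ᶠ n in atTop, |s n| ≤ S) :
    IsLittleOp P fun (n : ℕ) ω =>
      ∫ ω', Complex.exp ((s n * (√(n : ℝ))⁻¹ * ∑ i, inner ℝ (a n i ω') (e n i ω) : ℝ) *
        Complex.I) ∂(P n) - (Real.exp (-(s n ^ 2 * v n / 2)) : ℂ) := by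
  -- The scale n^{-1/2} raised to the power 2 + δ is n⁻¹ n^{-δ/2}: the n⁻¹ forms the average of the
  -- ‖e_i‖^{2+δ}, which is O_p(1), and n^{-δ/2} is left over.
  have hrate : IsLittleOp P fun (n : ℕ) (_ : Ω n) =>
      5 * C * S ^ (2 + δ) * (n : ℝ) ^ (-(δ / 2)) := by
    refine isLittleOp_of_tendsto_zero ?_
    have : Tendsto (fun n : ℕ => (n : ℝ) ^ (-(δ / 2))) atTop (𝓝 0) :=
      (tendsto_rpow_neg_atTop (by positivity)).comp tendsto_natCast_atTop_atTop
    simpa using this.const_mul (5 * C * S ^ (2 + δ))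
  have hfirst : IsLittleOp P fun (n : ℕ) ω =>
      ∫ ω', Complex.exp ((s n * (√(n : ℝ))⁻¹ * ∑ i, inner ℝ (a n i ω') (e n i ω) : ℝ) *
        Complex.I) ∂(P n) -
          (Real.exp (-(s n ^ 2 * conditionalVariance P a e n ω / 2)) : ℂ) := by
    refine (hmom.mul_isLittleOp hrate).of_le ?_
    filter_upwards [hs, eventually_gt_atTop 0] with n hsn hn
    refine ae_of_all _ fun ω => ?_
    have hn' : (0 : ℝ) < n := by exact_mod_cast hn
    have hC0 : 0 ≤ C := (integral_nonneg fun ω => by positivity).trans (hC n ⟨0, hn⟩)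
    have hS0 : 0 ≤ S := (abs_nonneg _).trans hsn
    have h1 := norm_integral_exp_inner_sum_sub_le (ham n) (hind n) (h0 n) hδ.le hδ1 (hint n) (hC n)
      (fun i => e n i ω) (s n * (√(n : ℝ))⁻¹)
    have h2 : (s n * (√(n : ℝ))⁻¹) ^ 2 *
        (∑ i, ∫ ω', (inner ℝ (a n i ω') (e n i ω)) ^ 2 ∂(P n)) / 2 =
          s n ^ 2 * conditionalVariance P a e n ω / 2 := by
      rw [conditionalVariance, mul_pow, inv_pow, Real.sq_sqrt hn'.le]
      ring
    rw [h2] at h1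
    refine h1.trans ?_
    have h3 : |s n * (√(n : ℝ))⁻¹| ^ (2 + δ) ≤
        S ^ (2 + δ) * ((n : ℝ) ^ (-(δ / 2)) * (n : ℝ)⁻¹) := by
      rw [abs_mul, Real.mul_rpow (abs_nonneg _) (abs_nonneg _)]
      have h4 : |(√(n : ℝ))⁻¹| ^ (2 + δ) = (n : ℝ) ^ (-(δ / 2)) * (n : ℝ)⁻¹ := by
        rw [abs_of_nonneg (by positivity), Real.sqrt_eq_rpow, ← Real.rpow_neg hn'.le,
          ← Real.rpow_mul hn'.le, ← Real.rpow_neg_one (n : ℝ), ← Real.rpow_add hn']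
        congr 1; ring
      rw [h4]
      gcongr
    rw [Real.norm_of_nonneg (by positivity)]
    calc 5 * C * |s n * (√(n : ℝ))⁻¹| ^ (2 + δ) * ∑ i, ‖e n i ω‖ ^ (2 + δ)
        ≤ 5 * C * (S ^ (2 + δ) * ((n : ℝ) ^ (-(δ / 2)) * (n : ℝ)⁻¹)) *
            ∑ i, ‖e n i ω‖ ^ (2 + δ) := by gcongr
      _ = _ := by ring
  -- Here the random conditional variance is replaced by its nonrandom proxy, which is possible as u
  -- ↦ e^{-u} is 1-Lipschitz on u ≥ 0.
  have hsecond : IsLittleOp P fun (n : ℕ) ω =>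
      (Real.exp (-(s n ^ 2 * conditionalVariance P a e n ω / 2)) : ℂ) -
        (Real.exp (-(s n ^ 2 * v n / 2)) : ℂ) := by
    refine ((isBigOp_const (S ^ 2 / 2)).mul_isLittleOp hvar).of_le ?_
    filter_upwards [hs] with n hsn
    refine ae_of_all _ fun ω => ?_
    have hq := conditionalVariance_nonneg (P := P) (a := a) (e := e) n ω
    have hvn := hv n
    rw [← Complex.ofReal_sub, Complex.norm_real, Real.norm_eq_abs, norm_mul]
    refine (abs_exp_neg_sub_exp_neg_le (by positivity) (by positivity)).trans ?_
    have h1 : s n ^ 2 * conditionalVariance P a e n ω / 2 - s n ^ 2 * v n / 2 =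
        s n ^ 2 / 2 * (conditionalVariance P a e n ω - v n) := by ring
    rw [h1, abs_mul, Real.norm_eq_abs, Real.norm_eq_abs, abs_of_nonneg (by positivity),
      abs_of_nonneg (by positivity : 0 ≤ S ^ 2 / 2), ← sq_abs (s n)]
    gcongr
  refine (hfirst.add hsecond).of_le
    (Eventually.of_forall fun n => ae_of_all _ fun ω => le_of_eq (congrArg _ ?_))
  ring

end ConditionalCentralLimitTheorem

/-! ### From the conditional limit to the joint central limit theorem. -/

section ConditionalCentralLimitTheorem

variable {L : ℕ} {Ω : ℕ → Type*} [∀ n, MeasurableSpace (Ω n)] {P : ∀ n, Measure (Ω n)}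
  [∀ n, IsProbabilityMeasure (P n)] {a e : ∀ n, Fin n → Ω n → EuclideanSpace ℝ (Fin L)}

/-- Central limit theorem for sums of products of independent centred vectors with weakly dependent
vectors, when the products with the means satisfy a central limit theorem. -/
theorem tendstoInDistribution_sum_inner_add (ham : ∀ n i, Measurable (a n i))
    (hem : ∀ n i, Measurable (e n i)) (heL : ∀ n i, MemLp (e n i) 2 (P n))
    (hind : ∀ n, iIndepFun (a n) (P n))
    (hae : ∀ n, IndepFun (fun ω i => a n i ω) (fun ω i => e n i ω) (P n))
    (h0 : ∀ n i l, ∫ ω, a n i ω l ∂(P n) = 0)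
    {δ C : ℝ} (hδ : 0 < δ) (hδ1 : δ ≤ 1)
    (hint : ∀ n i, Integrable (fun ω => ‖a n i ω‖ ^ (2 + δ)) (P n))
    (hC : ∀ n i, ∫ ω, ‖a n i ω‖ ^ (2 + δ) ∂(P n) ≤ C)
    (hmom : IsBigOp P fun (n : ℕ) ω => (n : ℝ)⁻¹ * ∑ i, ‖e n i ω‖ ^ (2 + δ))
    {μ : ℕ → EuclideanSpace ℝ (Fin L)} {v₁ v₂ : ℕ → ℝ} (hv₁ : ∀ n, 0 ≤ v₁ n) {κ : ℝ} (hκ : 0 < κ)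
    (hκv : ∀ᶠ n in atTop, κ ≤ v₁ n)
    (hvar : IsLittleOp P fun (n : ℕ) ω => conditionalVariance P a e n ω - v₁ n)
    (hv₂ : ∀ n : ℕ, ∫ ω, ((√(n : ℝ))⁻¹ * ∑ i, inner ℝ (μ n) (e n i ω)) ^ 2 ∂(P n) = v₂ n)
    (hclt : TendstoInDistribution
      (fun (n : ℕ) ω => (√(v₂ n))⁻¹ * ((√(n : ℝ))⁻¹ * ∑ i, inner ℝ (μ n) (e n i ω)))
      atTop id P (gaussianReal 0 1)) :
    TendstoInDistribution (fun (n : ℕ) ω =>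
      ((√(n : ℝ))⁻¹ * ∑ i, inner ℝ (a n i ω) (e n i ω) +
        (√(n : ℝ))⁻¹ * ∑ i, inner ℝ (μ n) (e n i ω)) / √(v₁ n + v₂ n))
      atTop id P (gaussianReal 0 1) := by
  have hTm : ∀ n : ℕ, Measurable fun ω =>
      (√(n : ℝ))⁻¹ * ∑ i, inner ℝ (μ n) (e n i ω) := fun n => by
    have := hem n; fun_prop
  have hAm : ∀ n : ℕ, Measurable fun ω =>
      (√(n : ℝ))⁻¹ * ∑ i, inner ℝ (a n i ω) (e n i ω) := fun n => by
    have := hem n; have := ham n; fun_prop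
  have hSm : ∀ n : ℕ, Measurable fun ω =>
      ((√(n : ℝ))⁻¹ * ∑ i, inner ℝ (a n i ω) (e n i ω) +
        (√(n : ℝ))⁻¹ * ∑ i, inner ℝ (μ n) (e n i ω)) / √(v₁ n + v₂ n) := fun n =>
    ((hAm n).add (hTm n)).div_const _
  have hv₂0 : ∀ n, 0 ≤ v₂ n := fun n => by
    rw [← hv₂ n]; exact integral_nonneg fun _ => sq_nonneg _
  have hTsq : ∀ n : ℕ, Integrable (fun ω =>
      ((√(n : ℝ))⁻¹ * ∑ i, inner ℝ (μ n) (e n i ω)) ^ 2) (P n) := fun n => by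
    have h1 : MemLp (fun ω => ∑ i, inner ℝ (μ n) (e n i ω)) 2 (P n) :=
      memLp_finsetSum _ fun i _ => (heL n i).const_inner (μ n)
    exact (h1.const_mul _).integrable_sq
  refine ⟨fun n => (hSm n).aemeasurable, aemeasurable_id,
    ProbabilityMeasure.tendsto_iff_tendsto_charFun.2 fun t => ?_⟩
  simp only [ProbabilityMeasure.coe_mk, Measure.map_id]
  set s : ℕ → ℝ := fun n => t / √(v₁ n + v₂ n) with hs
  have hsb : ∀ᶠ n in atTop, |s n| ≤ |t| / √κ := by
    filter_upwards [hκv] with n hn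
    rw [hs, abs_div, abs_of_nonneg (Real.sqrt_nonneg _)]
    have : √κ ≤ √(v₁ n + v₂ n) := Real.sqrt_le_sqrt (by linarith [hv₂0 n])
    have : 0 < √κ := Real.sqrt_pos.2 hκ
    gcongr
  -- The standardized second sum has its characteristic function evaluated at s √v₂, which stays in
  -- [-|t|, |t|] because v₂ ≤ v₁ + v₂.
  have hs2 : ∀ n, |s n * √(v₂ n)| ≤ |t| := by
    intro n
    rw [hs, abs_mul, abs_div, abs_of_nonneg (Real.sqrt_nonneg _),
      abs_of_nonneg (Real.sqrt_nonneg _), div_mul_eq_mul_div]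
    refine div_le_of_le_mul₀ (Real.sqrt_nonneg _) (abs_nonneg _) ?_
    gcongr
    linarith [hv₁ n]
  -- R is the error of replacing the conditional characteristic function given the e_i by its
  -- Gaussian proxy.
  let R : ∀ n, Ω n → ℂ := fun n ω =>
    ∫ ω', Complex.exp ((s n * (√(n : ℝ))⁻¹ * ∑ i, inner ℝ (a n i ω') (e n i ω) : ℝ) *
      Complex.I) ∂(P n) - (Real.exp (-(s n ^ 2 * v₁ n / 2)) : ℂ)
  have hR : IsLittleOp P R :=
    isLittleOp_integral_exp_sub_exp ham hind h0 hδ hδ1 hint hC hmom hv₁ hvar hsb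
  have hIm : ∀ n, Measurable fun ω => ∫ ω', Complex.exp
      ((s n * (√(n : ℝ))⁻¹ * ∑ i, inner ℝ (a n i ω') (e n i ω) : ℝ) * Complex.I) ∂(P n) :=
    fun n => measurable_integral_comp (P := P n) (X := fun ω i => a n i ω)
      (Y := fun ω i => e n i ω) (measurable_pi_lambda _ (ham n)) (measurable_pi_lambda _ (hem n))
      (F := fun z => Complex.exp ((s n * (√(n : ℝ))⁻¹ * ∑ i, inner ℝ (z.1 i) (z.2 i) : ℝ) *
        Complex.I)) (by fun_prop)
  have hRm : ∀ n, Measurable (R n) := fun n => (hIm n).sub measurable_const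
  have hIb : ∀ n ω, ‖∫ ω', Complex.exp
      ((s n * (√(n : ℝ))⁻¹ * ∑ i, inner ℝ (a n i ω') (e n i ω) : ℝ) * Complex.I) ∂(P n)‖ ≤ 1 :=
    fun n ω => (norm_integral_le_integral_norm _).trans (by
      simp only [Complex.norm_exp_ofReal_mul_I]; simp)
  have hEb : ∀ n, ‖(Real.exp (-(s n ^ 2 * v₁ n / 2)) : ℂ)‖ ≤ 1 := fun n => by
    rw [Complex.norm_real, Real.norm_of_nonneg (Real.exp_pos _).le]
    have := hv₁ n
    exact Real.exp_le_one_iff.2 (by have : 0 ≤ s n ^ 2 * v₁ n / 2 := by positivity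
                                    linarith)
  have hRb : ∀ n ω, ‖R n ω‖ ≤ 2 := fun n ω =>
    (norm_sub_le _ _).trans (by linarith [hIb n ω, hEb n])
  have hRlim := hR.tendsto_integral_norm (fun n => (hRm n).aestronglyMeasurable)
    (Eventually.of_forall fun n => ae_of_all _ (hRb n))
  -- Only an inequality: if v₂ n = 0, the convention 0⁻¹ = 0 makes the standardized sum vanish.
  have hT1 : ∀ n, ∫ ω, ((√(v₂ n))⁻¹ * ((√(n : ℝ))⁻¹ * ∑ i, inner ℝ (μ n) (e n i ω))) ^ 2 ∂(P n)
      ≤ 1 := by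
    intro n
    simp_rw [mul_pow _ ((√(n : ℝ))⁻¹ * _)]
    rw [integral_const_mul, hv₂ n, inv_pow, Real.sq_sqrt (hv₂0 n)]
    exact inv_mul_le_one
  have hchar := tendsto_charFun_sub_of_bounded hclt (fun n => by
    simp_rw [mul_pow _ ((√(n : ℝ))⁻¹ * _)]
    exact (hTsq n).const_mul _) hT1 hs2
  have hTchar : ∀ n, ∫ ω, Complex.exp
      ((s n * ((√(n : ℝ))⁻¹ * ∑ i, inner ℝ (μ n) (e n i ω)) : ℝ) * Complex.I) ∂(P n) =
        charFun ((P n).map fun ω =>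
          (√(v₂ n))⁻¹ * ((√(n : ℝ))⁻¹ * ∑ i, inner ℝ (μ n) (e n i ω))) (s n * √(v₂ n)) := by
    intro n
    rw [charFun_apply_real, integral_map ((hTm n).const_mul _).aemeasurable (by fun_prop)]
    refine integral_congr_ae ?_
    -- If v₂ n = 0, the standardization cannot be undone by multiplication, but then the sum itself
    -- vanishes almost surely and both sides are 1.
    rcases (hv₂0 n).eq_or_lt with h | h
    · have hz : ∫ ω, ((√(n : ℝ))⁻¹ * ∑ i, inner ℝ (μ n) (e n i ω)) ^ 2 ∂(P n) = 0 := by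
        rw [hv₂ n, ← h]
      rw [integral_eq_zero_iff_of_nonneg (fun _ => sq_nonneg _) (hTsq n)] at hz
      filter_upwards [hz] with ω hω
      have : (√(n : ℝ))⁻¹ * ∑ i, inner ℝ (μ n) (e n i ω) = 0 := by
        simpa only [Pi.zero_apply, sq_eq_zero_iff] using hω
      rw [this]
      simp
    · refine ae_of_all _ fun ω => ?_
      have : √(v₂ n) ≠ 0 := (Real.sqrt_pos.2 h).ne'
      have h2 : s n * ((√(n : ℝ))⁻¹ * ∑ i, inner ℝ (μ n) (e n i ω)) = s n * √(v₂ n) *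
          ((√(v₂ n))⁻¹ * ((√(n : ℝ))⁻¹ * ∑ i, inner ℝ (μ n) (e n i ω))) := by
        field_simp
      simp only
      rw [h2]
      push_cast
      rfl
  -- Integrate over the a_i first, with the e_i fixed; the factor from the μᵀ e_i does not involve
  -- the a_i and comes out of the inner integral.
  have hfub : ∀ n, charFun ((P n).map fun ω =>
      ((√(n : ℝ))⁻¹ * ∑ i, inner ℝ (a n i ω) (e n i ω) +
        (√(n : ℝ))⁻¹ * ∑ i, inner ℝ (μ n) (e n i ω)) / √(v₁ n + v₂ n)) t =
      ∫ ω, Complex.exp ((s n * ((√(n : ℝ))⁻¹ * ∑ i, inner ℝ (μ n) (e n i ω)) : ℝ) * Complex.I) *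
        ∫ ω', Complex.exp ((s n * (√(n : ℝ))⁻¹ * ∑ i, inner ℝ (a n i ω') (e n i ω) : ℝ) *
          Complex.I) ∂(P n) ∂(P n) := by
    intro n
    rw [charFun_apply_real, integral_map (hSm n).aemeasurable (by fun_prop)]
    have h1 := (hae n).integral_comp_eq_integral_integral (measurable_pi_lambda _ (ham n))
      (measurable_pi_lambda _ (hem n)) (F := fun z : (Fin n → EuclideanSpace ℝ (Fin L)) ×
          (Fin n → EuclideanSpace ℝ (Fin L)) =>
        Complex.exp ((s n * ((√(n : ℝ))⁻¹ * ∑ i, inner ℝ (μ n) (z.2 i)) : ℝ) * Complex.I) *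
        Complex.exp ((s n * (√(n : ℝ))⁻¹ * ∑ i, inner ℝ (z.1 i) (z.2 i) : ℝ) *
          Complex.I)) (by fun_prop) (C := 1) (fun z => by
            rw [norm_mul, Complex.norm_exp_ofReal_mul_I, Complex.norm_exp_ofReal_mul_I, one_mul])
    simp only [integral_const_mul] at h1
    rw [← h1]
    refine integral_congr_ae (ae_of_all _ fun ω => ?_)
    simp only
    rw [← Complex.exp_add]
    congr 1
    simp only [hs]
    push_cast
    ring
  -- The Gaussian characteristic function at t factors along s² v₁ + s² v₂ = t². One term carries
  -- the error R against a factor of modulus one; the other carries the error in the assumed central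
  -- limit theorem.
  have hdecomp : ∀ᶠ n in atTop, charFun ((P n).map fun ω =>
      ((√(n : ℝ))⁻¹ * ∑ i, inner ℝ (a n i ω) (e n i ω) +
        (√(n : ℝ))⁻¹ * ∑ i, inner ℝ (μ n) (e n i ω)) / √(v₁ n + v₂ n)) t -
          charFun (gaussianReal 0 1) t =
      (∫ ω, Complex.exp ((s n * ((√(n : ℝ))⁻¹ * ∑ i, inner ℝ (μ n) (e n i ω)) : ℝ) * Complex.I) *
        R n ω ∂(P n)) + (Real.exp (-(s n ^ 2 * v₁ n / 2)) : ℂ) *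
          (charFun ((P n).map fun ω =>
            (√(v₂ n))⁻¹ * ((√(n : ℝ))⁻¹ * ∑ i, inner ℝ (μ n) (e n i ω))) (s n * √(v₂ n)) -
              charFun (gaussianReal 0 1) (s n * √(v₂ n))) := by
    filter_upwards [hκv] with n hn
    have hexpm : Measurable fun ω => Complex.exp
        ((s n * ((√(n : ℝ))⁻¹ * ∑ i, inner ℝ (μ n) (e n i ω)) : ℝ) * Complex.I) := by
      have := hTm n; fun_prop
    have hexpi : Integrable (fun ω => Complex.exp
        ((s n * ((√(n : ℝ))⁻¹ * ∑ i, inner ℝ (μ n) (e n i ω)) : ℝ) * Complex.I)) (P n) :=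
      Integrable.of_bound hexpm.aestronglyMeasurable 1 (ae_of_all _ fun ω => by
        rw [Complex.norm_exp_ofReal_mul_I])
    have hgauss : charFun (gaussianReal 0 1) t = (Real.exp (-(s n ^ 2 * v₁ n / 2)) : ℂ) *
        charFun (gaussianReal 0 1) (s n * √(v₂ n)) := by
      rw [charFun_gaussianReal, charFun_gaussianReal, Complex.ofReal_exp, ← Complex.exp_add]
      congr 1
      have hpos : 0 < v₁ n + v₂ n := by linarith [hv₂0 n]
      have h3 : t ^ 2 = s n ^ 2 * v₁ n + (s n * √(v₂ n)) ^ 2 := by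
        simp only [hs]
        rw [mul_pow, div_pow, Real.sq_sqrt hpos.le, Real.sq_sqrt (hv₂0 n)]
        field_simp
      have h4 : (t : ℂ) ^ 2 = (s n : ℂ) ^ 2 * v₁ n + ((s n * √(v₂ n) : ℝ) : ℂ) ^ 2 := by
        exact_mod_cast h3
      simp only [Complex.ofReal_zero, mul_zero, zero_mul, NNReal.coe_one, Complex.ofReal_one,
        one_mul, zero_sub, h4]
      push_cast
      ring
    rw [hfub n, hgauss, mul_sub, ← hTchar n]
    have hsplit : ∫ ω, Complex.exp
        ((s n * ((√(n : ℝ))⁻¹ * ∑ i, inner ℝ (μ n) (e n i ω)) : ℝ) * Complex.I) *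
        R n ω ∂(P n) = (∫ ω, Complex.exp
          ((s n * ((√(n : ℝ))⁻¹ * ∑ i, inner ℝ (μ n) (e n i ω)) : ℝ) * Complex.I) *
        ∫ ω', Complex.exp ((s n * (√(n : ℝ))⁻¹ * ∑ i, inner ℝ (a n i ω') (e n i ω) : ℝ) *
          Complex.I) ∂(P n) ∂(P n)) - (Real.exp (-(s n ^ 2 * v₁ n / 2)) : ℂ) *
          ∫ ω, Complex.exp
            ((s n * ((√(n : ℝ))⁻¹ * ∑ i, inner ℝ (μ n) (e n i ω)) : ℝ) * Complex.I) ∂(P n) := by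
      rw [← integral_const_mul, ← integral_sub]
      · refine integral_congr_ae (ae_of_all _ fun ω => ?_)
        simp only [R]
        ring
      · exact Integrable.of_bound (hexpm.mul (hIm n)).aestronglyMeasurable 1
          (ae_of_all _ fun ω => by
            rw [norm_mul, Complex.norm_exp_ofReal_mul_I, one_mul]; exact hIb n ω)
      · exact hexpi.const_mul _
    rw [hsplit]
    ring
  rw [← tendsto_sub_nhds_zero_iff]
  refine Tendsto.congr' (hdecomp.mono fun n h => h.symm) ?_
  have hl1 : Tendsto (fun n => ∫ ω, Complex.exp
      ((s n * ((√(n : ℝ))⁻¹ * ∑ i, inner ℝ (μ n) (e n i ω)) : ℝ) * Complex.I) *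
        R n ω ∂(P n)) atTop (𝓝 0) := by
    refine squeeze_zero_norm (fun n => ?_) hRlim
    refine (norm_integral_le_integral_norm _).trans (le_of_eq ?_)
    simp only [norm_mul, Complex.norm_exp_ofReal_mul_I, one_mul]
  have hl2 : Tendsto (fun n => (Real.exp (-(s n ^ 2 * v₁ n / 2)) : ℂ) *
          (charFun ((P n).map fun ω =>
            (√(v₂ n))⁻¹ * ((√(n : ℝ))⁻¹ * ∑ i, inner ℝ (μ n) (e n i ω))) (s n * √(v₂ n)) -
              charFun (gaussianReal 0 1) (s n * √(v₂ n)))) atTop (𝓝 0) := by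
    refine squeeze_zero_norm (fun n => ?_) (tendsto_zero_iff_norm_tendsto_zero.1 hchar)
    rw [norm_mul]
    exact mul_le_of_le_one_left (norm_nonneg _) (hEb n)
  simpa using hl1.add hl2

end ConditionalCentralLimitTheorem

/-! ### Deterministic algebra of the normal equations, and measurability of OLS. -/

section LeastSquares

/-- Subtracting a·1 shifts the spectrum by a, so A - a·1 is positive semidefinite. Finiteness of the
spectrum makes the infimum in `lambdaMin` a genuine lower bound. -/
theorem mul_dotProduct_self_le_of_le_lambdaMin {p : ℕ} {A : Matrix (Fin p) (Fin p) ℝ}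
    (hA : A.IsHermitian) {a : ℝ} (h : a ≤ lambdaMin A) (x : Fin p → ℝ) :
    a * (x ⬝ᵥ x) ≤ x ⬝ᵥ A *ᵥ x := by
  have hpos : (A - algebraMap ℝ (Matrix (Fin p) (Fin p) ℝ) a).PosSemidef := by
    rw [Matrix.posSemidef_iff_isHermitian_and_spectrum_nonneg]
    refine ⟨hA.sub (by
      rw [Algebra.algebraMap_eq_smul_one, Matrix.IsHermitian, Matrix.conjTranspose_smul,
        Matrix.conjTranspose_one]; simp), ?_⟩
    intro k hk
    rw [← spectrum.sub_singleton_eq] at hk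
    obtain ⟨l, hl, m, hm, rfl⟩ := hk
    rw [Set.mem_singleton_iff] at hm
    have hfin : (spectrum ℝ A).Finite := by
      rw [hA.spectrum_real_eq_range_eigenvalues]; exact Set.finite_range _
    have : lambdaMin A ≤ l := csInf_le hfin.bddBelow hl
    simp only [Set.mem_ofPred_eq, hm]
    linarith
  have h1 := hpos.dotProduct_mulVec_nonneg x
  rw [Matrix.sub_mulVec, dotProduct_sub, Algebra.algebraMap_eq_smul_one, Matrix.smul_mulVec,
    Matrix.one_mulVec, dotProduct_smul, star_trivial, smul_eq_mul] at h1
  linarith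

theorem mul_norm_sq_le_sum_inner_sq {n p : ℕ} (w : Fin n → EuclideanSpace ℝ (Fin p)) {a : ℝ}
    (h : a ≤ lambdaMin ((n : ℝ)⁻¹ • ∑ i : Fin n, Matrix.vecMulVec (⇑(w i)) (⇑(w i))))
    (x : EuclideanSpace ℝ (Fin p)) : a * ‖x‖ ^ 2 ≤ (n : ℝ)⁻¹ * ∑ i, (inner ℝ (w i) x) ^ 2 := by
  have hA : ((n : ℝ)⁻¹ • ∑ i : Fin n, Matrix.vecMulVec (⇑(w i)) (⇑(w i))).IsHermitian := by
    ext l m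
    simp [Matrix.sum_apply, Matrix.vecMulVec_apply, mul_comm]
  have h1 := mul_dotProduct_self_le_of_le_lambdaMin hA h (⇑x)
  have h2 : (⇑x) ⬝ᵥ (⇑x) = ‖x‖ ^ 2 := by
    rw [EuclideanSpace.norm_sq_eq]
    simp [dotProduct, sq]
  have h3 : (⇑x) ⬝ᵥ ((n : ℝ)⁻¹ • ∑ i : Fin n, Matrix.vecMulVec (⇑(w i)) (⇑(w i))) *ᵥ (⇑x) =
      (n : ℝ)⁻¹ * ∑ i, (inner ℝ (w i) x) ^ 2 := by
    rw [Matrix.smul_mulVec, dotProduct_smul, smul_eq_mul, Matrix.sum_mulVec, dotProduct_sum]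
    congr 1
    refine Finset.sum_congr rfl fun i _ => ?_
    rw [Matrix.vecMulVec_mulVec, EuclideanSpace.inner_eq_sum_mul, dotProduct_smul, sq,
      dotProduct_comm]
    simp [dotProduct, mul_comm]
  rw [h2, h3] at h1
  exact h1

/-- Consequence of the orthogonality conditions `Σ fᵢ dᵢ = 0`, `Σ fᵢ wᵢ = 0` for the residuals
`fᵢ = dᵢ b + wᵢᵀ h - εᵢ`. -/
theorem abs_sub_le_of_orthogonal {n p : ℕ} (hn : 0 < n) {d ε : Fin n → ℝ}
    {w : Fin n → EuclideanSpace ℝ (Fin p)} {a b : ℝ}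
    {h : EuclideanSpace ℝ (Fin p)}
    (hcoer : ∀ x, a * ‖x‖ ^ 2 ≤ (n : ℝ)⁻¹ * ∑ i, (inner ℝ (w i) x) ^ 2)
    (hd : ∑ i, (d i * b + inner ℝ (w i) h - ε i) * d i = 0)
    (hw : ∑ i, (d i * b + inner ℝ (w i) h - ε i) • w i = 0) :
    a * ‖h‖ ≤ ‖(n : ℝ)⁻¹ • ∑ i, ε i • w i‖ +
        ‖(√(n : ℝ))⁻¹ • ∑ i, d i • w i‖ * |√(n : ℝ) * b| * (n : ℝ)⁻¹ ∧
    |((n : ℝ)⁻¹ * ∑ i, d i ^ 2) * (√(n : ℝ) * b) - (√(n : ℝ))⁻¹ * ∑ i, d i * ε i| ≤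
      ‖(√(n : ℝ))⁻¹ • ∑ i, d i • w i‖ * ‖h‖ := by
  have hn' : (0 : ℝ) < n := by exact_mod_cast hn
  have hsq : √(n : ℝ) * √(n : ℝ) = n := Real.mul_self_sqrt hn'.le
  have hs : 0 < √(n : ℝ) := Real.sqrt_pos.2 hn'
  set q := (√(n : ℝ))⁻¹ • ∑ i, d i • w i with hq
  set r := (n : ℝ)⁻¹ • ∑ i, ε i • w i with hr
  constructor
  · have h1 : (∑ i, (d i * b + inner ℝ (w i) h - ε i) * inner ℝ (w i) h) = 0 := by
      have := congrArg (fun x => inner ℝ x h) hw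
      simpa only [sum_inner, real_inner_smul_left, inner_zero_left] using this
    have h2 : (n : ℝ)⁻¹ * ∑ i, (inner ℝ (w i) h) ^ 2 =
        inner ℝ r h - (√(n : ℝ) * b) * (n : ℝ)⁻¹ * inner ℝ q h := by
      have e1 : inner ℝ r h = (n : ℝ)⁻¹ * ∑ i, ε i * inner ℝ (w i) h := by
        rw [hr, real_inner_smul_left, sum_inner]
        simp only [real_inner_smul_left]
      have e2 : inner ℝ q h = (√(n : ℝ))⁻¹ * ∑ i, d i * inner ℝ (w i) h := by
        rw [hq, real_inner_smul_left, sum_inner]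
        simp only [real_inner_smul_left]
      have e3 : ∑ i, (inner ℝ (w i) h) ^ 2 =
          ∑ i, ε i * inner ℝ (w i) h - b * ∑ i, d i * inner ℝ (w i) h := by
        rw [Finset.mul_sum, ← Finset.sum_sub_distrib, ← sub_eq_zero, ← Finset.sum_sub_distrib,
          ← h1]
        exact Finset.sum_congr rfl fun i _ => by ring
      rw [e1, e2, e3]
      field_simp
    have h3 := hcoer h
    rw [h2] at h3
    have h4 : inner ℝ r h ≤ ‖r‖ * ‖h‖ := real_inner_le_norm _ _
    have h5 : -(√(n : ℝ) * b * (n : ℝ)⁻¹ * inner ℝ q h) ≤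
        ‖q‖ * |√(n : ℝ) * b| * (n : ℝ)⁻¹ * ‖h‖ := by
      refine (neg_le_abs _).trans ?_
      rw [abs_mul, abs_mul, abs_of_nonneg (by positivity : 0 ≤ (n : ℝ)⁻¹)]
      calc _ ≤ |√(n : ℝ) * b| * (n : ℝ)⁻¹ * (‖q‖ * ‖h‖) := by
            gcongr; exact abs_real_inner_le_norm _ _
        _ = _ := by ring
    rcases (norm_nonneg h).eq_or_lt with h0 | h0
    · rw [← h0, mul_zero]; positivity
    · refine le_of_mul_le_mul_right ?_ h0
      nlinarith
  -- In the equation for d the only term besides s √n b and the score is the cross term between d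
  -- and wᵀ h, which is the inner product of q with h.
  · have h1 : ((n : ℝ)⁻¹ * ∑ i, d i ^ 2) * (√(n : ℝ) * b) - (√(n : ℝ))⁻¹ * ∑ i, d i * ε i =
        -inner ℝ q h := by
      have e2 : inner ℝ q h = (√(n : ℝ))⁻¹ * ∑ i, d i * inner ℝ (w i) h := by
        rw [hq, real_inner_smul_left, sum_inner]
        simp only [real_inner_smul_left]
      have e3 : ∑ i, d i * ε i = b * ∑ i, d i ^ 2 + ∑ i, d i * inner ℝ (w i) h := by
        rw [Finset.mul_sum, ← Finset.sum_add_distrib, eq_comm, ← sub_eq_zero,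
          ← Finset.sum_sub_distrib, ← hd]
        exact Finset.sum_congr rfl fun i _ => by ring
      have e4 : (n : ℝ)⁻¹ * √(n : ℝ) = (√(n : ℝ))⁻¹ := by
        rw [inv_mul_eq_div, inv_eq_one_div, div_eq_div_iff hn'.ne' hs.ne', hsq, one_mul]
      rw [e2, e3]
      linear_combination (b * ∑ i, d i ^ 2) * e4
    rw [h1, abs_neg]
    exact abs_real_inner_le_norm _ _

variable {n p : ℕ}

theorem regressorMatrix_mulVec (d : Fin n → ℝ) (w : Fin n → EuclideanSpace ℝ (Fin p))
    (θ : Fin (p + 1) → ℝ) (i : Fin n) :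
    (regressorMatrix d w *ᵥ θ) i = d i * θ 0 + ∑ j, w i j * θ j.succ := by
  simp [regressorMatrix, Matrix.mulVec, dotProduct, Fin.sum_univ_succ]

/-- The normal equations, after centring the regressor of interest at an arbitrary point. -/
theorem orthogonal_of_gram_mulVec_eq [NeZero p] {d ε : Fin n → ℝ}
    {w : Fin n → EuclideanSpace ℝ (Fin p)} {c : ℝ} (hc : c ≠ 0) (hw : ∀ i, w i 0 = c) (μ : ℝ)
    {θ : Fin (p + 1) → ℝ}
    (hθ : ((regressorMatrix d w)ᵀ * regressorMatrix d w) *ᵥ θ = (regressorMatrix d w)ᵀ *ᵥ ε) :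
    ∃ h : EuclideanSpace ℝ (Fin p),
      (∀ j, h j = θ j.succ + if j = 0 then θ 0 * μ / c else 0) ∧
      ∑ i, ((d i - μ) * θ 0 + inner ℝ (w i) h - ε i) * (d i - μ) = 0 ∧
      ∑ i, ((d i - μ) * θ 0 + inner ℝ (w i) h - ε i) • w i = 0 := by
  -- Subtracting μ from d lowers the fit by θ₀ μ; as w_i0 = c, raising the intercept coefficient by
  -- θ₀ μ / c restores it.
  refine ⟨WithLp.toLp 2 fun j => θ j.succ + if j = 0 then θ 0 * μ / c else 0, fun j => rfl, ?_⟩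
  set h : EuclideanSpace ℝ (Fin p) :=
    WithLp.toLp 2 fun j => θ j.succ + if j = 0 then θ 0 * μ / c else 0 with hh
  have hfit : ∀ i, (d i - μ) * θ 0 + inner ℝ (w i) h - ε i =
      (regressorMatrix d w *ᵥ θ) i - ε i := by
    intro i
    rw [regressorMatrix_mulVec, EuclideanSpace.inner_eq_sum_mul]
    have : ∀ j, h j = θ j.succ + if j = 0 then θ 0 * μ / c else 0 := fun j => rfl
    simp only [this, mul_add, Finset.sum_add_distrib, mul_ite, mul_zero, Finset.sum_ite_eq',
      Finset.mem_univ, if_true, hw]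
    field_simp
    ring
  have hcol : ∀ k, ∑ i, ((d i - μ) * θ 0 + inner ℝ (w i) h - ε i) * regressorMatrix d w i k = 0 := by
    intro k
    have h1 := congrFun hθ k
    rw [← Matrix.mulVec_mulVec] at h1
    simp only [Matrix.mulVec, dotProduct, Matrix.transpose_apply] at h1
    rw [← sub_eq_zero, ← Finset.sum_sub_distrib] at h1
    rw [← h1]
    refine Finset.sum_congr rfl fun i _ => ?_
    rw [hfit i]
    simp only [Matrix.mulVec, dotProduct]
    ring
  have hwcol : ∀ j, ∑ i, ((d i - μ) * θ 0 + inner ℝ (w i) h - ε i) * w i j = 0 := fun j => by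
    simpa [regressorMatrix] using hcol j.succ
  have hdcol : ∑ i, ((d i - μ) * θ 0 + inner ℝ (w i) h - ε i) * d i = 0 := by
    simpa [regressorMatrix] using hcol 0
  -- The intercept column makes the residuals sum to zero, so d may be centred in its own normal
  -- equation as well.
  have hone : ∑ i, ((d i - μ) * θ 0 + inner ℝ (w i) h - ε i) = 0 := by
    have := hwcol 0
    simp only [hw, ← Finset.sum_mul] at this
    exact (mul_eq_zero.1 this).resolve_right hc
  constructor
  · simp only [mul_sub _ (d _) μ, Finset.sum_sub_distrib, ← Finset.sum_mul, hone, hdcol]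
    simp
  · ext j
    simpa using hwcol j

/-- Finite-sample error of the linear expansion of the least squares coefficient. -/
theorem abs_ols_sub_le [NeZero p] (hn : 0 < n) {d ε : Fin n → ℝ}
    {w : Fin n → EuclideanSpace ℝ (Fin p)} {c : ℝ} (hc : c ≠ 0) (hw : ∀ i, w i 0 = c) (μ β : ℝ)
    (γ : EuclideanSpace ℝ (Fin p)) {a : ℝ} (ha : 0 < a)
    (hcoer : ∀ x, a * ‖x‖ ^ 2 ≤ (n : ℝ)⁻¹ * ∑ i, (inner ℝ (w i) x) ^ 2)
    (hs : a⁻¹ * ‖(√(n : ℝ))⁻¹ • ∑ i, (d i - μ) • w i‖ ^ 2 * (n : ℝ)⁻¹ <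
      (n : ℝ)⁻¹ * ∑ i, (d i - μ) ^ 2) :
    |((n : ℝ)⁻¹ * ∑ i, (d i - μ) ^ 2) * (√(n : ℝ) *
        (ols (regressorMatrix d w) (fun i => d i * β + (∑ j, w i j * γ j) + ε i) 0 - β)) -
          (√(n : ℝ))⁻¹ * ∑ i, (d i - μ) * ε i| ≤
      a⁻¹ * ‖(√(n : ℝ))⁻¹ • ∑ i, (d i - μ) • w i‖ * (‖(n : ℝ)⁻¹ • ∑ i, ε i • w i‖ +
        ‖(√(n : ℝ))⁻¹ • ∑ i, (d i - μ) • w i‖ * |√(n : ℝ) *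
          (ols (regressorMatrix d w) (fun i => d i * β + (∑ j, w i j * γ j) + ε i) 0 - β)| *
            (n : ℝ)⁻¹) := by
  have hn' : (0 : ℝ) < n := by exact_mod_cast hn
  have hsn : 0 < √(n : ℝ) := Real.sqrt_pos.2 hn'
  -- Stated for every solution θ of the normal equations because it is used twice: with zero errors
  -- to show that the Gram matrix is invertible, and then with the true errors.
  have hest : ∀ (η : Fin n → ℝ) (θ : Fin (p + 1) → ℝ),
      ((regressorMatrix d w)ᵀ * regressorMatrix d w) *ᵥ θ = (regressorMatrix d w)ᵀ *ᵥ η →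
      |((n : ℝ)⁻¹ * ∑ i, (d i - μ) ^ 2) * (√(n : ℝ) * θ 0) -
          (√(n : ℝ))⁻¹ * ∑ i, (d i - μ) * η i| ≤
        a⁻¹ * ‖(√(n : ℝ))⁻¹ • ∑ i, (d i - μ) • w i‖ * (‖(n : ℝ)⁻¹ • ∑ i, η i • w i‖ +
          ‖(√(n : ℝ))⁻¹ • ∑ i, (d i - μ) • w i‖ * |√(n : ℝ) * θ 0| * (n : ℝ)⁻¹) := by
    intro η θ hθ
    obtain ⟨h, -, h1, h2⟩ := orthogonal_of_gram_mulVec_eq hc hw μ hθ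
    obtain ⟨h3, h4⟩ := abs_sub_le_of_orthogonal hn hcoer h1 h2
    refine h4.trans ?_
    rw [mul_comm a⁻¹, mul_assoc]
    gcongr
    rw [le_inv_mul_iff₀ ha]
    exact h3
  -- A kernel vector solves the normal equations with zero errors. The strict inequality `hs` forces
  -- its first entry to vanish, and coercivity then kills the control part.
  have hdet : ((regressorMatrix d w)ᵀ * regressorMatrix d w).det ≠ 0 := by
    intro h0
    obtain ⟨θ, hθ0, hθ⟩ := Matrix.exists_mulVec_eq_zero_iff.2 h0
    have hθ' : ((regressorMatrix d w)ᵀ * regressorMatrix d w) *ᵥ θ =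
        (regressorMatrix d w)ᵀ *ᵥ (0 : Fin n → ℝ) := by rw [hθ, Matrix.mulVec_zero]
    have h1 := hest 0 θ hθ'
    simp only [Pi.zero_apply, mul_zero, zero_smul, Finset.sum_const_zero, sub_zero, smul_zero,
      norm_zero, zero_add] at h1
    rw [abs_mul, abs_of_nonneg (mul_nonneg (by positivity)
      (Finset.sum_nonneg fun i _ => sq_nonneg _))] at h1
    have hB : |√(n : ℝ) * θ 0| = 0 := by
      by_contra hne
      have hpos : 0 < |√(n : ℝ) * θ 0| := lt_of_le_of_ne (abs_nonneg _) (Ne.symm hne)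
      have := mul_lt_mul_of_pos_right hs hpos
      nlinarith
    have hθ00 : θ 0 = 0 := by
      rw [abs_eq_zero] at hB
      exact (mul_eq_zero.1 hB).resolve_left hsn.ne'
    obtain ⟨h, hh, h2, h3⟩ := orthogonal_of_gram_mulVec_eq hc hw μ hθ'
    have h4 := (abs_sub_le_of_orthogonal hn hcoer h2 h3).1
    simp only [Pi.zero_apply, zero_smul, Finset.sum_const_zero, smul_zero, norm_zero, hB, mul_zero,
      zero_mul, add_zero] at h4
    have h5 : h = 0 := by
      rw [← norm_le_zero_iff]
      exact le_of_mul_le_mul_left (by rwa [mul_zero]) ha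
    apply hθ0
    ext k
    refine Fin.cases hθ00 (fun j => ?_) k
    have := hh j
    simpa [h5, hθ00] using this.symm
  set X := regressorMatrix d w with hX
  set θ₀ : Fin (p + 1) → ℝ := Matrix.vecCons β γ with hθ₀
  have hY : (fun i => d i * β + (∑ j, w i j * γ j) + ε i) = X *ᵥ θ₀ + ε := by
    ext i
    rw [Pi.add_apply, hX, regressorMatrix_mulVec]
    simp [hθ₀]
  have hnormal : (Xᵀ * X) *ᵥ (ols X (X *ᵥ θ₀ + ε) - θ₀) = Xᵀ *ᵥ ε := by
    rw [Matrix.mulVec_sub, ols, Matrix.mulVec_mulVec,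
      Matrix.mul_nonsing_inv _ (isUnit_iff_ne_zero.2 hdet), Matrix.one_mulVec, Matrix.mulVec_add,
      Matrix.mulVec_mulVec, add_sub_cancel_left]
  have hfin := hest ε _ hnormal
  have h0 : (ols X (X *ᵥ θ₀ + ε) - θ₀) 0 = ols X (X *ᵥ θ₀ + ε) 0 - β := by
    simp [hθ₀]
  rw [h0] at hfin
  rw [hY]
  exact hfin

/-- Cramer's rule. The matrix inverse and the real inverse are both zero at a singular Gram matrix,
so no case distinction is needed and OLS is visibly measurable in the data. -/
theorem ols_apply_eq {k : ℕ} (X : Matrix (Fin n) (Fin k) ℝ) (Y : Fin n → ℝ) (j : Fin k) :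
    ols X Y j = ((Xᵀ * X).det)⁻¹ * ((Xᵀ * X).adjugate *ᵥ (Xᵀ *ᵥ Y)) j := by
  rw [ols, Matrix.inv_def, Matrix.smul_mulVec, Pi.smul_apply, smul_eq_mul, Ring.inverse_eq_inv']

variable {Ω : Type*} [MeasurableSpace Ω]

theorem Matrix.measurable_det {k : ℕ} {A : Ω → Matrix (Fin k) (Fin k) ℝ}
    (hA : ∀ i j, Measurable fun ω => A ω i j) : Measurable fun ω => (A ω).det := by
  simp only [Matrix.det_apply']
  exact Finset.measurable_fun_sum _ fun σ _ =>
    (Finset.measurable_fun_prod _ fun i _ => hA (σ i) i).const_mul _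

theorem Matrix.measurable_adjugate_apply {k : ℕ} {A : Ω → Matrix (Fin k) (Fin k) ℝ}
    (hA : ∀ i j, Measurable fun ω => A ω i j) (i j : Fin k) :
    Measurable fun ω => (A ω).adjugate i j := by
  simp only [Matrix.adjugate_apply]
  refine Matrix.measurable_det fun l m => ?_
  by_cases h : l = j
  · subst h
    simp only [Matrix.updateRow_self]
    exact measurable_const
  · simp only [Matrix.updateRow_ne h]
    exact hA l m

theorem measurable_ols {k : ℕ} {X : Ω → Matrix (Fin n) (Fin k) ℝ} {Y : Ω → Fin n → ℝ}
    (hX : ∀ i j, Measurable fun ω => X ω i j) (hY : ∀ i, Measurable fun ω => Y ω i) (j : Fin k) :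
    Measurable fun ω => ols (X ω) (Y ω) j := by
  have hG : ∀ l m, Measurable fun ω => ((X ω)ᵀ * X ω) l m := fun l m => by
    simp only [Matrix.mul_apply, Matrix.transpose_apply]
    exact Finset.measurable_fun_sum _ fun i _ => (hX i l).mul (hX i m)
  simp only [ols_apply_eq, Matrix.mulVec, dotProduct, Matrix.transpose_apply]
  exact (Matrix.measurable_det hG).inv.mul (Finset.measurable_fun_sum _ fun l _ =>
    (Matrix.measurable_adjugate_apply hG j l).mul
      (Finset.measurable_fun_sum _ fun i _ => (hX i l).mul (hY i)))

theorem measurable_regressorMatrix_apply {d : Fin n → Ω → ℝ}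
    {w : Fin n → Ω → EuclideanSpace ℝ (Fin p)} (hd : ∀ i, Measurable (d i))
    (hw : ∀ i, Measurable (w i)) (i : Fin n) (k : Fin (p + 1)) :
    Measurable fun ω => regressorMatrix (fun i => d i ω) (fun i => w i ω) i k := by
  refine Fin.cases ?_ (fun j => ?_) k
  · simp only [regressorMatrix, Matrix.of_apply, Matrix.cons_val_zero]
    exact hd i
  · simp only [regressorMatrix, Matrix.of_apply, Matrix.cons_val_succ]
    have := hw i
    fun_prop

end LeastSquares

/-! ### Transfer of moment bounds. -/

theorem MomentLE.memLp_two {Ω : Type*} [MeasurableSpace Ω] {P : Measure Ω}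
    [IsProbabilityMeasure P] {E : Type*} [NormedAddCommGroup E] {X : Ω → E} {δ K : ℝ}
    (h : MomentLE P X (2 + δ) K) (hX : AEStronglyMeasurable X P) (hδ : 0 ≤ δ) : MemLp X 2 P :=
  memLp_two_of_integrable_norm_rpow hX hδ h.1

theorem rpow_le_one_add_rpow {x q r : ℝ} (hx : 0 ≤ x) (hq : 0 ≤ q) (hqr : q ≤ r) :
    x ^ q ≤ 1 + x ^ r := by
  have h0 : 0 ≤ x ^ r := by positivity
  rcases le_total x 1 with h | h
  · linarith [Real.rpow_le_one hx h hq]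
  · linarith [Real.rpow_le_rpow_of_exponent_le h hqr]

theorem add_rpow_le_two_rpow_mul {x y q : ℝ} (hx : 0 ≤ x) (hy : 0 ≤ y) (hq : 0 ≤ q) :
    (x + y) ^ q ≤ 2 ^ q * (x ^ q + y ^ q) := by
  have h1 : x + y ≤ 2 * max x y := by linarith [le_max_left x y, le_max_right x y]
  have h2 : max x y ^ q ≤ x ^ q + y ^ q := by
    have := Real.rpow_nonneg hx q
    have := Real.rpow_nonneg hy q
    rcases max_choice x y with h | h <;> rw [h] <;> linarith
  calc (x + y) ^ q ≤ (2 * max x y) ^ q := Real.rpow_le_rpow (by positivity) h1 hq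
    _ = 2 ^ q * max x y ^ q := Real.mul_rpow (by norm_num) (le_max_of_le_left hx)
    _ ≤ _ := by gcongr

theorem MomentLE.of_le {Ω : Type*} [MeasurableSpace Ω] {P : Measure Ω} [IsProbabilityMeasure P]
    {E : Type*} [NormedAddCommGroup E] {X : Ω → E} {q r K : ℝ} (h : MomentLE P X r K)
    (hX : AEStronglyMeasurable X P) (hq : 0 ≤ q) (hqr : q ≤ r) : MomentLE P X q (1 + K) := by
  have hi : Integrable (fun ω => ‖X ω‖ ^ q) P :=
    Integrable.mono' ((integrable_const (1 : ℝ)).add h.1)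
      (hX.norm.aemeasurable.pow_const q).aestronglyMeasurable (ae_of_all _ fun ω => by
        rw [Real.norm_of_nonneg (by positivity)]
        exact rpow_le_one_add_rpow (norm_nonneg _) hq hqr)
  refine ⟨hi, (integral_mono hi ((integrable_const (1 : ℝ)).add h.1) fun ω =>
    rpow_le_one_add_rpow (norm_nonneg _) hq hqr).trans ?_⟩
  simp only [Pi.add_apply]
  rw [integral_add (integrable_const _) h.1]
  simpa using h.2

/-- Moment bound for a variable dominated by an affine function of another one. -/
theorem MomentLE.of_norm_le_add {Ω : Type*} [MeasurableSpace Ω] {P : Measure Ω}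
    [IsProbabilityMeasure P] {E F : Type*} [NormedAddCommGroup E] [NormedAddCommGroup F]
    {X : Ω → E} {Y : Ω → F} {q K a b : ℝ} (h : MomentLE P X q K) (hY : AEStronglyMeasurable Y P)
    (hq : 0 ≤ q) (ha : 0 ≤ a) (hb : 0 ≤ b) (hYX : ∀ᵐ ω ∂P, ‖Y ω‖ ≤ a * ‖X ω‖ + b) :
    MomentLE P Y q (2 ^ q * (a ^ q * K + b ^ q)) := by
  have hpt : ∀ᵐ ω ∂P, ‖Y ω‖ ^ q ≤ 2 ^ q * (a ^ q * ‖X ω‖ ^ q + b ^ q) := by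
    filter_upwards [hYX] with ω hω
    rw [← Real.mul_rpow ha (norm_nonneg _)]
    exact (Real.rpow_le_rpow (norm_nonneg _) hω hq).trans
      (add_rpow_le_two_rpow_mul (by positivity) hb hq)
  have hi2 : Integrable (fun ω => 2 ^ q * (a ^ q * ‖X ω‖ ^ q + b ^ q)) P :=
    ((h.1.const_mul _).add (integrable_const _)).const_mul _
  have hi : Integrable (fun ω => ‖Y ω‖ ^ q) P :=
    Integrable.mono' hi2 (hY.norm.aemeasurable.pow_const q).aestronglyMeasurable (by
      filter_upwards [hpt] with ω hω
      rwa [Real.norm_of_nonneg (by positivity)])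
  refine ⟨hi, (integral_mono_ae hi hi2 hpt).trans ?_⟩
  rw [integral_const_mul, integral_add (h.1.const_mul _) (integrable_const _), integral_const_mul]
  simp only [integral_const, probReal_univ, one_smul]
  have := h.2
  gcongr

/-! ### Moments and independence in the model, and the variance identities. -/

namespace RegressionArray

variable {p L : ℕ} {Ω : ℕ → Type*} {M : RegressionArray p L Ω}

theorem inner_A_eq (n : ℕ) (i : Fin n) (ω : Ω n) :
    inner ℝ (M.A n i ω) (M.e n i ω) = (M.d n i ω - M.muD n) * M.err n i ω := by
  rw [EuclideanSpace.inner_eq_sum_mul, err, Finset.mul_sum]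
  exact Finset.sum_congr rfl fun l _ => by simp [A, mul_assoc]

/-- The splitting behind both the limit theorem and the variance formula: a part that is centred
given e_i, and a part that sees e_i only through μ_Aᵀ e_i. -/
theorem inner_A_sub_add (n : ℕ) (i : Fin n) (ω : Ω n) :
    inner ℝ (M.A n i ω - M.muA n) (M.e n i ω) + inner ℝ (M.muA n) (M.e n i ω) =
      (M.d n i ω - M.muD n) * M.err n i ω := by
  rw [← inner_add_left, sub_add_cancel, inner_A_eq]

theorem score_eq (n : ℕ) (ω : Ω n) :
    M.score n ω = (√(n : ℝ))⁻¹ * ∑ i, inner ℝ (M.A n i ω - M.muA n) (M.e n i ω) +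
      (√(n : ℝ))⁻¹ * ∑ i, inner ℝ (M.muA n) (M.e n i ω) := by
  rw [← mul_add, ← Finset.sum_add_distrib, score]
  simp only [inner_A_sub_add]

/-- The vector `A_i` as a function of `d_i`. -/
def scaledDeviation (M : RegressionArray p L Ω) (n : ℕ) (x : ℝ) : EuclideanSpace ℝ (Fin L) :=
  WithLp.toLp 2 fun l => (x - M.muD n) * M.sigma n l x

variable [∀ n, MeasurableSpace (Ω n)] {P : ∀ n, Measure (Ω n)} {K : ℝ}

theorem sigmaE1Sq_nonneg (n : ℕ) : 0 ≤ M.sigmaE1Sq P n :=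
  mul_nonneg (by positivity) (Finset.sum_nonneg fun _ _ => integral_nonneg fun _ => sq_nonneg _)

theorem sigmaE2Sq_nonneg (n : ℕ) : 0 ≤ M.sigmaE2Sq P n := integral_nonneg fun _ => sq_nonneg _

theorem sigmaDE_sq (n : ℕ) : M.sigmaDE P n ^ 2 = M.sigmaE1Sq P n + M.sigmaE2Sq P n :=
  Real.sq_sqrt (add_nonneg (sigmaE1Sq_nonneg n) (sigmaE2Sq_nonneg n))

theorem ScaledErrorAssumption.measurable_scaledDeviation (he : M.ScaledErrorAssumption P K)
    (n : ℕ) : Measurable (M.scaledDeviation n) := by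
  have := he.measurable_sigma n
  unfold scaledDeviation
  fun_prop

theorem measurable_A (hd : M.RegressorAssumption P K) (he : M.ScaledErrorAssumption P K) (n : ℕ)
    (i : Fin n) : Measurable (M.A n i) :=
  (he.measurable_scaledDeviation n).comp (hd.measurable n i)

theorem measurable_err (hd : M.RegressorAssumption P K) (he : M.ScaledErrorAssumption P K) (n : ℕ)
    (i : Fin n) : Measurable (M.err n i) := by
  have h1 : ∀ l, Measurable fun ω => M.sigma n l (M.d n i ω) := fun l =>
    (he.measurable_sigma n l).comp (hd.measurable n i)
  have h2 := he.measurable n i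
  unfold err
  fun_prop

/-- The Euclidean norm is at most the sum of the L absolute entries. The crude factor L K is
harmless because L is fixed. -/
theorem ScaledErrorAssumption.norm_A_le (he : M.ScaledErrorAssumption P K) (n : ℕ) (i : Fin n) :
    ∀ᵐ ω ∂(P n), ‖M.A n i ω‖ ≤ L * K * |M.d n i ω - M.muD n| := by
  have h := ae_all_iff.2 (he.sigma_bounded n i)
  filter_upwards [h] with ω hω
  have h1 : ‖M.A n i ω‖ ≤ ∑ l, |M.A n i ω l| := by
    rw [EuclideanSpace.norm_eq]
    simp only [Real.norm_eq_abs]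
    rw [Real.sqrt_le_left (Finset.sum_nonneg fun _ _ => abs_nonneg _)]
    exact Finset.sum_sq_le_sq_sum_of_nonneg fun _ _ => abs_nonneg _
  refine h1.trans ?_
  have h2 := Finset.sum_le_card_nsmul Finset.univ (fun l => |M.A n i ω l|)
    (K * |M.d n i ω - M.muD n|) fun l _ => by
      simp only [A, abs_mul]
      rw [mul_comm]
      exact mul_le_mul_of_nonneg_right (hω l) (abs_nonneg _)
  rw [Finset.card_univ, Fintype.card_fin, nsmul_eq_mul] at h2
  linarith

theorem RegressorAssumption.integral_d_sub_sq (hd : M.RegressorAssumption P K) (n : ℕ)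
    (i : Fin n) : ∫ ω, (M.d n i ω - M.muD n) ^ 2 ∂(P n) = M.sigmaD n ^ 2 := by
  rw [← hd.variance n i, variance_eq_integral (hd.measurable n i).aemeasurable, hd.mean n i]

theorem iIndepFun_A_sub (hd : M.RegressorAssumption P K) (he : M.ScaledErrorAssumption P K)
    (n : ℕ) : iIndepFun (fun i ω => M.A n i ω - M.muA n) (P n) :=
  (hd.indep n).comp (g := fun _ x => M.scaledDeviation n x - M.muA n)
    fun _ => (he.measurable_scaledDeviation n).sub_const _

theorem indepFun_A_sub_e (he : M.ScaledErrorAssumption P K) (n : ℕ) :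
    IndepFun (fun ω i => M.A n i ω - M.muA n) (fun ω i => M.e n i ω) (P n) := by
  have h := he.measurable_scaledDeviation n
  have h1 : Measurable fun (x : Fin n → ℝ) i => M.scaledDeviation n (x i) - M.muA n :=
    measurable_pi_lambda _ fun i => (h.comp (measurable_pi_apply i)).sub_const _
  exact (he.indep n).comp h1 measurable_id

theorem indepFun_A_sub_e_apply (he : M.ScaledErrorAssumption P K) (n : ℕ) (i : Fin n) :
    IndepFun (fun ω => M.A n i ω - M.muA n) (M.e n i) (P n) :=
  (indepFun_A_sub_e he n).comp (measurable_pi_apply i) (measurable_pi_apply i)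

theorem integral_A_sub_entry_mul_eq (hd : M.RegressorAssumption P K)
    (he : M.ScaledErrorAssumption P K) (n : ℕ) (i j : Fin n) (l m : Fin L) :
    ∫ ω, (M.A n i ω - M.muA n) l * (M.A n i ω - M.muA n) m ∂(P n) =
      ∫ ω, (M.A n j ω - M.muA n) l * (M.A n j ω - M.muA n) m ∂(P n) := by
  have h := he.measurable_scaledDeviation n
  exact ((hd.identDistrib n i j).comp (u := fun x => (M.scaledDeviation n x - M.muA n) l *
    (M.scaledDeviation n x - M.muA n) m) (by fun_prop)).integral_eq

theorem memLp_muAe (he : M.ScaledErrorAssumption P K) (n : ℕ) (i : Fin n) :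
    MemLp (M.muAe n i) 2 (P n) := (he.sq_integrable n i).const_inner (M.muA n)

theorem memLp_sum_muAe (he : M.ScaledErrorAssumption P K) (n : ℕ) :
    MemLp (fun ω => (√(n : ℝ))⁻¹ * ∑ i, M.muAe n i ω) 2 (P n) := by
  have h1 : MemLp (fun ω => ∑ i, M.muAe n i ω) 2 (P n) :=
    memLp_finsetSum _ fun i _ => memLp_muAe he n i
  exact h1.const_mul _

variable [∀ n, IsProbabilityMeasure (P n)]

theorem RegressorAssumption.memLp_d (hd : M.RegressorAssumption P K) (n : ℕ) (i : Fin n) :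
    MemLp (M.d n i) 2 (P n) := by
  obtain ⟨δ, hδ, hm⟩ := hd.moment
  exact (hm n i).memLp_two (hd.measurable n i).aestronglyMeasurable hδ.le

theorem RegressorAssumption.memLp_d_sub (hd : M.RegressorAssumption P K) (n : ℕ) (i : Fin n) :
    MemLp (fun ω => M.d n i ω - M.muD n) 2 (P n) :=
  (hd.memLp_d n i).sub (memLp_const _)

theorem RegressorAssumption.integral_d_sub (hd : M.RegressorAssumption P K) (n : ℕ) (i : Fin n) :
    ∫ ω, (M.d n i ω - M.muD n) ∂(P n) = 0 := by
  rw [integral_sub ((hd.memLp_d n i).integrable one_le_two) (integrable_const _), hd.mean n i]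
  simp

/-- The index i certifies that the sample is nonempty; for n = 0 nothing ties `muD` to a
distribution. -/
theorem RegressorAssumption.abs_muD_le (hd : M.RegressorAssumption P K) (n : ℕ) (i : Fin n) :
    |M.muD n| ≤ 1 + K := by
  obtain ⟨δ, hδ, hm⟩ := hd.moment
  have h1 := (hm n i).of_le (q := 1) (hd.measurable n i).aestronglyMeasurable (by norm_num)
    (by linarith)
  rw [← hd.mean n i, ← Real.norm_eq_abs]
  refine (norm_integral_le_integral_norm _).trans ?_
  simpa using h1.2

theorem RegressorAssumption.sigmaD_sq_le (hd : M.RegressorAssumption P K) (n : ℕ) (i : Fin n) :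
    M.sigmaD n ^ 2 ≤ 1 + K := by
  obtain ⟨δ, hδ, hm⟩ := hd.moment
  have h1 := (hm n i).of_le (q := 2) (hd.measurable n i).aestronglyMeasurable (by norm_num)
    (by linarith)
  rw [← hd.variance n i]
  refine (variance_le_expectation_sq (hd.measurable n i).aestronglyMeasurable).trans ?_
  simpa using h1.2

theorem RegressorAssumption.momentLE_d_sub (hd : M.RegressorAssumption P K) (hK : 0 ≤ K) {q δ : ℝ}
    (hm : ∀ n i, MomentLE (P n) (M.d n i) (2 + δ) K) (hq : 0 ≤ q) (hqδ : q ≤ 2 + δ) (n : ℕ)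
    (i : Fin n) : MomentLE (P n) (fun ω => M.d n i ω - M.muD n) q
      (2 ^ q * (1 ^ q * (1 + K) + (1 + K) ^ q)) := by
  refine ((hm n i).of_le (hd.measurable n i).aestronglyMeasurable hq hqδ).of_norm_le_add
    ((hd.measurable n i).sub_const _).aestronglyMeasurable hq zero_le_one (by positivity)
    (ae_of_all _ fun ω => ?_)
  rw [one_mul]
  refine (norm_sub_le _ _).trans ?_
  gcongr
  exact hd.abs_muD_le n i

theorem memLp_A (hd : M.RegressorAssumption P K) (he : M.ScaledErrorAssumption P K)
    (n : ℕ) (i : Fin n) : MemLp (M.A n i) 2 (P n) :=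
  (hd.memLp_d_sub n i).of_le_mul (measurable_A hd he n i).aestronglyMeasurable (by
    simpa only [Real.norm_eq_abs] using he.norm_A_le n i)

theorem memLp_A_sub (hd : M.RegressorAssumption P K) (he : M.ScaledErrorAssumption P K)
    (n : ℕ) (i : Fin n) : MemLp (fun ω => M.A n i ω - M.muA n) 2 (P n) :=
  (memLp_A hd he n i).sub (memLp_const _)

theorem integral_A_apply (hd : M.RegressorAssumption P K) (he : M.ScaledErrorAssumption P K)
    (n : ℕ) (i : Fin n) (l : Fin L) :
    ∫ ω, (M.d n i ω - M.muD n) * M.sigma n l (M.d n i ω) ∂(P n) = M.muA n l := by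
  rw [← he.mean_A n i, eval_integral_piLp fun l =>
    ((memLp_A hd he n i).eval_piLp l).integrable one_le_two]
  rfl

theorem integral_A_sub_apply (hd : M.RegressorAssumption P K) (he : M.ScaledErrorAssumption P K)
    (n : ℕ) (i : Fin n) (l : Fin L) : ∫ ω, (M.A n i ω - M.muA n) l ∂(P n) = 0 := by
  have h1 : ∫ ω, M.A n i ω l ∂(P n) = M.muA n l := integral_A_apply hd he n i l
  simp only [PiLp.sub_apply]
  rw [integral_sub (((memLp_A hd he n i).eval_piLp l).integrable one_le_two) (integrable_const _),
    h1]
  simp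

theorem norm_muA_le (hK : 0 ≤ K) (hd : M.RegressorAssumption P K)
    (he : M.ScaledErrorAssumption P K) (n : ℕ) (i : Fin n) :
    ‖M.muA n‖ ≤ L * K * (2 * (1 + K)) := by
  obtain ⟨δ, hδ, hm⟩ := hd.moment
  have h1 := (hm n i).of_le (q := 1) (hd.measurable n i).aestronglyMeasurable (by norm_num)
    (by linarith)
  have hi : Integrable (fun ω => |M.d n i ω - M.muD n|) (P n) :=
    ((hd.memLp_d_sub n i).integrable one_le_two).abs
  have hi' : Integrable (fun ω => |M.d n i ω|) (P n) :=
    ((hd.memLp_d n i).integrable one_le_two).abs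
  rw [← he.mean_A n i]
  refine (norm_integral_le_integral_norm _).trans ?_
  refine (integral_mono_ae ((memLp_A hd he n i).integrable one_le_two).norm (hi.const_mul _)
    (he.norm_A_le n i)).trans ?_
  rw [integral_const_mul]
  gcongr
  have h2 : ∫ ω, |M.d n i ω - M.muD n| ∂(P n) ≤ ∫ ω, (|M.d n i ω| + |M.muD n|) ∂(P n) :=
    integral_mono hi (hi'.add (integrable_const _)) fun ω => abs_sub _ _
  rw [integral_add hi' (integrable_const _)] at h2
  have h3 : ∫ ω, |M.d n i ω| ∂(P n) ≤ 1 + K := by simpa using h1.2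
  have h4 := hd.abs_muD_le n i
  simp only [integral_const, probReal_univ, one_smul] at h2
  linarith

theorem exists_momentLE_A_sub (hK : 0 ≤ K) (hd : M.RegressorAssumption P K)
    (he : M.ScaledErrorAssumption P K) {q δ : ℝ} (hq : 0 ≤ q) (hqδ : q ≤ 2 + δ)
    (hm : ∀ n i, MomentLE (P n) (M.d n i) (2 + δ) K) :
    ∃ C, ∀ n i, MomentLE (P n) (fun ω => M.A n i ω - M.muA n) q C := by
  refine ⟨_, fun n i => (hd.momentLE_d_sub hK hm hq hqδ n i).of_norm_le_add (a := L * K)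
    (b := L * K * (2 * (1 + K))) ((measurable_A hd he n i).sub_const _).aestronglyMeasurable hq
    (by positivity) (by positivity) ?_⟩
  filter_upwards [he.norm_A_le n i] with ω hω
  exact (norm_sub_le _ _).trans (add_le_add hω (norm_muA_le hK hd he n i))

theorem integral_muAe (he : M.ScaledErrorAssumption P K) (n : ℕ) (i : Fin n) :
    ∫ ω, M.muAe n i ω ∂(P n) = 0 := by
  unfold muAe
  rw [integral_inner ((he.sq_integrable n i).integrable one_le_two), he.mean_zero n i,
    inner_zero_right]

/-- A_i - μ_A is centred and independent of e_i, hence orthogonal to any integrable function of e_i;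
apply this to each coordinate of the inner product. -/
theorem integral_inner_A_sub_mul_muAe (hd : M.RegressorAssumption P K)
    (he : M.ScaledErrorAssumption P K) (n : ℕ) (i : Fin n) :
    ∫ ω, inner ℝ (M.A n i ω - M.muA n) (M.e n i ω) * M.muAe n i ω ∂(P n) = 0 := by
  have hind : ∀ l, IndepFun (fun ω => (M.A n i ω - M.muA n) l)
      (fun ω => M.e n i ω l * M.muAe n i ω) (P n) := fun l =>
    (indepFun_A_sub_e_apply he n i).comp (φ := fun x : EuclideanSpace ℝ (Fin L) => x l)
      (ψ := fun x : EuclideanSpace ℝ (Fin L) => x l * inner ℝ (M.muA n) x)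
      (by fun_prop) (by fun_prop)
  have hi1 : ∀ l, Integrable (fun ω => (M.A n i ω - M.muA n) l) (P n) := fun l =>
    ((memLp_A_sub hd he n i).eval_piLp l).integrable one_le_two
  have hi2 : ∀ l, Integrable (fun ω => M.e n i ω l * M.muAe n i ω) (P n) := fun l =>
    ((he.sq_integrable n i).eval_piLp l).integrable_mul (memLp_muAe he n i)
  have hi : ∀ l, Integrable (fun ω => (M.A n i ω - M.muA n) l *
      (M.e n i ω l * M.muAe n i ω)) (P n) := fun l => (hind l).integrable_mul (hi1 l) (hi2 l)
  simp only [EuclideanSpace.inner_eq_sum_mul, Finset.sum_mul, mul_assoc]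
  rw [integral_finsetSum _ fun l _ => hi l]
  refine Finset.sum_eq_zero fun l _ => ?_
  rw [(hind l).integral_fun_mul_eq_mul_integral (hi1 l).aestronglyMeasurable
    (hi2 l).aestronglyMeasurable, integral_A_sub_apply hd he n i l, zero_mul]

theorem integral_sq_d_sub_mul_err (hd : M.RegressorAssumption P K)
    (he : M.ScaledErrorAssumption P K) (n : ℕ) (i : Fin n) :
    ∫ ω, (M.d n i ω - M.muD n) ^ 2 * M.err n i ω ^ 2 ∂(P n) =
      ∫ ω, (inner ℝ (M.A n i ω - M.muA n) (M.e n i ω)) ^ 2 ∂(P n) +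
        variance (M.muAe n i) (P n) := by
  have h1 : Integrable (fun ω => (inner ℝ (M.A n i ω - M.muA n) (M.e n i ω)) ^ 2) (P n) :=
    (indepFun_A_sub_e_apply he n i).integrable_inner_sq (memLp_A_sub hd he n i)
      (he.sq_integrable n i)
  have hm : Measurable fun ω => inner ℝ (M.A n i ω - M.muA n) (M.e n i ω) := by
    have := measurable_A hd he n i
    have := he.measurable n i
    fun_prop
  have hL : MemLp (fun ω => inner ℝ (M.A n i ω - M.muA n) (M.e n i ω)) 2 (P n) :=
    (memLp_two_iff_integrable_sq hm.aestronglyMeasurable).2 h1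
  have h2 : Integrable (fun ω => inner ℝ (M.A n i ω - M.muA n) (M.e n i ω) * M.muAe n i ω) (P n) :=
    hL.integrable_mul (memLp_muAe he n i)
  have h3 : Integrable (fun ω => M.muAe n i ω ^ 2) (P n) := (memLp_muAe he n i).integrable_sq
  have h12 : Integrable (fun ω => (inner ℝ (M.A n i ω - M.muA n) (M.e n i ω)) ^ 2 +
      2 * (inner ℝ (M.A n i ω - M.muA n) (M.e n i ω) * M.muAe n i ω)) (P n) :=
    h1.add (h2.const_mul 2)
  have heq : ∀ ω, (M.d n i ω - M.muD n) ^ 2 * M.err n i ω ^ 2 =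
      (inner ℝ (M.A n i ω - M.muA n) (M.e n i ω)) ^ 2 +
        2 * (inner ℝ (M.A n i ω - M.muA n) (M.e n i ω) * M.muAe n i ω) + M.muAe n i ω ^ 2 := by
    intro ω
    rw [← mul_pow, ← inner_A_sub_add, muAe]
    ring
  simp only [heq]
  rw [integral_add h12 h3, integral_add h1 (h2.const_mul 2), integral_const_mul,
    integral_inner_A_sub_mul_muAe hd he n i,
    variance_of_integral_eq_zero (memLp_muAe he n i).aemeasurable (integral_muAe he n i)]
  ring

theorem variance_sum_muAe (he : M.ScaledErrorAssumption P K) (n : ℕ) :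
    variance (fun ω => (√(n : ℝ))⁻¹ * ∑ i, M.muAe n i ω) (P n) = M.sigmaE2Sq P n := by
  refine variance_of_integral_eq_zero (memLp_sum_muAe he n).aemeasurable ?_
  rw [integral_const_mul, integral_finsetSum _ fun i _ =>
    (memLp_muAe he n i).integrable one_le_two]
  simp [integral_muAe he n]

/-- The dependence of the errors across units enters the variance only through `μ_Aᵀ e_i`. -/
theorem sigmaDE_sq_eq (hd : M.RegressorAssumption P K) (he : M.ScaledErrorAssumption P K) (n : ℕ) :
    M.sigmaDE P n ^ 2 =
      (n : ℝ)⁻¹ * (∑ i : Fin n, ∫ ω, (M.d n i ω - M.muD n) ^ 2 * M.err n i ω ^ 2 ∂(P n))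
        + (variance (fun ω => (√(n : ℝ))⁻¹ * ∑ i : Fin n, M.muAe n i ω) (P n)
          - (n : ℝ)⁻¹ * ∑ i : Fin n, variance (M.muAe n i) (P n)) := by
  rw [sigmaDE_sq, variance_sum_muAe he n]
  simp only [integral_sq_d_sub_mul_err hd he n, Finset.sum_add_distrib]
  rw [sigmaE1Sq]
  ring

/-- The two components of μ_A are E[d^*] = 0 and E[d^* d] = σ_d², so the component with constant
scale drops out. -/
theorem muAe_ae_eq_of_binary (hd : M.RegressorAssumption P K) (he : M.ScaledErrorAssumption P K)
    {n : ℕ} {l₀ l₁ : Fin L} (hne : l₀ ≠ l₁) (hL : ∀ l, l = l₀ ∨ l = l₁)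
    (h₀ : ∀ i, ∀ᵐ ω ∂(P n), M.sigma n l₀ (M.d n i ω) = 1)
    (h₁ : ∀ i, ∀ᵐ ω ∂(P n), M.sigma n l₁ (M.d n i ω) = M.d n i ω) (i : Fin n) (ω : Ω n) :
    M.muAe n i ω = M.sigmaD n ^ 2 * M.e n i ω l₁ := by
  have e0 : M.muA n l₀ = 0 := by
    rw [← integral_A_apply hd he n i l₀, ← hd.integral_d_sub n i]
    refine integral_congr_ae ?_
    filter_upwards [h₀ i] with ω hω
    rw [hω, mul_one]
  have e1 : M.muA n l₁ = M.sigmaD n ^ 2 := by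
    rw [← integral_A_apply hd he n i l₁, ← hd.integral_d_sub_sq n i]
    have hs : Integrable (fun ω => (M.d n i ω - M.muD n) ^ 2) (P n) :=
      (hd.memLp_d_sub n i).integrable_sq
    have hl : Integrable (fun ω => M.muD n * (M.d n i ω - M.muD n)) (P n) :=
      ((hd.memLp_d_sub n i).integrable one_le_two).const_mul _
    -- As d^* d = (d^*)² + μ_d d^*, the extra term has mean zero.
    have h2 : ∫ ω, ((M.d n i ω - M.muD n) ^ 2 + M.muD n * (M.d n i ω - M.muD n)) ∂(P n) =
        ∫ ω, (M.d n i ω - M.muD n) ^ 2 ∂(P n) := by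
      rw [integral_add hs hl, integral_const_mul, hd.integral_d_sub n i, mul_zero, add_zero]
    rw [← h2]
    refine integral_congr_ae ?_
    filter_upwards [h₁ i] with ω hω
    rw [hω]
    ring
  have huniv : (Finset.univ : Finset (Fin L)) = {l₀, l₁} := by
    ext l
    simpa using hL l
  rw [muAe, EuclideanSpace.inner_eq_sum_mul, huniv, Finset.sum_pair hne, e0, e1, zero_mul, zero_add]

/-- With potential outcomes, the dependence enters only through the treatment effects. -/
theorem sigmaDE_sq_div_eq_of_binary (hK : 0 < K) (hd : M.RegressorAssumption P K)
    (he : M.ScaledErrorAssumption P K) {n : ℕ} (hn : 1 ≤ n) {l₀ l₁ : Fin L} (hne : l₀ ≠ l₁)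
    (hL : ∀ l, l = l₀ ∨ l = l₁)
    (h₀ : ∀ i, ∀ᵐ ω ∂(P n), M.sigma n l₀ (M.d n i ω) = 1)
    (h₁ : ∀ i, ∀ᵐ ω ∂(P n), M.sigma n l₁ (M.d n i ω) = M.d n i ω) {τ : Fin n → Ω n → ℝ}
    (hτ : ∀ i, ∀ᵐ ω ∂(P n), M.e n i ω l₁ = τ i ω - ∫ ω', τ i ω' ∂(P n)) :
    M.sigmaDE P n ^ 2 / M.sigmaD n ^ 4 =
      ((n : ℝ) * M.sigmaD n ^ 4)⁻¹ *
          (∑ i : Fin n, ∫ ω, (M.d n i ω - M.muD n) ^ 2 * M.err n i ω ^ 2 ∂(P n))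
        + variance (fun ω => (√(n : ℝ))⁻¹ * ∑ i : Fin n, τ i ω) (P n)
        - (n : ℝ)⁻¹ * ∑ i : Fin n, variance (τ i) (P n) := by
  have hpos : 0 < M.sigmaD n ^ 2 := (inv_pos.2 hK).trans_le (hd.variance_ge n hn)
  have heL : ∀ i, MemLp (fun ω => M.e n i ω l₁) 2 (P n) := fun i =>
    (he.sq_integrable n i).eval_piLp l₁
  have hmu := muAe_ae_eq_of_binary hd he hne hL h₀ h₁
  have hvar : ∀ i, variance (M.muAe n i) (P n) = M.sigmaD n ^ 4 * variance (τ i) (P n) := by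
    intro i
    have e1 : τ i =ᵐ[P n] fun ω => M.e n i ω l₁ + ∫ ω', τ i ω' ∂(P n) := by
      filter_upwards [hτ i] with ω hω
      rw [hω]; ring
    have e2 : M.muAe n i = fun ω => M.sigmaD n ^ 2 * M.e n i ω l₁ := funext (hmu i)
    rw [e2, variance_const_mul, variance_congr e1, variance_add_const (heL i).aestronglyMeasurable]
    ring
  have hsum : variance (fun ω => (√(n : ℝ))⁻¹ * ∑ i : Fin n, M.muAe n i ω) (P n) =
      M.sigmaD n ^ 4 * variance (fun ω => (√(n : ℝ))⁻¹ * ∑ i : Fin n, τ i ω) (P n) := by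
    have e1 : (fun ω => (√(n : ℝ))⁻¹ * ∑ i : Fin n, τ i ω) =ᵐ[P n] fun ω =>
        (√(n : ℝ))⁻¹ * ∑ i : Fin n, M.e n i ω l₁ +
          (√(n : ℝ))⁻¹ * ∑ i : Fin n, ∫ ω', τ i ω' ∂(P n) := by
      filter_upwards [ae_all_iff.2 hτ] with ω hω
      simp only [hω, Finset.sum_sub_distrib]
      ring
    have e2 : (fun ω => (√(n : ℝ))⁻¹ * ∑ i : Fin n, M.muAe n i ω) =
        fun ω => M.sigmaD n ^ 2 * ((√(n : ℝ))⁻¹ * ∑ i : Fin n, M.e n i ω l₁) := by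
      funext ω
      simp only [hmu, ← Finset.mul_sum]
      ring
    have hm : AEStronglyMeasurable (fun ω => (√(n : ℝ))⁻¹ * ∑ i : Fin n, M.e n i ω l₁) (P n) := by
      have := he.measurable n
      exact Measurable.aestronglyMeasurable (by fun_prop)
    rw [e2, variance_const_mul, variance_congr e1, variance_add_const hm]
    ring
  have hn' : (0 : ℝ) < n := by exact_mod_cast hn
  have h4 : M.sigmaD n ^ 4 ≠ 0 := by
    have : M.sigmaD n ^ 4 = (M.sigmaD n ^ 2) ^ 2 := by ring
    rw [this]; positivity
  rw [sigmaDE_sq_eq hd he n, hsum]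
  simp only [hvar, ← Finset.mul_sum]
  generalize ∑ i : Fin n, ∫ ω, (M.d n i ω - M.muD n) ^ 2 * M.err n i ω ^ 2 ∂(P n) = x
  generalize variance (fun ω => (√(n : ℝ))⁻¹ * ∑ i : Fin n, τ i ω) (P n) = y
  generalize M.sigmaD n ^ 4 = z at h4 ⊢
  field_simp
  ring

end RegressionArray

/-! ### Convergence in distribution implies stochastic boundedness. -/

section Tightness

variable {Ω : ℕ → Type*} [∀ n, MeasurableSpace (Ω n)] {P : ∀ n, Measure (Ω n)}
  [∀ n, IsProbabilityMeasure (P n)]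

theorem MeasureTheory.TendstoInDistribution.isBigOp {Ω' : Type*} [MeasurableSpace Ω']
    {P' : Measure Ω'} [IsProbabilityMeasure P'] {Z : Ω' → ℝ} {X : ∀ n, Ω n → ℝ}
    (hX : TendstoInDistribution X atTop Z P P') : IsBigOp P X := by
  intro η hη
  have hη' : 0 < ENNReal.ofReal η := by simpa using hη
  have : IsProbabilityMeasure (P'.map Z) := Measure.isProbabilityMeasure_map hX.aemeasurable_limit
  have htight := isTightMeasureSet_iff_tendsto_measure_norm_gt.1
    (isTightMeasureSet_singleton (μ := P'.map Z))
  simp only [iSup_singleton] at htight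
  obtain ⟨C, hC⟩ := (htight.eventually (gt_mem_nhds hη')).exists
  -- Portmanteau bounds the limsup on closed sets; the closed tail at C + 1 lies inside the open
  -- tail at C, where tightness of the limit law gives a strict bound.
  refine ⟨C + 1, ?_⟩
  have hclosed : IsClosed {x : ℝ | C + 1 ≤ ‖x‖} := isClosed_le continuous_const continuous_norm
  have hlim := ProbabilityMeasure.limsup_measure_closed_le_of_tendsto hX.tendsto hclosed
  have hlt : P'.map Z {x : ℝ | C + 1 ≤ ‖x‖} < ENNReal.ofReal η := by
    refine lt_of_le_of_lt (measure_mono fun x (hx : C + 1 ≤ ‖x‖) => ?_) hC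
    exact show C < ‖x‖ by linarith
  filter_upwards [eventually_lt_of_limsup_lt (lt_of_le_of_lt hlim hlt)] with n hn
  have hn' : (P n).map (X n) {x : ℝ | C + 1 ≤ ‖x‖} < ENNReal.ofReal η := hn
  rw [Measure.map_apply_of_aemeasurable (hX.forall_aemeasurable n) hclosed.measurableSet] at hn'
  exact (measure_mono fun ω (hω : C + 1 < ‖X n ω‖) => hω.le).trans hn'.le

end Tightness

/-- Second moment of a sum of products of independent centred variables with other variables. -/
theorem integral_sq_sum_mul_eq {Ω ι : Type*} [Fintype ι] [MeasurableSpace Ω] {P : Measure Ω}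
    [IsProbabilityMeasure P] {x z : ι → Ω → ℝ} (hx : ∀ i, MemLp (x i) 2 P)
    (hz : ∀ i, MemLp (z i) 2 P) (h0 : ∀ i, ∫ ω, x i ω ∂P = 0) (hind : iIndepFun x P)
    (hxz : ∀ i k, IndepFun (fun ω => x i ω * x k ω) (fun ω => z i ω * z k ω) P) :
    Integrable (fun ω => (∑ i, x i ω * z i ω) ^ 2) P ∧
    ∫ ω, (∑ i, x i ω * z i ω) ^ 2 ∂P = ∑ i, (∫ ω, x i ω ^ 2 ∂P) * ∫ ω, z i ω ^ 2 ∂P := by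
  classical
  have heq : ∀ ω, (∑ i, x i ω * z i ω) ^ 2 =
      ∑ i, ∑ k, x i ω * x k ω * (z i ω * z k ω) := by
    intro ω
    rw [sq, Finset.sum_mul_sum]
    exact Finset.sum_congr rfl fun i _ => Finset.sum_congr rfl fun k _ => by ring
  have hxx : ∀ i k, Integrable (fun ω => x i ω * x k ω) P := fun i k =>
    (hx i).integrable_mul (hx k)
  have hzz : ∀ i k, Integrable (fun ω => z i ω * z k ω) P := fun i k =>
    (hz i).integrable_mul (hz k)
  have hint : ∀ i k, Integrable (fun ω => x i ω * x k ω * (z i ω * z k ω)) P := fun i k =>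
    (hxz i k).integrable_mul (hxx i k) (hzz i k)
  simp only [heq]
  refine ⟨integrable_finsetSum _ fun i _ => integrable_finsetSum _ fun k _ => hint i k, ?_⟩
  rw [integral_finsetSum _ fun i _ => integrable_finsetSum _ fun k _ => hint i k]
  refine Finset.sum_congr rfl fun i _ => ?_
  -- The off-diagonal terms vanish because E[x_i x_k] = 0, whatever the dependence among the z_i.
  rw [integral_finsetSum _ fun k _ => hint i k, Finset.sum_eq_single i]
  · rw [(hxz i i).integral_fun_mul_eq_mul_integral (hxx i i).aestronglyMeasurable
      (hzz i i).aestronglyMeasurable]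
    simp only [sq]
  · intro k _ hk
    rw [(hxz i k).integral_fun_mul_eq_mul_integral (hxx i k).aestronglyMeasurable
      (hzz i k).aestronglyMeasurable, (hind.indepFun hk.symm).integral_fun_mul_eq_mul_integral
      (hx i).aestronglyMeasurable (hx k).aestronglyMeasurable, h0 i, zero_mul, zero_mul]
  · simp

/-! ### Limit of the score and linearization of the estimator. -/

namespace RegressionArray

variable {p L : ℕ} {Ω : ℕ → Type*} {M : RegressionArray p L Ω}
  [∀ n, MeasurableSpace (Ω n)] {P : ∀ n, Measure (Ω n)} {K : ℝ}

theorem inv_le_sigmaDE_sq (he : M.ScaledErrorAssumption P K) {n : ℕ} (hn : 1 ≤ n) :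
    K⁻¹ ≤ M.sigmaDE P n ^ 2 := by
  rw [sigmaDE_sq]
  linarith [he.sigmaE1Sq_ge n hn, sigmaE2Sq_nonneg (M := M) (P := P) n]

theorem sigmaDE_pos (hK : 0 < K) (he : M.ScaledErrorAssumption P K) {n : ℕ} (hn : 1 ≤ n) :
    0 < M.sigmaDE P n := by
  refine lt_of_le_of_ne (Real.sqrt_nonneg _) fun h => ?_
  have h1 := (inv_pos.2 hK).trans_le (inv_le_sigmaDE_sq he hn)
  rw [← h] at h1
  simp at h1

theorem measurable_betaHat [NeZero p] (hd : M.RegressorAssumption P K)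
    (hw : M.ControlAssumption P K) (he : M.ScaledErrorAssumption P K) (n : ℕ) :
    Measurable (M.betaHat n) := by
  have hy : ∀ i, Measurable fun ω => M.y n i ω := fun i => by
    have h1 := hd.measurable n i
    have h2 := hw.measurable n i
    have h3 := measurable_err hd he n i
    unfold y
    fun_prop
  exact measurable_ols (measurable_regressorMatrix_apply (hd.measurable n) (hw.measurable n)) hy 0

/-- On a typical sample, the standardized estimation error is close to the standardized score. -/
theorem abs_standardized_sub_le [NeZero p] (hK : 0 < K) (he : M.ScaledErrorAssumption P K) {n : ℕ}
    (hn : 1 ≤ n) {ω : Ω n} {c : ℝ} (hc : c ≠ 0) (hw : ∀ i, M.w n i ω 0 = c) {a : ℝ} (ha : 0 < a)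
    (hlam : a ≤ lambdaMin
      ((n : ℝ)⁻¹ • ∑ i : Fin n, Matrix.vecMulVec (⇑(M.w n i ω)) (⇑(M.w n i ω))))
    (hs : a⁻¹ * ‖(√(n : ℝ))⁻¹ • ∑ i, (M.d n i ω - M.muD n) • M.w n i ω‖ ^ 2 * (n : ℝ)⁻¹ <
      (n : ℝ)⁻¹ * ∑ i, (M.d n i ω - M.muD n) ^ 2) :
    |((n : ℝ)⁻¹ * ∑ i, (M.d n i ω - M.muD n) ^ 2) *
        (√(n : ℝ) * (M.betaHat n ω - M.beta n) / M.sigmaDE P n) - M.score n ω / M.sigmaDE P n| ≤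
      a⁻¹ * ‖(√(n : ℝ))⁻¹ • ∑ i, (M.d n i ω - M.muD n) • M.w n i ω‖ *
        (‖(n : ℝ)⁻¹ • ∑ i, M.err n i ω • M.w n i ω‖ * (M.sigmaDE P n)⁻¹) +
      a⁻¹ * ‖(√(n : ℝ))⁻¹ • ∑ i, (M.d n i ω - M.muD n) • M.w n i ω‖ ^ 2 * (n : ℝ)⁻¹ *
        |√(n : ℝ) * (M.betaHat n ω - M.beta n) / M.sigmaDE P n| := by
  have hσ := sigmaDE_pos hK he hn
  have h := abs_ols_sub_le (ε := fun i => M.err n i ω) hn hc hw (M.muD n) (M.beta n) (M.gamma n) ha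
    (mul_norm_sq_le_sum_inner_sq _ hlam) hs
  have hB : ols (regressorMatrix (fun i => M.d n i ω) fun i => M.w n i ω)
      (fun i => M.d n i ω * M.beta n + (∑ j, M.w n i ω j * M.gamma n j) + M.err n i ω) 0 =
        M.betaHat n ω := rfl
  have hT : (√(n : ℝ))⁻¹ * ∑ i, (M.d n i ω - M.muD n) * M.err n i ω = M.score n ω := rfl
  rw [hB, hT] at h
  rw [← mul_div_assoc, ← sub_div, abs_div, abs_div, abs_of_pos hσ, div_le_iff₀ hσ]
  refine h.trans (le_of_eq ?_)
  field_simp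

variable [∀ n, IsProbabilityMeasure (P n)]

/-- In each coordinate the cross terms of the second moment vanish, as the d_i^* are independent,
centred and independent of the controls. What is left is at most (1 + K) K, and the controls may be
arbitrarily dependent across units. -/
theorem isBigOp_sum_smul_controls [NeZero p] (hd : M.RegressorAssumption P K)
    (hw : M.ControlAssumption P K) :
    IsBigOp P fun (n : ℕ) ω => ‖(√(n : ℝ))⁻¹ • ∑ i, (M.d n i ω - M.muD n) • M.w n i ω‖ := by
  have hwL : ∀ n i, MemLp (M.w n i) 2 (P n) := fun n i => by
    have := hw.moment n i
    rw [← add_zero (2 : ℝ)] at this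
    exact this.memLp_two (hw.measurable n i).aestronglyMeasurable le_rfl
  have hcoord : ∀ n j, Integrable (fun ω => (∑ i, (M.d n i ω - M.muD n) * M.w n i ω j) ^ 2) (P n) ∧
      ∫ ω, (∑ i, (M.d n i ω - M.muD n) * M.w n i ω j) ^ 2 ∂(P n) =
        ∑ i, (∫ ω, (M.d n i ω - M.muD n) ^ 2 ∂(P n)) * ∫ ω, M.w n i ω j ^ 2 ∂(P n) := fun n j =>
    integral_sq_sum_mul_eq (x := fun i ω => M.d n i ω - M.muD n) (z := fun i ω => M.w n i ω j)
      (hd.memLp_d_sub n) (fun i => (hwL n i).eval_piLp j) (hd.integral_d_sub n)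
      ((hd.indep n).comp (g := fun _ x => x - M.muD n) fun _ => by fun_prop) fun i k =>
        (hd.indep_controls n).comp
          (φ := fun x : Fin n → ℝ => (x i - M.muD n) * (x k - M.muD n))
          (ψ := fun x : Fin n → EuclideanSpace ℝ (Fin p) => x i j * x k j)
          (by fun_prop) (by fun_prop)
  have hnorm : ∀ (n : ℕ) ω,
      ‖(√(n : ℝ))⁻¹ • ∑ i, (M.d n i ω - M.muD n) • M.w n i ω‖ ^ 2 =
        (n : ℝ)⁻¹ * ∑ j, (∑ i, (M.d n i ω - M.muD n) * M.w n i ω j) ^ 2 := by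
    intro n ω
    rw [norm_smul, mul_pow, EuclideanSpace.norm_sq_eq, Real.norm_of_nonneg (by positivity), inv_pow,
      Real.sq_sqrt (by positivity)]
    simp
  refine isBigOp_of_integral_sq_le (C := (1 + K) * K) (fun n => ?_) ?_
  · simp only [hnorm]
    exact (integrable_finsetSum _ fun j _ => (hcoord n j).1).const_mul _
  · filter_upwards [eventually_gt_atTop 0] with n hn
    simp only [hnorm]
    rw [integral_const_mul, integral_finsetSum _ fun j _ => (hcoord n j).1]
    simp only [hcoord]
    rw [Finset.sum_comm]
    refine inv_mul_sum_le_of_forall_le hn fun i => ?_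
    rw [← Finset.mul_sum, hd.integral_d_sub_sq n i]
    have h1 : ∑ j, ∫ ω, M.w n i ω j ^ 2 ∂(P n) ≤ K := by
      rw [← integral_finsetSum _ fun j _ => ((hwL n i).eval_piLp j).integrable_sq]
      refine le_trans (le_of_eq ?_) (hw.moment n i).2
      refine integral_congr_ae (ae_of_all _ fun ω => ?_)
      simp only
      rw [Real.rpow_two, EuclideanSpace.norm_sq_eq]
      simp
    exact mul_le_mul (hd.sigmaD_sq_le n i) h1
      (Finset.sum_nonneg fun j _ => integral_nonneg fun ω => sq_nonneg _)
      ((sq_nonneg _).trans (hd.sigmaD_sq_le n i))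

/-- The weak law applied to (d_i^*)², whose moment of order 1 + δ/2 is the moment of order 2 + δ of
d_i^*. -/
theorem isLittleOp_average_sq_sub (hK : 0 ≤ K) (hd : M.RegressorAssumption P K) :
    IsLittleOp P fun (n : ℕ) ω =>
      (n : ℝ)⁻¹ * ∑ i, (M.d n i ω - M.muD n) ^ 2 - M.sigmaD n ^ 2 := by
  obtain ⟨δ, hδ, hm⟩ := hd.moment
  have hmom := hd.momentLE_d_sub hK hm (q := 2 + δ) (by positivity) le_rfl
  have hpow : ∀ n i ω, ((M.d n i ω - M.muD n) ^ 2) ^ (1 + δ / 2) =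
      ‖M.d n i ω - M.muD n‖ ^ (2 + δ) := fun n i ω => by
    rw [← sq_abs, ← Real.rpow_natCast, ← Real.rpow_mul (abs_nonneg _), Real.norm_eq_abs]
    congr 1; push_cast; ring
  have h := isLittleOp_average_sub_average_integral (P := P)
    (Y := fun n i ω => (M.d n i ω - M.muD n) ^ 2)
    (fun n i => ((hd.measurable n i).sub_const _).pow_const 2) (fun _ _ _ => sq_nonneg _)
    (fun n i _ j _ hij => ((hd.indep n).indepFun hij).comp (φ := fun x => (x - M.muD n) ^ 2)
      (ψ := fun x => (x - M.muD n) ^ 2) (by fun_prop) (by fun_prop))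
    (η := δ / 2) (by positivity) (fun n i => by simpa only [hpow] using (hmom n i).1)
    (fun n i => by simpa only [hpow] using (hmom n i).2)
  refine h.of_le ?_
  filter_upwards [eventually_gt_atTop 0] with n hn
  refine ae_of_all _ fun ω => le_of_eq (congrArg _ ?_)
  have hn' : (0 : ℝ) < n := by exact_mod_cast hn
  simp only [hd.integral_d_sub_sq n, Finset.sum_const, Finset.card_univ, Fintype.card_fin,
    nsmul_eq_mul]
  field_simp

/-- Asymptotic normality of the standardized score. -/
theorem tendstoInDistribution_score (hK : 0 < K) (hd : M.RegressorAssumption P K)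
    (he : M.ScaledErrorAssumption P K) (hdep : M.WeakDependenceAssumption P) :
    TendstoInDistribution (fun (n : ℕ) ω => M.score n ω / M.sigmaDE P n)
      atTop id P (gaussianReal 0 1) := by
  obtain ⟨δ₁, hδ₁, hm⟩ := hd.moment
  obtain ⟨δ₃, hδ₃, hmom⟩ := hdep.moment
  -- One exponent has to serve the moments of A_i and of e_i, and the cap at 1 is required by the
  -- Taylor bound.
  set δ := min 1 (min δ₁ δ₃) with hδdef
  have hδ : 0 < δ := lt_min one_pos (lt_min hδ₁ hδ₃)
  have hδ1 : δ ≤ 1 := min_le_left _ _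
  have hδδ₁ : δ ≤ δ₁ := (min_le_right _ _).trans (min_le_left _ _)
  have hδδ₃ : δ ≤ δ₃ := (min_le_right _ _).trans (min_le_right _ _)
  obtain ⟨C, hC⟩ := exists_momentLE_A_sub hK.le hd he (q := 2 + δ) (by positivity)
    (by linarith) hm
  have hmom' : IsBigOp P fun (n : ℕ) ω => (n : ℝ)⁻¹ * ∑ i, ‖M.e n i ω‖ ^ (2 + δ) := by
    refine ((isBigOp_const (1 : ℝ)).add hmom).of_le ?_
    filter_upwards [eventually_gt_atTop 0] with n hn
    refine ae_of_all _ fun ω => ?_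
    have hn' : (0 : ℝ) < n := by exact_mod_cast hn
    rw [Real.norm_of_nonneg (by positivity), Real.norm_of_nonneg (by positivity)]
    have h1 : ∑ i, ‖M.e n i ω‖ ^ (2 + δ) ≤ ∑ i, (1 + ‖M.e n i ω‖ ^ (2 + δ₃)) :=
      Finset.sum_le_sum fun i _ => rpow_le_one_add_rpow (norm_nonneg _) (by positivity)
        (by linarith)
    rw [Finset.sum_add_distrib] at h1
    simp only [Finset.sum_const, Finset.card_univ, Fintype.card_fin, nsmul_eq_mul, mul_one] at h1
    calc _ ≤ (n : ℝ)⁻¹ * (n + ∑ i, ‖M.e n i ω‖ ^ (2 + δ₃)) := by gcongr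
      _ = _ := by field_simp
  have hvar : IsLittleOp P fun (n : ℕ) ω =>
      conditionalVariance P (fun n i ω => M.A n i ω - M.muA n) M.e n ω - M.sigmaE1Sq P n := by
    -- The d_i are identically distributed, so the covariance matrix common to all A_i can be read
    -- off at index 0; the value 0 for the empty sample is a dummy.
    refine isLittleOp_conditionalVariance_sub (memLp_A_sub hd he) he.sq_integrable
      (indepFun_A_sub_e_apply he)
      (V := fun n l m => if h : 0 < n then
        ∫ ω, (M.A n ⟨0, h⟩ ω - M.muA n) l * (M.A n ⟨0, h⟩ ω - M.muA n) m ∂(P n) else 0)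
      (fun n i l m => ?_) (C := 1 + C) ?_ hdep.lln_outer
    · have hn : 0 < n := i.pos
      simp only [hn, dif_pos]
      exact integral_A_sub_entry_mul_eq hd he n i _ l m
    · filter_upwards [eventually_gt_atTop 0] with n hn l m
      simp only [hn, dif_pos]
      have hm2 := (hC n ⟨0, hn⟩).of_le (q := 2)
        ((measurable_A hd he n _).sub_const _).aestronglyMeasurable (by norm_num) (by linarith)
      rw [← Real.norm_eq_abs]
      refine (norm_integral_le_integral_norm _).trans ((integral_mono ?_ hm2.1 fun ω => ?_).trans
        hm2.2)
      · exact ((memLp_A_sub hd he n _).integrable_entry_mul l m).norm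
      · simp only
        rw [norm_mul, Real.rpow_two, sq]
        exact mul_le_mul (PiLp.norm_apply_le _ _) (PiLp.norm_apply_le _ _) (norm_nonneg _)
          (norm_nonneg _)
  have h := tendstoInDistribution_sum_inner_add (P := P)
    (a := fun n i ω => M.A n i ω - M.muA n) (e := M.e)
    (fun n i => (measurable_A hd he n i).sub_const _) he.measurable he.sq_integrable
    (iIndepFun_A_sub hd he) (indepFun_A_sub_e he) (integral_A_sub_apply hd he) hδ hδ1
    (fun n i => (hC n i).1) (fun n i => (hC n i).2) hmom' (μ := M.muA) (v₁ := M.sigmaE1Sq P)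
    (v₂ := M.sigmaE2Sq P) sigmaE1Sq_nonneg (inv_pos.2 hK)
    (by filter_upwards [eventually_ge_atTop 1] with n hn using he.sigmaE1Sq_ge n hn) hvar
    (fun n => rfl) hdep.clt
  simp only [← score_eq] at h
  exact h

/-- Two passes through one inequality, |s B - T| ≤ o_p(1) + o_p(1) |B|, where B is the estimation
error and T the score, both over σ_{dε}. The first pass absorbs |B| and shows B = O_p(1); the second
then makes the whole right side o_p(1). -/
theorem isLittleOp_standardized_sub [NeZero p] (hK : 0 < K) (hd : M.RegressorAssumption P K)
    (hw : M.ControlAssumption P K) (herr : M.ErrorAssumption P K)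
    (he : M.ScaledErrorAssumption P K) (hdep : M.WeakDependenceAssumption P) :
    IsLittleOp P (fun (n : ℕ) ω =>
      √(n : ℝ) * (M.betaHat n ω - M.beta n) / (M.sigmaDE P n / M.sigmaD n ^ 2)
        - M.score n ω / M.sigmaDE P n) := by
  obtain ⟨R, hR, hlam⟩ := hw.lambdaMin_ge
  let q : ∀ n, Ω n → ℝ := fun n ω =>
    ‖(√(n : ℝ))⁻¹ • ∑ i, (M.d n i ω - M.muD n) • M.w n i ω‖
  let r : ∀ n, Ω n → ℝ := fun n ω =>
    ‖(n : ℝ)⁻¹ • ∑ i, M.err n i ω • M.w n i ω‖ * (M.sigmaDE P n)⁻¹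
  let s : ∀ n, Ω n → ℝ := fun n ω => (n : ℝ)⁻¹ * ∑ i, (M.d n i ω - M.muD n) ^ 2
  let T : ∀ n, Ω n → ℝ := fun n ω => M.score n ω / M.sigmaDE P n
  let B : ∀ n, Ω n → ℝ := fun n ω => √(n : ℝ) * (M.betaHat n ω - M.beta n) / M.sigmaDE P n
  have hK' : 0 < K⁻¹ := inv_pos.2 hK
  -- Half of K⁻¹: off the bad event, errors below a leave both the smallest eigenvalue and s at
  -- least K⁻¹ - a = a.
  set a := K⁻¹ / 2 with ha
  have ha0 : 0 < a := half_pos hK'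
  have hq : IsBigOp P q := isBigOp_sum_smul_controls hd hw
  have hT : IsBigOp P T := (tendstoInDistribution_score hK hd he hdep).isBigOp
  have hs : IsLittleOp P fun n ω => s n ω - M.sigmaD n ^ 2 := isLittleOp_average_sq_sub hK.le hd
  have hσ : IsBigOp P fun (n : ℕ) (_ : Ω n) => (M.sigmaDE P n)⁻¹ := by
    refine (isBigOp_const (1 + K)).of_le ?_
    filter_upwards [eventually_ge_atTop 1] with n hn
    refine ae_of_all _ fun ω => ?_
    have h1 := sigmaDE_pos hK he hn
    have h2 : (M.sigmaDE P n)⁻¹ ^ 2 ≤ K := by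
      rw [inv_pow]
      exact inv_le_of_inv_le₀ hK (inv_le_sigmaDE_sq he hn)
    rw [Real.norm_of_nonneg (by positivity), Real.norm_of_nonneg (by positivity)]
    nlinarith [sq_nonneg ((M.sigmaDE P n)⁻¹ - 1)]
  have hr : IsLittleOp P r := by
    refine (hσ.mul_isLittleOp herr.orthogonality.norm).of_le
      (Eventually.of_forall fun n => ae_of_all _ fun ω => le_of_eq (congrArg _ ?_))
    exact mul_comm _ _
  have hqr : IsLittleOp P fun n ω => a⁻¹ * q n ω * r n ω :=
    ((isBigOp_const a⁻¹).mul hq).mul_isLittleOp hr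
  have hqq : IsLittleOp P fun (n : ℕ) ω => a⁻¹ * q n ω ^ 2 * (n : ℝ)⁻¹ := by
    have h1 : IsLittleOp P fun (n : ℕ) (_ : Ω n) => (n : ℝ)⁻¹ :=
      isLittleOp_of_tendsto_zero tendsto_inv_atTop_nhds_zero_nat
    have h2 := (((isBigOp_const a⁻¹).mul hq).mul hq).mul_isLittleOp h1
    simpa only [sq, mul_assoc] using h2
  let bad : ∀ n, Set (Ω n) := fun n =>
    {ω | a ≤ ‖R n ω‖} ∪ {ω | a ≤ ‖s n ω - M.sigmaD n ^ 2‖} ∪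
      {ω | a / 2 ≤ ‖a⁻¹ * q n ω ^ 2 * (n : ℝ)⁻¹‖}
  have hbad : Tendsto (fun n => P n (bad n)) atTop (𝓝 0) := by
    have h1 := ((hR a ha0).add (hs a ha0)).add (hqq (a / 2) (by positivity))
    simp only [add_zero] at h1
    refine tendsto_of_tendsto_of_tendsto_of_le_of_le tendsto_const_nhds h1 (fun _ => zero_le)
      fun n => (measure_union_le _ _).trans ?_
    gcongr
    exact measure_union_le _ _
  have hgood : ∀ᶠ n in atTop, ∀ᵐ ω ∂(P n), ω ∉ bad n →
      |s n ω * B n ω - T n ω| ≤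
          a⁻¹ * q n ω * r n ω + a⁻¹ * q n ω ^ 2 * (n : ℝ)⁻¹ * |B n ω| ∧
        a ≤ s n ω ∧ a⁻¹ * q n ω ^ 2 * (n : ℝ)⁻¹ < a / 2 := by
    filter_upwards [eventually_ge_atTop 1] with n hn
    obtain ⟨c, hc, hcw⟩ := hw.intercept n
    filter_upwards [ae_all_iff.2 hcw, hlam n] with ω hω hl hb
    simp only [bad, Set.mem_union, Set.mem_ofPred_eq, not_or, not_le] at hb
    obtain ⟨⟨hb1, hb2⟩, hb3⟩ := hb
    rw [Real.norm_eq_abs, abs_lt] at hb1 hb2 hb3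
    have hv := hd.variance_ge n hn
    have hsa : a ≤ s n ω := by linarith [hb2.1]
    refine ⟨?_, hsa, hb3.2⟩
    exact abs_standardized_sub_le hK he hn hc hω ha0 (by linarith [hb1.1])
      (lt_of_lt_of_le hb3.2 ((half_le_self ha0.le).trans hsa))
  have hqr0 : ∀ n, 1 ≤ n → ∀ ω, 0 ≤ a⁻¹ * q n ω * r n ω := fun n hn ω => by
    have := sigmaDE_pos hK he hn
    positivity
  have hB : IsBigOp P B := by
    have hTn : IsBigOp P fun n ω => ‖T n ω‖ :=
      hT.of_le (Eventually.of_forall fun n => ae_of_all _ fun ω => by rw [norm_norm])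
    -- Since s ≥ a while the coefficient of |B| on the right is below a/2, absorbing that term
    -- leaves (a/2) |B| ≤ |T| + o_p(1), hence the factor 2/a.
    refine ((isBigOp_const (2 / a)).mul (hTn.add hqr.isBigOp)).of_le_off hbad ?_
    filter_upwards [hgood, eventually_ge_atTop 1] with n hn hn1
    filter_upwards [hn] with ω hω hb
    obtain ⟨h1, h2, h3⟩ := hω hb
    have h0 := hqr0 n hn1 ω
    refine le_trans ?_ (Real.le_norm_self _)
    rw [Real.norm_eq_abs, Real.norm_eq_abs, div_mul_eq_mul_div, le_div_iff₀ ha0]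
    have h4 : |s n ω * B n ω| - |T n ω| ≤ |s n ω * B n ω - T n ω| := abs_sub_abs_le_abs_sub _ _
    rw [abs_mul, abs_of_pos (ha0.trans_le h2)] at h4
    have h5 := mul_le_mul_of_nonneg_right h2 (abs_nonneg (B n ω))
    have h6 := mul_le_mul_of_nonneg_right h3.le (abs_nonneg (B n ω))
    linarith
  refine (((hB.mul_isLittleOp hs).norm.add hqr).add (hB.mul_isLittleOp hqq).norm).of_le_off hbad ?_
  filter_upwards [hgood, eventually_ge_atTop 1] with n hn hn1
  filter_upwards [hn] with ω hω hb
  obtain ⟨h1, -, -⟩ := hω hb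
  have h0 := hqr0 n hn1 ω
  have h2 : 0 ≤ a⁻¹ * q n ω ^ 2 * (n : ℝ)⁻¹ := by positivity
  -- The target is σ_d² B - T; replacing σ_d² by s costs B (s - σ_d²), a product of O_p(1) and
  -- o_p(1).
  have hsplit : √(n : ℝ) * (M.betaHat n ω - M.beta n) / (M.sigmaDE P n / M.sigmaD n ^ 2) -
      M.score n ω / M.sigmaDE P n =
        (s n ω * B n ω - T n ω) - B n ω * (s n ω - M.sigmaD n ^ 2) := by
    simp only [B, T]
    rw [div_div_eq_mul_div]
    ring
  refine le_trans ?_ (Real.le_norm_self _)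
  rw [hsplit, norm_mul (B n ω) (a⁻¹ * _ * _), Real.norm_of_nonneg h2]
  refine (norm_sub_le _ _).trans ?_
  rw [Real.norm_eq_abs (s n ω * B n ω - T n ω), Real.norm_eq_abs (B n ω)]
  linarith

end RegressionArray

theorem theorem2 {p L : ℕ} [NeZero p] {Ω : ℕ → Type*} [∀ n, MeasurableSpace (Ω n)]
    (P : ∀ n, Measure (Ω n)) [∀ n, IsProbabilityMeasure (P n)]
    (M : RegressionArray p L Ω) (K : ℝ) (hK : 0 < K)
    (hd : M.RegressorAssumption P K) (hw : M.ControlAssumption P K)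
    (herr : M.ErrorAssumption P K) (he : M.ScaledErrorAssumption P K)
    (hdep : M.WeakDependenceAssumption P) :
    -- asymptotic linear expansion
    IsLittleOp P (fun (n : ℕ) ω =>
      √(n : ℝ) * (M.betaHat n ω - M.beta n) / (M.sigmaDE P n / M.sigmaD n ^ 2)
        - M.score n ω / M.sigmaDE P n) ∧
    -- asymptotic normality, of the leading term and of the estimator
    TendstoInDistribution (fun (n : ℕ) ω => M.score n ω / M.sigmaDE P n)
      atTop id P (gaussianReal 0 1) ∧
    TendstoInDistribution (fun (n : ℕ) ω =>
      √(n : ℝ) * (M.betaHat n ω - M.beta n) / (M.sigmaDE P n / M.sigmaD n ^ 2))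
      atTop id P (gaussianReal 0 1) ∧
    -- dependence across units enters the variance only through the scalars `μ_Aᵀ e_i`
    (∀ n : ℕ, 1 ≤ n →
      M.sigmaDE P n ^ 2 =
        (n : ℝ)⁻¹ * (∑ i : Fin n, ∫ ω, (M.d n i ω - M.muD n) ^ 2 * M.err n i ω ^ 2 ∂(P n))
          + (variance (fun ω => (√(n : ℝ))⁻¹ * ∑ i : Fin n, M.muAe n i ω) (P n)
            - (n : ℝ)⁻¹ * ∑ i : Fin n, variance (M.muAe n i) (P n))) ∧
    -- potential outcomes: only the treatment effects `Y1 i - Y0 i` matter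
    (∀ n : ℕ, 1 ≤ n → ∀ l₀ l₁ : Fin L, l₀ ≠ l₁ → (∀ l, l = l₀ ∨ l = l₁) →
      (∀ i, ∀ᵐ ω ∂(P n), M.sigma n l₀ (M.d n i ω) = 1) →
      (∀ i, ∀ᵐ ω ∂(P n), M.sigma n l₁ (M.d n i ω) = M.d n i ω) →
      ∀ Y0 Y1 : Fin n → Ω n → ℝ,
      (∀ i, ∀ᵐ ω ∂(P n), M.e n i ω l₁ = (Y1 i ω - Y0 i ω) - ∫ ω', (Y1 i ω' - Y0 i ω') ∂(P n)) →
      M.sigmaDE P n ^ 2 / M.sigmaD n ^ 4 =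
        ((n : ℝ) * M.sigmaD n ^ 4)⁻¹ *
            (∑ i : Fin n, ∫ ω, (M.d n i ω - M.muD n) ^ 2 * M.err n i ω ^ 2 ∂(P n))
          + variance (fun ω => (√(n : ℝ))⁻¹ * ∑ i : Fin n, (Y1 i ω - Y0 i ω)) (P n)
          - (n : ℝ)⁻¹ * ∑ i : Fin n, variance (fun ω => Y1 i ω - Y0 i ω) (P n)) := by
  have hexp := RegressionArray.isLittleOp_standardized_sub hK hd hw herr he hdep
  have hscore := RegressionArray.tendstoInDistribution_score hK hd he hdep
  refine ⟨hexp, hscore, ?_, fun n _ => RegressionArray.sigmaDE_sq_eq hd he n, ?_⟩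
  · refine tendstoInDistribution_of_isLittleOp_sub hscore (fun n => ?_) hexp
    exact (((RegressionArray.measurable_betaHat hd hw he n).sub_const _).const_mul _).div_const _
      |>.aemeasurable
  · intro n hn l₀ l₁ hne hL h₀ h₁ Y0 Y1 hτ
    exact RegressionArray.sigmaDE_sq_div_eq_of_binary hK hd he hn hne hL h₀ h₁
      (τ := fun i ω => Y1 i ω - Y0 i ω) hτ

end
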